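/- Let $L$ be the Virasoro-like algebra: the complex Lie algebra with basis $D(\mathbf m)$ ($0\neq\mathbf m\in\Gamma=\mathbb Z^2$), $c_1,c_2$, where $c_1,c_2$ are central and, with $D(0)=0$, $\det(\mathbf m,\mathbf n)=m_1n_2-m_2n_1$ and $h(\mathbf m)=m_1c_1+m_2c_2$, $$[D(\mathbf m),D(\mathbf n)]=-\det(\mathbf m,\mathbf n)\,D(\mathbf m+\mathbf n)+\delta_{\mathbf m+\mathbf n,0}\,h(\mathbf m).$$ Fix a $\mathbb Z$-basis $\mathbf b_1,\mathbf b_2$ of $\Gamma$ and grade $L=\bigoplus_{j\in\mathbb Z}L_j$ by $L_j=\langle D(j\mathbf b_1+m\mathbf b_2): m\in\mathbb Z\rangle\oplus\delta_{j,0}\langle c_1,c_2\rangle$; put $L_+=\bigoplus_{j>0}L_j$ and $L_-=\bigoplus_{j<0}L_j$. A $\mathbb Z$-graded $L$-module is an $L$-module $V=\bigoplus_{n\in\mathbb Z}V_n$ with $L_mV_n\subseteq V_{m+n}$. It is in $\mathcal O_{\mathbb Z}$ if it is irreducible as a graded module (it is nonzero and has no graded submodules other than $0$ and itself) and every $V_n$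 is finite dimensional. A linear function $\psi\neq0$ on $L_0$ is called exp-polynomial if $\psi(h(\mathbf b_2))=0$ and there are polynomials $p_1,\dots,p_r\in\mathbb C[x]$ and $\alpha_1,\dots,\alpha_r\in\mathbb C\setminus\{0\}$ with $$\psi(D(k\mathbf b_2))=\frac1k\sum_{i=1}^r p_i(k)\alpha_i^k\quad(0\neq k\in\mathbb Z),\qquad \psi(h(\mathbf b_1))=-\det(\mathbf b_1,\mathbf b_2)\sum_{i=1}^r p_i(0).$$ For a linear $\psi$ on $L_0$ with $\psi(h(\mathbf b_2))=0$, let $\mathbb Cv_0$ be the one-dimensional $(L_0+L_\pm)$-module with $L_\pm v_0=0$ and $xv_0=\psi(x)v_0$ for $x\in L_0$, let $\overline V^{\pm}(\psi)=U(L)\otimes_{U(L_0+L_\pm)}\mathbb Cv_0$, graded so that $v_0$ has degree $0$, and let $\widehat V^{\pm}(\psi)$ be the quotient of $\overline V^{\pm}(\psi)$ by its largest proper graded submodule. Let $V$ be a nonzero $\mathbb Z$-graded $L$-module on which some element of the center of $L$ acts as a nonzero scalar. Then $V\in\mathcal O_{\mathbb Z}$ if and only if there is an exp-polynomial function $\psi$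 on $L_0$ such that $V\simeq\widehat V^{+}(\psi)$ or $V\simeq\widehat V^{-}(\psi)$ as $L$-modules. Moreover, if $V\in\mathcal O_{\mathbb Z}$, then $V$ has no submodules at all, graded or not, other than $0$ and $V$. -/

import Mathlib

/-- Determinant of two elements of `Γ = ℤ²`. -/
def gdet (m n : ℤ × ℤ) : ℤ := m.1 * n.2 - m.2 * n.1

/-- Underlying space of the Virasoro-like algebra: the first component has basis `D(m)`,
`0 ≠ m ∈ ℤ²`, the second component is spanned by the central elements `c₁ = (1, 0)` and
`c₂ = (0, 1)`. -/
def VirLike : Type := ({m : ℤ × ℤ // m ≠ 0} →₀ ℂ) × (ℂ × ℂ)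

namespace VirLike

noncomputable instance : AddCommGroup VirLike :=
  inferInstanceAs (AddCommGroup (({m : ℤ × ℤ // m ≠ 0} →₀ ℂ) × (ℂ × ℂ)))

noncomputable instance : Module ℂ VirLike :=
  inferInstanceAs (Module ℂ (({m : ℤ × ℤ // m ≠ 0} →₀ ℂ) × (ℂ × ℂ)))

/-- The inclusion of the span of the `D(m)`. -/
noncomputable def inclD : ({m : ℤ × ℤ // m ≠ 0} →₀ ℂ) →ₗ[ℂ] VirLike :=
  LinearMap.inl ℂ ({m : ℤ × ℤ // m ≠ 0} →₀ ℂ) (ℂ × ℂ)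

/-- The inclusion of `⟨c₁, c₂⟩`. -/
noncomputable def inclC : (ℂ × ℂ) →ₗ[ℂ] VirLike :=
  LinearMap.inr ℂ ({m : ℤ × ℤ // m ≠ 0} →₀ ℂ) (ℂ × ℂ)

/-- The element `D(m)`, with the convention `D(0) = 0`. -/
noncomputable def D (m : ℤ × ℤ) : VirLike :=
  if hm : m ≠ 0 then inclD (Finsupp.single ⟨m, hm⟩ 1) else 0

/-- The central element `u c₁ + v c₂`. -/
noncomputable def cen (u v : ℂ) : VirLike := inclC (u, v)

/-- `h(m) = m₁ c₁ + m₂ c₂`. -/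
noncomputable def h (m : ℤ × ℤ) : VirLike := cen (m.1 : ℂ) (m.2 : ℂ)

/-- The bracket of `D(m)` and `D(n)`. -/
noncomputable def brD (m n : ℤ × ℤ) : VirLike :=
  (-(gdet m n : ℂ)) • D (m + n) + if m + n = 0 then h m else 0

/-- Coordinates along the elements `D(m)`; its kernel is `⟨c₁, c₂⟩`. -/
noncomputable def coordD : VirLike →ₗ[ℂ] ({m : ℤ × ℤ // m ≠ 0} →₀ ℂ) :=
  LinearMap.fst ℂ ({m : ℤ × ℤ // m ≠ 0} →₀ ℂ) (ℂ × ℂ)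

/-- The bilinear bracket for which `c₁`, `c₂` are central and `[D(m), D(n)] = brD m n`. -/
noncomputable def br : VirLike →ₗ[ℂ] VirLike →ₗ[ℂ] VirLike :=
  (Finsupp.linearCombination ℂ fun m : {m : ℤ × ℤ // m ≠ 0} =>
    Finsupp.linearCombination ℂ fun n : {m : ℤ × ℤ // m ≠ 0} => brD m.1 n.1).compl₁₂
      coordD coordD

theorem coordD_cen (u v : ℂ) : coordD (cen u v) = 0 := rfl

theorem D_coe (m : {m : ℤ × ℤ // m ≠ 0}) : D m.1 = inclD (Finsupp.single m 1) :=
  dif_pos m.2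

theorem coordD_D (m : {m : ℤ × ℤ // m ≠ 0}) : coordD (D m.1) = Finsupp.single m 1 := by
  rw [D_coe]; rfl

theorem D_zero : D 0 = 0 := by simp [D]

theorem h_zero : h 0 = 0 := by
  simp only [h, cen, Prod.fst_zero, Prod.snd_zero, Int.cast_zero]; exact map_zero inclC

theorem brD_zero_left (n : ℤ × ℤ) : brD 0 n = 0 := by
  simp [brD, gdet, h_zero]

theorem brD_zero_right (n : ℤ × ℤ) : brD n 0 = 0 := by
  by_cases hn : n = 0
  · subst hn; exact brD_zero_left 0
  · simp [brD, gdet, hn]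

theorem br_D_D (m n : ℤ × ℤ) : br (D m) (D n) = brD m n := by
  by_cases hm : m = 0
  · subst hm; simp [D_zero, brD_zero_left]
  by_cases hn : n = 0
  · subst hn; simp [D_zero, brD_zero_right]
  simp [br, coordD_D ⟨m, hm⟩, coordD_D ⟨n, hn⟩]

theorem br_cen_left (u v : ℂ) (y : VirLike) : br (cen u v) y = 0 := by
  simp [br, coordD_cen]

theorem br_cen_right (u v : ℂ) (x : VirLike) : br x (cen u v) = 0 := by
  simp [br, coordD_cen]

/-- Every element is a combination of the `D(m)` and of central elements. -/
theorem induct {P : VirLike → Prop} (hadd : ∀ x y, P x → P y → P (x + y))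
    (hsmul : ∀ (t : ℂ) x, P x → P (t • x)) (hD : ∀ m, P (D m)) (hc : ∀ u v, P (cen u v))
    (x : VirLike) : P x := by
  have key : ∀ f, P (inclD f) := by
    intro f
    induction f using Finsupp.induction_linear with
    | zero => rw [map_zero, ← map_zero inclC]; exact hc 0 0
    | add f g hf hg => rw [map_add]; exact hadd _ _ hf hg
    | single m t =>
      have e : Finsupp.single m t = t • Finsupp.single m (1 : ℂ) := by simp
      rw [e, map_smul, ← D_coe]
      exact hsmul t _ (hD m.1)
  have e : x = inclD x.1 + cen x.2.1 x.2.2 := by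
    exact Prod.ext (add_zero x.1).symm (zero_add x.2).symm
  rw [e]
  exact hadd _ _ (key _) (hc _ _)

theorem h_add (m n : ℤ × ℤ) : h (m + n) = h m + h n := by
  simp only [h, cen, ← map_add]; simp

theorem h_neg (m : ℤ × ℤ) : h (-m) = -h m := by
  simp only [h, cen, ← map_neg]; simp

theorem brD_skew (m n : ℤ × ℤ) : brD m n = -brD n m := by
  unfold brD
  rw [add_comm n m, neg_add, ← neg_smul]
  congr 1
  · congr 1; simp only [gdet]; push_cast; ring
  · split_ifs with hmn
    · rw [eq_neg_of_add_eq_zero_left hmn, h_neg]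
    · simp

theorem br_skew (x y : VirLike) : br x y = -br y x := by
  induction x using induct with
  | hadd x x' hx hx' => simp [hx, hx']; abel
  | hsmul t x hx => simp [hx]
  | hc u v => simp [br_cen_left, br_cen_right]
  | hD m =>
    induction y using induct with
    | hadd y y' hx hx' => simp [hx, hx']; abel
    | hsmul t y hx => simp [hx]
    | hc u v => simp [br_cen_left, br_cen_right]
    | hD n => rw [br_D_D, br_D_D, brD_skew]

theorem br_self (x : VirLike) : br x x = 0 := by
  have := br_skew x x
  have h2 : (2 : ℂ) • br x x = 0 := by rw [two_smul]; nth_rewrite 1 [this]; simp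
  exact (smul_eq_zero.mp h2).resolve_left two_ne_zero

theorem br_h_left (m : ℤ × ℤ) (y : VirLike) : br (h m) y = 0 := br_cen_left _ _ y

theorem br_h_right (m : ℤ × ℤ) (y : VirLike) : br y (h m) = 0 := br_cen_right _ _ y

theorem br_brD_left (m n p : ℤ × ℤ) :
    br (brD m n) (D p) = (-(gdet m n : ℂ)) • brD (m + n) p := by
  have : br (if m + n = 0 then h m else 0) (D p) = 0 := by
    split_ifs
    · exact br_h_left _ _
    · simp
  rw [brD, map_add, LinearMap.add_apply, map_smul, LinearMap.smul_apply, br_D_D, this, add_zero]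

theorem br_brD_right (m n p : ℤ × ℤ) :
    br (D p) (brD m n) = (-(gdet m n : ℂ)) • brD p (m + n) := by
  have : br (D p) (if m + n = 0 then h m else 0) = 0 := by
    split_ifs
    · exact br_h_right _ _
    · simp
  rw [brD, map_add, map_smul, br_D_D, this, add_zero]

theorem br_jacobi (x y z : VirLike) : br x (br y z) = br (br x y) z + br y (br x z) := by
  induction x using induct with
  | hadd x x' hx hx' => simp only [map_add, LinearMap.add_apply, hx, hx']; abel
  | hsmul t x hx => simp only [map_smul, LinearMap.smul_apply, hx, smul_add]
  | hc u v => simp [br_cen_left]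
  | hD m =>
  induction y using induct with
  | hadd x x' hx hx' => simp only [map_add, LinearMap.add_apply, hx, hx']; abel
  | hsmul t x hx => simp only [map_smul, LinearMap.smul_apply, hx, smul_add]
  | hc u v => simp [br_cen_left, br_cen_right]
  | hD n =>
  induction z using induct with
  | hadd x x' hx hx' => simp only [map_add, hx, hx']; abel
  | hsmul t x hx => simp only [map_smul, hx, smul_add]
  | hc u v => simp [br_cen_right]
  | hD p =>
  rw [br_D_D, br_D_D, br_D_D, br_brD_left, br_brD_right, br_brD_right]
  unfold brD
  have e1 : m + (n + p) = m + n + p := by abel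
  have e2 : n + (m + p) = m + n + p := by abel
  rw [e1, e2]
  simp only [smul_add, smul_smul]
  by_cases hs : m + n + p = 0
  · have hp : p = -(m + n) := (neg_eq_of_add_eq_zero_right hs).symm
    subst hp
    simp only [hs, if_true, D_zero, smul_zero, zero_add, h_add, smul_add]
    have c1 : gdet n (-(m + n)) = gdet m n := by simp [gdet]; ring
    have c2 : gdet m (-(m + n)) = -gdet m n := by simp [gdet]; ring
    rw [c1, c2]
    push_cast
    module
  · simp only [hs, if_false, smul_zero, add_zero, ← add_smul]
    congr 1
    simp only [gdet, Prod.fst_add, Prod.snd_add]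
    push_cast
    ring

noncomputable instance : LieRing VirLike where
  bracket x y := br x y
  add_lie x y z := by change br (x + y) z = br x z + br y z; simp
  lie_add x y z := by change br x (y + z) = br x y + br x z; simp
  lie_self x := br_self x
  leibniz_lie x y z := br_jacobi x y z

noncomputable instance : LieAlgebra ℂ VirLike where
  lie_smul t x y := by change br x (t • y) = t • br x y; simp

/-- The defining relations of the Virasoro-like algebra. -/
theorem lie_D_D (m n : ℤ × ℤ) :
    ⁅D m, D n⁆ = (-(gdet m n : ℂ)) • D (m + n) + if m + n = 0 then h m else 0 := br_D_D m n

theorem lie_cen (u v : ℂ) (x : VirLike) : ⁅cen u v, x⁆ = 0 := br_cen_left u v x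

/-! From here on `b = (b 0, b 1)` is a `ℤ`-basis `(b₁, b₂)` of `Γ = ℤ²`. -/

/-- The homogeneous component `L_j = ⟨D(j b₁ + m b₂) | m ∈ ℤ⟩ ⊕ δ_{j,0} ⟨c₁, c₂⟩`. -/
noncomputable def gr (b : Module.Basis (Fin 2) ℤ (ℤ × ℤ)) (j : ℤ) : Submodule ℂ VirLike :=
  Submodule.span ℂ (Set.range fun m : ℤ => D (j • b 0 + m • b 1)) ⊔
    (if j = 0 then Submodule.span ℂ {cen 1 0, cen 0 1} else ⊥)

theorem D_mem_gr_zero (b : Module.Basis (Fin 2) ℤ (ℤ × ℤ)) (k : ℤ) : D (k • b 1) ∈ gr b 0 :=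
  Submodule.mem_sup_left (Submodule.subset_span ⟨k, by simp⟩)

theorem h_mem_gr_zero (b : Module.Basis (Fin 2) ℤ (ℤ × ℤ)) (m : ℤ × ℤ) : h m ∈ gr b 0 := by
  refine Submodule.mem_sup_right ?_
  rw [if_pos rfl, Submodule.mem_span_pair]
  refine ⟨m.1, m.2, ?_⟩
  simp only [cen, h, ← map_smul, ← map_add]
  simp

section GradedModules

variable {V : Type*} [AddCommGroup V] [Module ℂ V] [LieRingModule VirLike V]
  [LieModule ℂ VirLike V]

/-- `V = ⊕ 𝓥 n` is a `ℤ`-graded `L`-module. -/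
structure IsZGraded (b : Module.Basis (Fin 2) ℤ (ℤ × ℤ)) (𝓥 : ℤ → Submodule ℂ V) : Prop where
  isInternal : DirectSum.IsInternal 𝓥
  lie_mem : ∀ (i j : ℤ), ∀ x ∈ gr b i, ∀ v ∈ 𝓥 j, ⁅x, v⁆ ∈ 𝓥 (i + j)

/-- The submodule `N` is graded: it is the sum of its intersections with the components. -/
def IsGradedSub (𝓥 : ℤ → Submodule ℂ V) (N : LieSubmodule ℂ VirLike V) : Prop :=
  N.toSubmodule ≤ ⨆ n : ℤ, N.toSubmodule ⊓ 𝓥 n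

/-- Irreducibility in the graded sense: `V ≠ 0`, and the only graded submodules are `0`, `V`. -/
def IsGradedIrreducible (𝓥 : ℤ → Submodule ℂ V) : Prop :=
  Nontrivial V ∧ ∀ N : LieSubmodule ℂ VirLike V, IsGradedSub 𝓥 N → N = ⊥ ∨ N = ⊤

/-- All homogeneous subspaces are finite dimensional. -/
def IsQuasiFinite (𝓥 : ℤ → Submodule ℂ V) : Prop := ∀ n : ℤ, FiniteDimensional ℂ (𝓥 n)

/-- Membership in `𝒪_ℤ`: the `ℤ`-graded module `V = ⊕ 𝓥 n` is irreducible (as a graded module)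
and quasi-finite. -/
def InOZ (b : Module.Basis (Fin 2) ℤ (ℤ × ℤ)) (𝓥 : ℤ → Submodule ℂ V) : Prop :=
  IsZGraded b 𝓥 ∧ IsGradedIrreducible 𝓥 ∧ IsQuasiFinite 𝓥

end GradedModules

/-- The defining relation of `U(L)`. -/
theorem ι_lie (x y : VirLike) : UniversalEnvelopingAlgebra.ι ℂ ⁅x, y⁆ =
    UniversalEnvelopingAlgebra.ι ℂ x * UniversalEnvelopingAlgebra.ι ℂ y -
      UniversalEnvelopingAlgebra.ι ℂ y * UniversalEnvelopingAlgebra.ι ℂ x := by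
  let _ := LieRing.ofAssociativeRing (A := UniversalEnvelopingAlgebra ℂ VirLike)
  rw [LieHom.map_lie, LieRing.of_associative_ring_bracket]

/-- Left ideal of `U(L)` generated by the `L_j` with `s j > 0` and by `x - ψ(x)`, `x ∈ L_0`. -/
noncomputable def vermaIdeal (b : Module.Basis (Fin 2) ℤ (ℤ × ℤ)) (s : ℤˣ)
    (ψ : gr b 0 →ₗ[ℂ] ℂ) : Ideal (UniversalEnvelopingAlgebra ℂ VirLike) :=
  Ideal.span
    ({u | ∃ j : ℤ, 0 < (s : ℤ) * j ∧ ∃ x ∈ gr b j, u = UniversalEnvelopingAlgebra.ι ℂ x} ∪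
     {u | ∃ x : gr b 0, u = UniversalEnvelopingAlgebra.ι ℂ (x : VirLike) -
        algebraMap ℂ (UniversalEnvelopingAlgebra ℂ VirLike) (ψ x)})

/-- The induced module `U(L) ⊗_{U(L_0 + L_±)} ℂ v₀`, with the sign `s = ±1`, on which `L_±` kills
`v₀` and `x v₀ = ψ(x) v₀` for `x ∈ L_0`; it is realized as the quotient of `U(L)` by the left ideal
annihilating `v₀`. It is used only for `ψ(h(b₂)) = 0`. -/
def Verma (b : Module.Basis (Fin 2) ℤ (ℤ × ℤ)) (s : ℤˣ) (ψ : gr b 0 →ₗ[ℂ] ℂ) : Type :=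
  UniversalEnvelopingAlgebra ℂ VirLike ⧸ vermaIdeal b s ψ

section Verma

variable (b : Module.Basis (Fin 2) ℤ (ℤ × ℤ)) (s : ℤˣ) (ψ : gr b 0 →ₗ[ℂ] ℂ)

noncomputable instance : AddCommGroup (Verma b s ψ) :=
  inferInstanceAs (AddCommGroup (UniversalEnvelopingAlgebra ℂ VirLike ⧸ vermaIdeal b s ψ))

noncomputable instance : Module (UniversalEnvelopingAlgebra ℂ VirLike) (Verma b s ψ) :=
  inferInstanceAs (Module (UniversalEnvelopingAlgebra ℂ VirLike)
    (UniversalEnvelopingAlgebra ℂ VirLike ⧸ vermaIdeal b s ψ))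

noncomputable instance : Module ℂ (Verma b s ψ) :=
  inferInstanceAs (Module ℂ (UniversalEnvelopingAlgebra ℂ VirLike ⧸ vermaIdeal b s ψ))

instance : IsScalarTower ℂ (UniversalEnvelopingAlgebra ℂ VirLike) (Verma b s ψ) :=
  inferInstanceAs (IsScalarTower ℂ (UniversalEnvelopingAlgebra ℂ VirLike)
    (UniversalEnvelopingAlgebra ℂ VirLike ⧸ vermaIdeal b s ψ))

/-- `L` acts through `L → U(L)`. -/
noncomputable instance : LieRingModule VirLike (Verma b s ψ) where
  bracket x v := UniversalEnvelopingAlgebra.ι ℂ x • v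
  add_lie x y v := by
    change UniversalEnvelopingAlgebra.ι ℂ (x + y) • v = _
    rw [map_add, add_smul]
  lie_add x v w := smul_add _ v w
  leibniz_lie x y v := by
    change UniversalEnvelopingAlgebra.ι ℂ x • UniversalEnvelopingAlgebra.ι ℂ y • v =
      UniversalEnvelopingAlgebra.ι ℂ ⁅x, y⁆ • v +
        UniversalEnvelopingAlgebra.ι ℂ y • UniversalEnvelopingAlgebra.ι ℂ x • v
    rw [ι_lie, sub_smul, mul_smul, mul_smul]
    abel

noncomputable instance : LieModule ℂ VirLike (Verma b s ψ) where
  smul_lie t x v := by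
    change UniversalEnvelopingAlgebra.ι ℂ (t • x) • v = t • UniversalEnvelopingAlgebra.ι ℂ x • v
    rw [map_smul, smul_assoc]
  lie_smul t x v := by
    change UniversalEnvelopingAlgebra.ι ℂ x • t • v = t • UniversalEnvelopingAlgebra.ι ℂ x • v
    exact (smul_algebra_smul_comm t _ v)

/-- The generator `v₀`. -/
noncomputable def v0 : Verma b s ψ :=
  Submodule.Quotient.mk (p := vermaIdeal b s ψ) (1 : UniversalEnvelopingAlgebra ℂ VirLike)

/-- The grading of the induced module in which `v₀` has degree `0`: the degree `n` component is
spanned by all `x₁ ⋯ x_k v₀` with `x_i ∈ L_{d_i}` and `d₁ + ⋯ + d_k = n`. -/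
noncomputable def vermaGr (n : ℤ) : Submodule ℂ (Verma b s ψ) :=
  Submodule.span ℂ {w | ∃ l : List (ℤ × VirLike), (∀ p ∈ l, p.2 ∈ gr b p.1) ∧
    (l.map Prod.fst).sum = n ∧ w = l.foldr (fun p v => ⁅p.2, v⁆) (v0 b s ψ)}

/-- The maximal proper graded submodule `J`: the sum of all proper graded submodules. -/
noncomputable def vermaRad : LieSubmodule ℂ VirLike (Verma b s ψ) :=
  sSup {N | N ≠ ⊤ ∧ IsGradedSub (vermaGr b s ψ) N}

/-- The irreducible module obtained from the induced module by dividing out `J`. -/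
abbrev IrrWt : Type := Verma b s ψ ⧸ vermaRad b s ψ

end Verma

/-- The irreducible highest weight module `V̂⁺(ψ)`. -/
abbrev VhatPlus (b : Module.Basis (Fin 2) ℤ (ℤ × ℤ)) (ψ : gr b 0 →ₗ[ℂ] ℂ) : Type := IrrWt b 1 ψ

/-- The irreducible lowest weight module `V̂⁻(ψ)`. -/
abbrev VhatMinus (b : Module.Basis (Fin 2) ℤ (ℤ × ℤ)) (ψ : gr b 0 →ₗ[ℂ] ℂ) : Type :=
  IrrWt b (-1) ψ

/-- Exp-polynomial functions over `L_0`. The polynomial `p i` has coefficients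
`b_{i0}, b_{i1}, …`. -/
def IsExpPoly (b : Module.Basis (Fin 2) ℤ (ℤ × ℤ)) (ψ : gr b 0 →ₗ[ℂ] ℂ) : Prop :=
  ψ ≠ 0 ∧ ψ ⟨h (b 1), h_mem_gr_zero b (b 1)⟩ = 0 ∧
  ∃ (r : ℕ) (p : Fin r → Polynomial ℂ) (α : Fin r → ℂ), (∀ i, α i ≠ 0) ∧
    (∀ k : ℤ, k ≠ 0 → ψ ⟨D (k • b 1), D_mem_gr_zero b k⟩ =
      (∑ i, (p i).eval (k : ℂ) * α i ^ k) / (k : ℂ)) ∧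
    ψ ⟨h (b 0), h_mem_gr_zero b (b 0)⟩ = -(gdet (b 0) (b 1) : ℂ) * ∑ i, (p i).coeff 0

end VirLike

/-! ### Ladder operators for a Weyl pair. -/

section WeylPair

variable {V : Type*} [AddCommGroup V] [Module ℂ V] {A A' B : Module.End ℂ V} {θ : ℂ}

/-! Suppose `V` is graded irreducible and quasi-finite. Central elements act by scalars, and `h (b
1)` acts by zero because it is a commutator of two operators on a finite-dimensional component. The
nonzero level is therefore a scalar `κ ≠ 0` for `h (b 0)`, and the elements `D(k b₁)` form a
Heisenberg algebra with central charge `κ`.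

Boundedness of the degrees comes from counting. Take a joint eigenvector of the number operators of
modes 1 and `k`. If it were neither of Fock type for both modes nor of the opposite type for both,
moving up with one mode and back with the other would give infinitely many eigenvalues of the first
number operator in one finite-dimensional component (`VirLikeRep.type_dichotomy`). So every
component is the sum of a Fock part and an opposite part. The same count in degree 0 kills the Fock
part in high degrees and the opposite part in low ones. If some Fock part is nonzero, a vector in
the highest one is killed by all `D(k b₁ + m b₂)` with `k ≥ 2`. By irreducibility every vector is
then killed in large degrees, which excludes opposite vectors above that degree
(`VirLikeRep.bounded`). Hence the degrees are bounded on one side and an extreme component contains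
a joint eigenvector `v` of `L_0`.

Exp-polynomials enter through linear recurrences: a two-sided sequence is exp-polynomial exactly
when a nonzero polynomial in the shift kills it. One linear relation among the vectors `D(∓b₁ + m
b₂) v` in the next component, hit by every `D(±b₁ + k b₂)`, becomes a recurrence for `k ψ(D(k b₂))`,
whose value at `k = 0` encodes the level (`InOZ.isExpPoly`). Conversely, a recurrence for the weight
propagates down the module degree by degree, because commuting past a lowering operator only
multiplies by the square of the index. Recurrences leave finitely many generators in each step
(`VirLikeRep.finiteDimensional`).

The isomorphism with `IrrWt` is not assumed homogeneous. A nonzero homogeneous component of the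
image of `v0` is again singular of the same weight, so it gives a homogeneous copy of the quotient
(`exists_homogeneous_lift`). In that copy any nonzero vector can be raised to the extremal one by
acting on its component farthest from the top. This proves irreducibility among all submodules, not
only graded ones (`isIrreducible_of_equiv`). -/

theorem weyl_eigen_pow_lower (h : ∀ v, A (A' v) = A' (A v) + θ • v) {l : ℂ} {u : V}
    (hu : A' (A u) = l • u) (i : ℕ) : A' (A ((A ^ i) u)) = (l - i * θ) • (A ^ i) u := by
  induction i with
  | zero => simp [hu]
  | succ i ih =>
    have e := h (A ((A ^ i) u))
    rw [ih, map_smul] at e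
    rw [pow_succ', Module.End.mul_apply, ← sub_eq_iff_eq_add.mpr e, ← sub_smul]
    congr 1; push_cast; ring

/-- The eigenvalue of `A' A` drops by `θ` at each step, and `A` can only kill a vector once it has
reached 0. -/
theorem weyl_pow_lower_ne (h : ∀ v, A (A' v) = A' (A v) + θ • v) {l : ℂ} {u : V}
    (hu : A' (A u) = l • u) (h0 : u ≠ 0) (hl : ∀ i : ℕ, l ≠ i * θ) (i : ℕ) : (A ^ i) u ≠ 0 := by
  induction i with
  | zero => simpa
  | succ i ih =>
    intro e
    rw [pow_succ', Module.End.mul_apply] at e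
    have := weyl_eigen_pow_lower h hu i
    rw [e, map_zero] at this
    exact (smul_ne_zero (sub_ne_zero.mpr (hl i)) ih) this.symm

theorem weyl_eigen_pow_raise (h : ∀ v, A (A' v) = A' (A v) + θ • v) {l : ℂ} {u : V}
    (hu : A' (A u) = l • u) (i : ℕ) : A' (A ((A' ^ i) u)) = (l + i * θ) • (A' ^ i) u := by
  induction i with
  | zero => simp [hu]
  | succ i ih =>
    rw [pow_succ', Module.End.mul_apply, h, ih, ← add_smul, map_smul]
    congr 1; push_cast; ring

/-- `A'` can only kill an eigenvector on which `A A' = A' A + θ` is zero, that is, one of eigenvalue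
`-θ`. -/
theorem weyl_pow_raise_ne (h : ∀ v, A (A' v) = A' (A v) + θ • v) {l : ℂ} {u : V}
    (hu : A' (A u) = l • u) (h0 : u ≠ 0) (hl : ∀ i : ℕ, l ≠ -((i + 1) * θ)) (i : ℕ) :
    (A' ^ i) u ≠ 0 := by
  induction i with
  | zero => simpa
  | succ i ih =>
    intro e
    rw [pow_succ', Module.End.mul_apply] at e
    have := h ((A' ^ i) u)
    rw [weyl_eigen_pow_raise h hu i, ← add_smul, e, map_zero] at this
    refine (smul_ne_zero ?_ ih) this.symm
    intro e2
    exact hl i (by linear_combination e2)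

theorem eigen_pow_of_commute (hA : ∀ v, A (B v) = B (A v)) (hA' : ∀ v, A' (B v) = B (A' v))
    {l : ℂ} {u : V} (hu : A' (A u) = l • u) (i : ℕ) :
    A' (A ((B ^ i) u)) = l • (B ^ i) u := by
  induction i with
  | zero => simp [hu]
  | succ i ih => rw [pow_succ', Module.End.mul_apply, hA, hA', ih, map_smul]

/-- The number of distinct eigenvalues is bounded by the dimension. -/
theorem card_le_finrank_of_eigen {ι : Type*} [Fintype ι] (N : Module.End ℂ V)
    (W : Submodule ℂ V) [FiniteDimensional ℂ W] (z : ι → V) (l : ι → ℂ)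
    (hl : Function.Injective l) (hz : ∀ i, z i ∈ W) (h0 : ∀ i, z i ≠ 0)
    (he : ∀ i, N (z i) = l i • z i) : Fintype.card ι ≤ Module.finrank ℂ W := by
  have h1 : LinearIndependent ℂ z := Module.End.eigenvectors_linearIndependent' N l hl z
    fun i => ⟨Module.End.mem_eigenspace_iff.mpr (he i), h0 i⟩
  have h2 : LinearIndependent ℂ (fun i => (⟨z i, hz i⟩ : W)) :=
    LinearIndependent.of_comp W.subtype (by exact h1)
  exact h2.fintype_card_le_finrank

end WeylPair

/-- Operators `X i m` (standing for `D(i b₁ + m b₂)`) satisfying the relations of the Virasoro-like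
algebra with `h(b₁)` acting as `κ` and `h(b₂)` as `0`. -/
structure VirLikeRep {V : Type*} [AddCommGroup V] [Module ℂ V] (ε κ : ℂ)
    (X : ℤ → ℤ → Module.End ℂ V) : Prop where
  comm : ∀ i m j n v, X i m (X j n v) = X j n (X i m v)
    - (ε * (i * n - j * m)) • X (i + j) (m + n) v
    + (if i + j = 0 ∧ m + n = 0 then i * κ else 0) • v

/-- The operators shift the degrees of a grading. -/
def ShiftsDegrees {V : Type*} [AddCommGroup V] [Module ℂ V] (X : ℤ → ℤ → Module.End ℂ V)
    (𝓥 : ℤ → Submodule ℂ V) : Prop :=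
  ∀ i m n v, v ∈ 𝓥 n → X i m v ∈ 𝓥 (n + i)

/-! ### Heisenberg modes: Fock and opposite types, and boundedness of the degrees. -/

section Dichotomy

variable {V : Type*} [AddCommGroup V] [Module ℂ V] {ε κ : ℂ} {X : ℤ → ℤ → Module.End ℂ V}
  {𝓥 : ℤ → Submodule ℂ V}

theorem VirLikeRep.heis_comm (H : VirLikeRep ε κ X) {k l : ℤ} (hkl : k + l ≠ 0) (v : V) :
    X k 0 (X l 0 v) = X l 0 (X k 0 v) := by
  rw [H.comm]; simp [hkl]

theorem VirLikeRep.heis_weyl (H : VirLikeRep ε κ X) (k : ℤ) (v : V) :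
    X k 0 (X (-k) 0 v) = X (-k) 0 (X k 0 v) + (k * κ) • v := by
  rw [H.comm]; simp

theorem ShiftsDegrees.pow_mem (hX : ShiftsDegrees X 𝓥) (i m : ℤ) {n : ℤ} {v : V}
    (hv : v ∈ 𝓥 n) (p : ℕ) : (X i m ^ p) v ∈ 𝓥 (n + p * i) := by
  induction p with
  | zero => simpa
  | succ p ih =>
    rw [pow_succ', Module.End.mul_apply]
    have := hX i m _ _ ih
    convert this using 2; push_cast; ring

/-- The number operator of the first Heisenberg mode. -/
def heisN (X : ℤ → ℤ → Module.End ℂ V) : Module.End ℂ V := X (-1) 0 * X 1 0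

/-- The vectors `X 1 0 ^ (k i) (X (-k) 0 ^ i u)` all have the degree of `u`. They are nonzero by the
hypotheses on `l` and `l'`, and have distinct eigenvalues `l - k i κ`, since mode `k ≥ 2` commutes
with the first number operator. A finite-dimensional component cannot hold them all. -/
theorem VirLikeRep.not_lower_raise (H : VirLikeRep ε κ X) (hκ : κ ≠ 0) (hX : ShiftsDegrees X 𝓥)
    (hfin : ∀ n, FiniteDimensional ℂ (𝓥 n)) {n : ℤ} {u : V} (hu : u ∈ 𝓥 n) (h0 : u ≠ 0)
    {k : ℕ} (hk : 2 ≤ k) {l l' : ℂ} (h1 : X (-1) 0 (X 1 0 u) = l • u)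
    (h2 : X (-k) 0 (X k 0 u) = l' • u) (hl : ∀ i : ℕ, l ≠ i * κ)
    (hl' : ∀ i : ℕ, l' ≠ -((i + 1) * (k * κ))) : False := by
  have W1 : ∀ v, X 1 0 (X (-1) 0 v) = X (-1) 0 (X 1 0 v) + κ • v := fun v => by
    simpa using H.heis_weyl 1 v
  have Wk := H.heis_weyl (k : ℤ)
  have key : ∀ i : ℕ, X (-1) 0 (X 1 0 ((X (-k) 0 ^ i) u)) = l • (X (-k) 0 ^ i) u := fun i =>
    eigen_pow_of_commute (H.heis_comm (by omega)) (H.heis_comm (by omega)) h1 i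
  have hne : ∀ i : ℕ, (X (-k) 0 ^ i) u ≠ 0 := fun i =>
    weyl_pow_raise_ne Wk h2 h0 (by simpa using hl') i
  have := card_le_finrank_of_eigen (ι := Fin (Module.finrank ℂ (𝓥 n) + 1)) (heisN X) (𝓥 n)
    (fun i => (X 1 0 ^ (k * (i : ℕ))) ((X (-k) 0 ^ (i : ℕ)) u))
    (fun i => l - ((k * (i : ℕ) : ℕ) : ℂ) * κ) ?_ ?_ ?_ ?_
  · simp at this
  · intro i j hij
    have h3 : ((k * (i : ℕ) : ℕ) : ℂ) = ((k * (j : ℕ) : ℕ) : ℂ) :=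
      mul_right_cancel₀ hκ (by linear_combination -hij)
    have h4 : k * (i : ℕ) = k * j := by exact_mod_cast h3
    exact Fin.ext (Nat.eq_of_mul_eq_mul_left (by omega) h4)
  · intro i
    have := hX.pow_mem 1 0 (hX.pow_mem (-k) 0 hu i) (k * i)
    convert this using 2; push_cast; ring
  · exact fun i => weyl_pow_lower_ne W1 (key i) (hne i) hl _
  · exact fun i => weyl_eigen_pow_lower W1 (key i) _

/-- Mirror image of `VirLikeRep.not_lower_raise`, with `X k 0` and `X (-1) 0` in place of `X (-k) 0`
and `X 1 0`. -/
theorem VirLikeRep.not_raise_lower (H : VirLikeRep ε κ X) (hκ : κ ≠ 0) (hX : ShiftsDegrees X 𝓥)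
    (hfin : ∀ n, FiniteDimensional ℂ (𝓥 n)) {n : ℤ} {u : V} (hu : u ∈ 𝓥 n) (h0 : u ≠ 0)
    {k : ℕ} (hk : 2 ≤ k) {l l' : ℂ} (h1 : X (-1) 0 (X 1 0 u) = l • u)
    (h2 : X (-k) 0 (X k 0 u) = l' • u) (hl : ∀ i : ℕ, l ≠ -((i + 1) * κ))
    (hl' : ∀ i : ℕ, l' ≠ i * (k * κ)) : False := by
  have W1 : ∀ v, X 1 0 (X (-1) 0 v) = X (-1) 0 (X 1 0 v) + κ • v := fun v => by
    simpa using H.heis_weyl 1 v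
  have Wk := H.heis_weyl (k : ℤ)
  have key : ∀ i : ℕ, X (-1) 0 (X 1 0 ((X k 0 ^ i) u)) = l • (X k 0 ^ i) u := fun i =>
    eigen_pow_of_commute (H.heis_comm (by omega)) (H.heis_comm (by omega)) h1 i
  have hne : ∀ i : ℕ, (X k 0 ^ i) u ≠ 0 := fun i =>
    weyl_pow_lower_ne Wk h2 h0 (by simpa using hl') i
  have := card_le_finrank_of_eigen (ι := Fin (Module.finrank ℂ (𝓥 n) + 1)) (heisN X) (𝓥 n)
    (fun i => (X (-1) 0 ^ (k * (i : ℕ))) ((X k 0 ^ (i : ℕ)) u))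
    (fun i => l + ((k * (i : ℕ) : ℕ) : ℂ) * κ) ?_ ?_ ?_ ?_
  · simp at this
  · intro i j hij
    have h3 : ((k * (i : ℕ) : ℕ) : ℂ) = ((k * (j : ℕ) : ℕ) : ℂ) :=
      mul_right_cancel₀ hκ (by linear_combination hij)
    have h4 : k * (i : ℕ) = k * j := by exact_mod_cast h3
    exact Fin.ext (Nat.eq_of_mul_eq_mul_left (by omega) h4)
  · intro i
    have := hX.pow_mem (-1) 0 (hX.pow_mem k 0 hu i) (k * i)
    convert this using 2; push_cast; ring
  · exact fun i => weyl_pow_raise_ne W1 (key i) (hne i) hl _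
  · exact fun i => weyl_eigen_pow_raise W1 (key i) _

theorem nat_mul_ne_neg {κ : ℂ} (hκ : κ ≠ 0) (i j : ℕ) : (i : ℂ) * κ ≠ -((j + 1) * κ) := by
  intro h
  have h3 : (i : ℂ) + j + 1 = 0 := mul_right_cancel₀ hκ (by linear_combination h)
  have : i + j + 1 = 0 := by exact_mod_cast h3
  omega

/-- A joint eigenvector of two number operators is either a vacuum-type vector for both or for
neither. -/
theorem VirLikeRep.type_dichotomy (H : VirLikeRep ε κ X) (hκ : κ ≠ 0) (hX : ShiftsDegrees X 𝓥)
    (hfin : ∀ n, FiniteDimensional ℂ (𝓥 n)) {n : ℤ} {u : V} (hu : u ∈ 𝓥 n) (h0 : u ≠ 0)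
    {k : ℕ} (hk : 2 ≤ k) {l l' : ℂ} (h1 : X (-1) 0 (X 1 0 u) = l • u)
    (h2 : X (-k) 0 (X k 0 u) = l' • u) :
    ((∃ i : ℕ, l = i * κ) ∧ ∃ i : ℕ, l' = i * (k * κ)) ∨
    ((∃ i : ℕ, l = -((i + 1) * κ)) ∧ ∃ i : ℕ, l' = -((i + 1) * (k * κ))) := by
  have c1 := H.not_lower_raise hκ hX hfin hu h0 hk h1 h2
  have c2 := H.not_raise_lower hκ hX hfin hu h0 hk h1 h2
  have hk0 : (k * κ : ℂ) ≠ 0 := mul_ne_zero (by exact_mod_cast (by omega : k ≠ 0)) hκ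
  by_cases p : ∃ i : ℕ, l = i * κ
  · left
    refine ⟨p, ?_⟩
    by_contra! q
    obtain ⟨i, rfl⟩ := p
    exact c2 (fun j => nat_mul_ne_neg hκ i j) q
  · right
    push Not at p
    have q : ∃ i : ℕ, l' = -((i + 1) * (k * κ)) := by
      by_contra! q; exact c1 p q
    refine ⟨?_, q⟩
    by_contra! r
    obtain ⟨i, rfl⟩ := q
    exact c2 r (fun j => (nat_mul_ne_neg hk0 j i).symm)

theorem exists_eigen_of_mapsTo (W : Submodule ℂ V) [FiniteDimensional ℂ W] (hW : W ≠ ⊥)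
    (N : Module.End ℂ V) (hN : ∀ v ∈ W, N v ∈ W) : ∃ l : ℂ, ∃ u ∈ W, u ≠ 0 ∧ N u = l • u := by
  have : Nontrivial W := Submodule.nontrivial_iff_ne_bot.mpr hW
  obtain ⟨l, hl⟩ := Module.End.exists_eigenvalue (LinearMap.restrict N hN)
  obtain ⟨u, hu⟩ := hl.exists_hasEigenvector
  refine ⟨l, u, u.2, fun h => hu.2 (Subtype.ext h), ?_⟩
  have := congrArg Subtype.val hu.apply_eq_smul
  simpa using this

/-- The last nonzero power of `N - l` applied to a generalized eigenvector is an eigenvector, and it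
stays in the invariant subspace `W`. -/
theorem exists_eigen_of_inf_maxGenEigenspace {W : Submodule ℂ V} {N : Module.End ℂ V} {l : ℂ}
    (hN : ∀ v ∈ W, N v ∈ W) (h : W ⊓ N.maxGenEigenspace l ≠ ⊥) :
    W ⊓ N.eigenspace l ≠ ⊥ := by
  obtain ⟨u, hu, h0⟩ := Submodule.exists_mem_ne_zero_of_ne_bot h
  obtain ⟨k, hk⟩ := (Module.End.mem_maxGenEigenspace _ _ _).mp hu.2
  classical
  have hex : ∃ k : ℕ, ((N - l • (1 : Module.End ℂ V)) ^ k) u = 0 := ⟨k, hk⟩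
  obtain ⟨j, hj⟩ : ∃ j, Nat.find hex = j + 1 := Nat.exists_eq_succ_of_ne_zero fun h => by
    have := Nat.find_spec hex; rw [h] at this; exact h0 (by simpa using this)
  have hW : ∀ i : ℕ, ((N - l • (1 : Module.End ℂ V)) ^ i) u ∈ W := by
    intro i
    induction i with
    | zero => simpa using hu.1
    | succ i ih =>
      rw [pow_succ', Module.End.mul_apply]
      exact W.sub_mem (hN _ ih) (W.smul_mem l ih)
  refine fun hb => Nat.find_min hex (m := j) (by omega) ?_
  rw [← Submodule.mem_bot ℂ, ← hb]
  refine ⟨hW j, ?_⟩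
  have := Nat.find_spec hex
  rw [hj, pow_succ', Module.End.mul_apply] at this
  rw [SetLike.mem_coe, Module.End.mem_eigenspace_iff]
  exact sub_eq_zero.mp (by simpa using this)

theorem le_iSup_inf_maxGenEigenspace (W : Submodule ℂ V) [FiniteDimensional ℂ W]
    (N : Module.End ℂ V) (hN : ∀ v ∈ W, N v ∈ W) : W ≤ ⨆ l : ℂ, W ⊓ N.maxGenEigenspace l := by
  have h1 := Module.End.iSup_maxGenEigenspace_eq_top (LinearMap.restrict N hN)
  calc W = (⊤ : Submodule ℂ W).map W.subtype := by simp
    _ = ⨆ l : ℂ, (Module.End.maxGenEigenspace (LinearMap.restrict N hN) l).map W.subtype := by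
        rw [← h1, Submodule.map_iSup]
    _ ≤ _ := by
        refine iSup_mono fun l => ?_
        rintro _ ⟨x, hx, rfl⟩
        refine ⟨x.2, ?_⟩
        have := Module.End.genEigenspace_restrict N W ⊤ l hN
        have h3 : x ∈ Module.End.genEigenspace (LinearMap.restrict N hN) l ⊤ := hx
        rw [this] at h3
        exact h3

/-- The part of degree `n` on which the first number operator has eigenvalues of vacuum type. -/
def heisPos (κ : ℂ) (X : ℤ → ℤ → Module.End ℂ V) (𝓥 : ℤ → Submodule ℂ V) (n : ℤ) :
    Submodule ℂ V :=
  ⨆ i : ℕ, 𝓥 n ⊓ (heisN X).maxGenEigenspace (i * κ)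

/-- The part of degree `n` on which the first number operator has eigenvalues of the opposite
type. -/
def heisNeg (κ : ℂ) (X : ℤ → ℤ → Module.End ℂ V) (𝓥 : ℤ → Submodule ℂ V) (n : ℤ) :
    Submodule ℂ V :=
  ⨆ i : ℕ, 𝓥 n ⊓ (heisN X).maxGenEigenspace (-((i + 1) * κ))

theorem ShiftsDegrees.heisN_mem (hX : ShiftsDegrees X 𝓥) {n : ℤ} {v : V} (hv : v ∈ 𝓥 n) :
    heisN X v ∈ 𝓥 n := by
  have := hX (-1) 0 _ _ (hX 1 0 _ _ hv)
  rwa [add_neg_cancel_right] at this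

theorem heisPos_le (n : ℤ) : heisPos κ X 𝓥 n ≤ 𝓥 n := iSup_le fun _ => inf_le_left

theorem VirLikeRep.exists_joint_eigen (H : VirLikeRep ε κ X) (hX : ShiftsDegrees X 𝓥)
    (hfin : ∀ n, FiniteDimensional ℂ (𝓥 n)) {n : ℤ} {l : ℂ}
    (h : 𝓥 n ⊓ (heisN X).maxGenEigenspace l ≠ ⊥) {k : ℕ} (hk : 2 ≤ k) :
    ∃ u ∈ 𝓥 n, u ≠ 0 ∧ X (-1) 0 (X 1 0 u) = l • u ∧ ∃ l' : ℂ, X (-k) 0 (X k 0 u) = l' • u := by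
  have h1 := exists_eigen_of_inf_maxGenEigenspace (fun v hv => hX.heisN_mem hv) h
  have : FiniteDimensional ℂ ↥(𝓥 n ⊓ (heisN X).eigenspace l) :=
    Submodule.finiteDimensional_of_le inf_le_left
  have h2 : ∀ v ∈ 𝓥 n ⊓ (heisN X).eigenspace l,
      (X (-k) 0 * X k 0) v ∈ 𝓥 n ⊓ (heisN X).eigenspace l := by
    rintro v ⟨hv, hv'⟩
    refine ⟨?_, ?_⟩
    · have := hX (-k) 0 _ _ (hX k 0 _ _ hv)
      rwa [add_neg_cancel_right] at this
    · have e : X (-1) 0 (X 1 0 v) = l • v := Module.End.mem_eigenspace_iff.mp hv'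
      rw [SetLike.mem_coe, Module.End.mem_eigenspace_iff]
      change X (-1) 0 (X 1 0 (X (-k) 0 (X k 0 v))) = l • X (-k) 0 (X k 0 v)
      rw [H.heis_comm (k := 1) (l := -k) (by omega), H.heis_comm (k := 1) (l := k) (by omega),
        H.heis_comm (k := -1) (l := -k) (by omega), H.heis_comm (k := -1) (l := k) (by omega), e,
        map_smul, map_smul]
  obtain ⟨l', u, hu, h0, he⟩ := exists_eigen_of_mapsTo _ h1 (X (-k) 0 * X k 0) h2
  exact ⟨u, hu.1, h0, Module.End.mem_eigenspace_iff.mp hu.2, l', he⟩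

theorem VirLikeRep.heis_sup (H : VirLikeRep ε κ X) (hκ : κ ≠ 0) (hX : ShiftsDegrees X 𝓥)
    (hfin : ∀ n, FiniteDimensional ℂ (𝓥 n)) (n : ℤ) :
    𝓥 n ≤ heisPos κ X 𝓥 n ⊔ heisNeg κ X 𝓥 n := by
  refine (le_iSup_inf_maxGenEigenspace (𝓥 n) (heisN X) fun v hv => hX.heisN_mem hv).trans ?_
  refine iSup_le fun l => ?_
  by_cases h : 𝓥 n ⊓ (heisN X).maxGenEigenspace l = ⊥
  · rw [h]; exact bot_le
  obtain ⟨u, hu, h0, h1, l', h2⟩ := H.exists_joint_eigen hX hfin h le_rfl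
  rcases H.type_dichotomy hκ hX hfin hu h0 le_rfl h1 h2 with ⟨⟨i, rfl⟩, -⟩ | ⟨⟨i, rfl⟩, -⟩
  · exact le_sup_of_le_left (le_iSup (fun i : ℕ => 𝓥 n ⊓ (heisN X).maxGenEigenspace (i * κ)) i)
  · exact le_sup_of_le_right
      (le_iSup (fun i : ℕ => 𝓥 n ⊓ (heisN X).maxGenEigenspace (-((i + 1) * κ))) i)

theorem VirLikeRep.exists_of_heisPos (H : VirLikeRep ε κ X) (hκ : κ ≠ 0) (hX : ShiftsDegrees X 𝓥)
    (hfin : ∀ n, FiniteDimensional ℂ (𝓥 n)) {n : ℤ} (h : heisPos κ X 𝓥 n ≠ ⊥)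
    {k : ℕ} (hk : 2 ≤ k) :
    ∃ u ∈ 𝓥 n, u ≠ 0 ∧ ∃ i j : ℕ, X (-1) 0 (X 1 0 u) = (i * κ) • u ∧
      X (-k) 0 (X k 0 u) = (j * (k * κ)) • u := by
  obtain ⟨i, hi⟩ : ∃ i : ℕ, 𝓥 n ⊓ (heisN X).maxGenEigenspace (i * κ) ≠ ⊥ := by
    by_contra! hc; exact h (by simp [heisPos, hc])
  obtain ⟨u, hu, h0, h1, l', h2⟩ := H.exists_joint_eigen hX hfin hi hk
  rcases H.type_dichotomy hκ hX hfin hu h0 hk h1 h2 with ⟨-, j, rfl⟩ | ⟨⟨j, hj⟩, -⟩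
  · exact ⟨u, hu, h0, i, j, h1, h2⟩
  · exact absurd hj (nat_mul_ne_neg hκ i j)

theorem VirLikeRep.exists_of_heisNeg (H : VirLikeRep ε κ X) (hκ : κ ≠ 0) (hX : ShiftsDegrees X 𝓥)
    (hfin : ∀ n, FiniteDimensional ℂ (𝓥 n)) {n : ℤ} (h : heisNeg κ X 𝓥 n ≠ ⊥) :
    ∃ u ∈ 𝓥 n, u ≠ 0 ∧ ∃ i : ℕ, X (-1) 0 (X 1 0 u) = (-((i + 1) * κ)) • u ∧
      ∀ k : ℕ, 2 ≤ k → ∀ l' : ℂ, X (-k) 0 (X k 0 u) = l' • u → ∃ j : ℕ, l' = -((j + 1) * (k * κ)) := by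
  obtain ⟨i, hi⟩ : ∃ i : ℕ, 𝓥 n ⊓ (heisN X).maxGenEigenspace (-((i + 1) * κ)) ≠ ⊥ := by
    by_contra! hc; exact h (by simp [heisNeg, hc])
  obtain ⟨u, hu, h0, h1, -⟩ := H.exists_joint_eigen hX hfin hi le_rfl
  refine ⟨u, hu, h0, i, h1, fun k hk l' h2 => ?_⟩
  rcases H.type_dichotomy hκ hX hfin hu h0 hk h1 h2 with ⟨⟨j, hj⟩, -⟩ | ⟨-, j, hj⟩
  · exact absurd hj.symm (nat_mul_ne_neg hκ j i)
  · exact ⟨j, hj⟩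

theorem VirLikeRep.exists_joint_of_heisNeg (H : VirLikeRep ε κ X) (hκ : κ ≠ 0)
    (hX : ShiftsDegrees X 𝓥) (hfin : ∀ n, FiniteDimensional ℂ (𝓥 n)) {n : ℤ}
    (h : heisNeg κ X 𝓥 n ≠ ⊥) :
    ∃ u ∈ 𝓥 n, u ≠ 0 ∧ ∃ i j : ℕ, X (-1) 0 (X 1 0 u) = (-((i + 1) * κ)) • u ∧
      X (-2) 0 (X 2 0 u) = (-((j + 1) * (2 * κ))) • u := by
  obtain ⟨i, hi⟩ : ∃ i : ℕ, 𝓥 n ⊓ (heisN X).maxGenEigenspace (-((i + 1) * κ)) ≠ ⊥ := by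
    by_contra! hc; exact h (by simp [heisNeg, hc])
  obtain ⟨u, hu, h0, h1, l', h2⟩ := H.exists_joint_eigen hX hfin hi le_rfl
  rcases H.type_dichotomy hκ hX hfin hu h0 le_rfl h1 h2 with ⟨⟨j, hj⟩, -⟩ | ⟨-, j, rfl⟩
  · exact absurd hj.symm (nat_mul_ne_neg hκ j i)
  · exact ⟨u, hu, h0, i, j, h1, by exact_mod_cast h2⟩

/-- Modes 1 and 2 never kill a vector of the opposite type. From degree `-s` the vectors `X 1 0 ^ (s
- 2p) (X 2 0 ^ p u)` land in degree 0 with distinct eigenvalues. The bound on `n` leaves room for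
one more value of `p` than `dim 𝓥 0`. -/
theorem VirLikeRep.heisNeg_eq_bot (H : VirLikeRep ε κ X) (hκ : κ ≠ 0)
    (hX : ShiftsDegrees X 𝓥) (hfin : ∀ n, FiniteDimensional ℂ (𝓥 n)) {n : ℤ}
    (hn : n < -(2 * Module.finrank ℂ (𝓥 0))) : heisNeg κ X 𝓥 n = ⊥ := by
  by_contra h
  obtain ⟨u, hu, h0, i, j, h1, h2⟩ := H.exists_joint_of_heisNeg hκ hX hfin h
  obtain ⟨s, hs⟩ : ∃ s : ℕ, n = -s := ⟨n.natAbs, by omega⟩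
  have W1 : ∀ v, X 1 0 (X (-1) 0 v) = X (-1) 0 (X 1 0 v) + κ • v := fun v => by
    simpa using H.heis_weyl 1 v
  have W2 : ∀ v, X 2 0 (X (-2) 0 v) = X (-2) 0 (X 2 0 v) + (2 * κ) • v := fun v => by
    simpa using H.heis_weyl 2 v
  have key := fun p => eigen_pow_of_commute (H.heis_comm (k := 1) (l := 2) (by omega))
    (H.heis_comm (k := -1) (l := 2) (by omega)) h1 p
  have hne := weyl_pow_lower_ne W2 h2 h0
    (fun p => (nat_mul_ne_neg (mul_ne_zero two_ne_zero hκ) p j).symm)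
  have := card_le_finrank_of_eigen (ι := Fin (Module.finrank ℂ (𝓥 0) + 1)) (heisN X) (𝓥 0)
    (fun p => (X 1 0 ^ (s - 2 * (p : ℕ))) ((X 2 0 ^ (p : ℕ)) u))
    (fun p => -((i + 1) * κ) - ((s - 2 * (p : ℕ) : ℕ) : ℂ) * κ) ?_ ?_ ?_ ?_
  · simp at this
  · intro p q hpq
    have h3 : ((s - 2 * (p : ℕ) : ℕ) : ℂ) = ((s - 2 * (q : ℕ) : ℕ) : ℂ) :=
      mul_right_cancel₀ hκ (by linear_combination -hpq)
    have h4 : s - 2 * (p : ℕ) = s - 2 * q := by exact_mod_cast h3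
    exact Fin.ext (by omega)
  · intro p
    have := hX.pow_mem 1 0 (hX.pow_mem 2 0 hu p) (s - 2 * p)
    convert this using 2; omega
  · exact fun p => weyl_pow_lower_ne W1 (key p) (hne p)
      (fun q => (nat_mul_ne_neg hκ q i).symm) _
  · exact fun p => weyl_eigen_pow_lower W1 (key p) _

/-- The same count with `X (-1) 0` and `X (-2) 0`, which never kill a vector of Fock type. -/
theorem VirLikeRep.heisPos_eq_bot (H : VirLikeRep ε κ X) (hκ : κ ≠ 0)
    (hX : ShiftsDegrees X 𝓥) (hfin : ∀ n, FiniteDimensional ℂ (𝓥 n)) {n : ℤ}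
    (hn : 2 * Module.finrank ℂ (𝓥 0) < n) : heisPos κ X 𝓥 n = ⊥ := by
  by_contra h
  obtain ⟨u, hu, h0, i, j, h1, h2⟩ := H.exists_of_heisPos hκ hX hfin h le_rfl
  obtain ⟨s, hs⟩ : ∃ s : ℕ, n = s := ⟨n.natAbs, by omega⟩
  have W1 : ∀ v, X 1 0 (X (-1) 0 v) = X (-1) 0 (X 1 0 v) + κ • v := fun v => by
    simpa using H.heis_weyl 1 v
  have W2 : ∀ v, X 2 0 (X (-2) 0 v) = X (-2) 0 (X 2 0 v) + (2 * κ) • v := fun v => by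
    simpa using H.heis_weyl 2 v
  have key := fun p => eigen_pow_of_commute (H.heis_comm (k := 1) (l := -2) (by omega))
    (H.heis_comm (k := -1) (l := -2) (by omega)) h1 p
  have hne := weyl_pow_raise_ne W2 (by exact_mod_cast h2) h0
    (fun p => (nat_mul_ne_neg (mul_ne_zero two_ne_zero hκ) j p))
  have := card_le_finrank_of_eigen (ι := Fin (Module.finrank ℂ (𝓥 0) + 1)) (heisN X) (𝓥 0)
    (fun p => (X (-1) 0 ^ (s - 2 * (p : ℕ))) ((X (-2) 0 ^ (p : ℕ)) u))
    (fun p => (i * κ) + ((s - 2 * (p : ℕ) : ℕ) : ℂ) * κ) ?_ ?_ ?_ ?_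
  · simp at this
  · intro p q hpq
    have h3 : ((s - 2 * (p : ℕ) : ℕ) : ℂ) = ((s - 2 * (q : ℕ) : ℕ) : ℂ) :=
      mul_right_cancel₀ hκ (by linear_combination hpq)
    have h4 : s - 2 * (p : ℕ) = s - 2 * q := by exact_mod_cast h3
    exact Fin.ext (by omega)
  · intro p
    have := hX.pow_mem (-1) 0 (hX.pow_mem (-2) 0 hu p) (s - 2 * p)
    convert this using 2; omega
  · exact fun p => weyl_pow_raise_ne W1 (key p) (hne p) (fun q => nat_mul_ne_neg hκ i q) _
  · exact fun p => weyl_eigen_pow_raise W1 (key p) _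

/-- Modes other than `±1` commute with the first number operator, so they move degrees without
mixing its generalized eigenspaces. -/
theorem VirLikeRep.heis_mem_inf (H : VirLikeRep ε κ X) (hX : ShiftsDegrees X 𝓥) {k : ℤ}
    (hk : 1 + k ≠ 0) (hk' : -1 + k ≠ 0) (n : ℤ) (l : ℂ) {v : V}
    (hv : v ∈ 𝓥 n ⊓ (heisN X).maxGenEigenspace l) :
    X k 0 v ∈ 𝓥 (n + k) ⊓ (heisN X).maxGenEigenspace l := by
  refine ⟨hX k 0 n v hv.1, ?_⟩
  refine Module.End.mapsTo_maxGenEigenspace_of_comm (f := heisN X) (g := X k 0) ?_ l hv.2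
  refine LinearMap.ext fun w => ?_
  change X (-1) 0 (X 1 0 (X k 0 w)) = X k 0 (X (-1) 0 (X 1 0 w))
  rw [H.heis_comm hk, H.heis_comm hk']

theorem VirLikeRep.heis_mem_heisPos (H : VirLikeRep ε κ X) (hX : ShiftsDegrees X 𝓥) {k : ℤ}
    (hk : 1 + k ≠ 0) (hk' : -1 + k ≠ 0) {n : ℤ} {v : V} (hv : v ∈ heisPos κ X 𝓥 n) :
    X k 0 v ∈ heisPos κ X 𝓥 (n + k) := by
  have : heisPos κ X 𝓥 n ≤ (heisPos κ X 𝓥 (n + k)).comap (X k 0) :=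
    iSup_le fun i w hw => Submodule.mem_iSup_of_mem i (H.heis_mem_inf hX hk hk' n _ hw)
  exact this hv

theorem VirLikeRep.heis_mem_heisNeg (H : VirLikeRep ε κ X) (hX : ShiftsDegrees X 𝓥) {k : ℤ}
    (hk : 1 + k ≠ 0) (hk' : -1 + k ≠ 0) {n : ℤ} {v : V} (hv : v ∈ heisNeg κ X 𝓥 n) :
    X k 0 v ∈ heisNeg κ X 𝓥 (n + k) := by
  have : heisNeg κ X 𝓥 n ≤ (heisNeg κ X 𝓥 (n + k)).comap (X k 0) :=
    iSup_le fun i w hw => Submodule.mem_iSup_of_mem i (H.heis_mem_inf hX hk hk' n _ hw)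
  exact this hv

/-- The vectors annihilated by all operators of large degree. -/
def eventuallyKilled (X : ℤ → ℤ → Module.End ℂ V) : Submodule ℂ V where
  carrier := {w | ∃ N : ℤ, ∀ k m, N ≤ k → X k m w = 0}
  zero_mem' := ⟨0, fun _ _ _ => map_zero _⟩
  add_mem' := by
    rintro v w ⟨N, hN⟩ ⟨M, hM⟩
    exact ⟨max N M, fun k m hk => by
      rw [map_add, hN k m ((le_max_left _ _).trans hk), hM k m ((le_max_right _ _).trans hk),
        add_zero]⟩
  smul_mem' := by
    rintro c w ⟨N, hN⟩
    exact ⟨N, fun k m hk => by rw [map_smul, hN k m hk, smul_zero]⟩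

theorem VirLikeRep.mem_eventuallyKilled (H : VirLikeRep ε κ X) (i m : ℤ) {w : V}
    (hw : w ∈ eventuallyKilled X) : X i m w ∈ eventuallyKilled X := by
  obtain ⟨N, hN⟩ := hw
  refine ⟨|N| + |i| + 1, fun k m' hk => ?_⟩
  have h1 := le_abs_self N
  have h2 := neg_abs_le i
  have h3 := abs_nonneg i
  have h4 := abs_nonneg N
  have : ¬ (k + i = 0 ∧ m' + m = 0) := by omega
  rw [H.comm, hN k m' (by omega), hN (k + i) _ (by omega), if_neg this]
  simp

/-- An irreducible quasi-finite module of nonzero level is bounded above or below. -/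
theorem VirLikeRep.bounded (H : VirLikeRep ε κ X) (hε : ε ≠ 0) (hκ : κ ≠ 0)
    (hX : ShiftsDegrees X 𝓥) (hfin : ∀ n, FiniteDimensional ℂ (𝓥 n))
    (hirr : ∀ n, ∀ v ∈ 𝓥 n, v ≠ 0 → ∀ T : Submodule ℂ V, v ∈ T →
      (∀ i m, ∀ w ∈ T, X i m w ∈ T) → T = ⊤) :
    (∃ N, ∀ n, N < n → 𝓥 n = ⊥) ∨ (∃ N, ∀ n, n < N → 𝓥 n = ⊥) := by
  by_cases hpos : ∀ n, heisPos κ X 𝓥 n = ⊥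
  · right
    refine ⟨-(2 * Module.finrank ℂ (𝓥 0)), fun n hn => ?_⟩
    have := H.heis_sup hκ hX hfin n
    rwa [hpos, H.heisNeg_eq_bot hκ hX hfin hn, sup_bot_eq, le_bot_iff] at this
  left
  push Not at hpos
  obtain ⟨n, hn, hmax⟩ := Int.exists_greatest_of_bdd (P := fun n => heisPos κ X 𝓥 n ≠ ⊥)
    ⟨2 * Module.finrank ℂ (𝓥 0), fun z hz => by
      by_contra! h; exact hz (H.heisPos_eq_bot hκ hX hfin h)⟩ hpos
  have hbot : ∀ j, n < j → heisPos κ X 𝓥 j = ⊥ := fun j hj => by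
    by_contra h; exact absurd (hmax j h) (by omega)
  have hkill : ∀ w ∈ heisPos κ X 𝓥 n, ∀ k : ℤ, 2 ≤ k → X k 0 w = 0 := fun w hw k hk => by
    have := H.heis_mem_heisPos hX (k := k) (by omega) (by omega) hw
    rwa [hbot _ (by omega), Submodule.mem_bot] at this
  obtain ⟨v, hv, hv0⟩ := Submodule.exists_mem_ne_zero_of_ne_bot hn
  have hvn : v ∈ 𝓥 n := heisPos_le n hv
  have hsing : ∀ k m : ℤ, 2 ≤ k → X k m v = 0 := by
    intro k m hk
    by_cases hm : m = 0
    · subst hm; exact hkill v hv k hk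
    have hm' : (m : ℂ) ≠ 0 := by exact_mod_cast hm
    have c1 : ∀ k : ℤ, 2 ≤ k → X k 0 (X 0 m v) = (-(ε * (k * m))) • X k m v := by
      intro k hk
      have : ¬ (k = 0 ∧ m = 0) := by omega
      rw [H.comm, hkill v hv k hk]; simp [this]
    -- Both sides are multiples of `X (k + k) m v`; comparing them relates the square of mode `k` to
    -- mode `2k` on `X 0 m v`.
    have c2 : ∀ k : ℤ, 2 ≤ k → X k 0 (X k 0 (X 0 m v)) =
        (-(ε * (k * m)) / 2) • X (k + k) 0 (X 0 m v) := by
      intro k hk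
      have hkk : ¬ (k + k = 0 ∧ 0 + m = 0) := by omega
      rw [c1 k hk, map_smul, H.comm, hkill v hv k hk, c1 (k + k) (by omega), if_neg hkk]
      simp only [map_zero, zero_smul, add_zero, zero_sub, zero_add, smul_smul,
        ← neg_smul]
      congr 1; push_cast; ring
    obtain ⟨w, hw, w', hw', hww⟩ := Submodule.mem_sup.mp
      (H.heis_sup hκ hX hfin n (by simpa using hX 0 m n v hvn))
    -- The opposite part `w'` of `X 0 m v` inherits the relation `c2`, because the Fock part `w` is
    -- killed by all modes `≥ 2`.
    have hw0 : w' = 0 := by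
      -- A new `k`, large enough that degree `n - 2k` has no opposite part, so that mode `-2k` kills
      -- `w'`.
      obtain ⟨k, hk, hkn⟩ : ∃ k : ℤ, 2 ≤ k ∧ n - 2 * k < -(2 * Module.finrank ℂ (𝓥 0)) := by
        refine ⟨|n| + Module.finrank ℂ (𝓥 0) + 2, ?_⟩
        have := le_abs_self n
        have := abs_nonneg n
        omega
      have hz : X (-(k + k)) 0 w' = 0 := by
        have := H.heis_mem_heisNeg hX (k := -(k + k)) (by omega) (by omega) hw'
        rwa [H.heisNeg_eq_bot hκ hX hfin (by omega), Submodule.mem_bot] at this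
      have e := c2 k hk
      rw [← hww, map_add, map_add, map_add, hkill w hw k hk, hkill w hw _ (by omega), map_zero,
        zero_add, zero_add] at e
      -- Mode `-2k` commutes with mode `k` and kills `w'`, so the left side vanishes. Hence `X (-2k)
      -- 0 (X (2k) 0 w') = 0`, and the Weyl relation leaves `2kκ • w' = 0`.
      have e2 := congrArg (X (-(k + k)) 0) e
      rw [H.heis_comm (k := -(k + k)) (l := k) (by omega),
        H.heis_comm (k := -(k + k)) (l := k) (by omega), hz, map_zero, map_zero, map_smul] at e2
      have e3 := H.heis_weyl (k + k) w'
      rw [hz, map_zero] at e3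
      have hk0 : (k : ℂ) ≠ 0 := by exact_mod_cast (by omega : k ≠ 0)
      have e4 : X (-(k + k)) 0 (X (k + k) 0 w') = 0 := by
        refine (smul_eq_zero.mp e2.symm).resolve_left ?_
        simp [hε, hk0, hm']
      rw [e4, zero_add] at e3
      refine (smul_eq_zero.mp e3.symm).resolve_left (mul_ne_zero ?_ hκ)
      exact_mod_cast (by omega : k + k ≠ 0)
    subst hw0
    have := c1 k hk
    rw [← hww, add_zero, hkill w hw k hk] at this
    have hk0 : (k : ℂ) ≠ 0 := by exact_mod_cast (by omega : k ≠ 0)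
    exact (smul_eq_zero.mp this.symm).resolve_left
      (neg_ne_zero.mpr (mul_ne_zero hε (mul_ne_zero hk0 hm')))
  have htop := hirr n v hvn hv0 (eventuallyKilled X) ⟨2, fun k m => hsing k m⟩
    fun i m w hw => H.mem_eventuallyKilled i m hw
  refine ⟨n, fun j hj => ?_⟩
  have hneg : heisNeg κ X 𝓥 j = ⊥ := by
    by_contra hne
    obtain ⟨u, hu, h0, i, h1, h2⟩ := H.exists_of_heisNeg hκ hX hfin hne
    obtain ⟨N, hN⟩ : u ∈ eventuallyKilled X := htop ▸ Submodule.mem_top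
    have hk : N ≤ ((N.natAbs + 2 : ℕ) : ℤ) := by omega
    -- A mode that kills `u` has number eigenvalue 0, which is of Fock type and never of the
    -- opposite type.
    obtain ⟨p, hp⟩ := h2 (N.natAbs + 2) (by omega) 0 (by rw [hN _ 0 hk]; simp)
    have hκ' : ((N.natAbs + 2 : ℕ) : ℂ) * κ ≠ 0 :=
      mul_ne_zero (by exact_mod_cast (by omega : N.natAbs + 2 ≠ 0)) hκ
    exact nat_mul_ne_neg hκ' 0 p (by simpa using hp)
  have := H.heis_sup hκ hX hfin j
  rwa [hbot j hj, hneg, sup_bot_eq, le_bot_iff] at this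

end Dichotomy

/-! ### Linear recurrences for two-sided sequences and exponential polynomials. -/

section Recurrence

open Polynomial

variable {W W' : Type*} [AddCommGroup W] [Module ℂ W] [AddCommGroup W'] [Module ℂ W']

/-- The shift of two-sided sequences. -/
def zshift (W : Type*) [AddCommGroup W] [Module ℂ W] : Module.End ℂ (ℤ → W) :=
  LinearMap.funLeft ℂ W fun l => l + 1

/-- Multiplication of a two-sided sequence by its index. -/
def zindex (W : Type*) [AddCommGroup W] [Module ℂ W] : Module.End ℂ (ℤ → W) where
  toFun g l := (l : ℂ) • g l
  map_add' g g' := by ext l; simp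
  map_smul' c g := by ext l; exact smul_comm _ _ _

theorem zshift_pow_apply (g : ℤ → W) (i : ℕ) (l : ℤ) : (zshift W ^ i) g l = g (l + i) := by
  induction i generalizing l with
  | zero => simp
  | succ i ih =>
    rw [pow_succ', Module.End.mul_apply]
    change (zshift W ^ i) g (l + 1) = _
    rw [ih]; congr 1; push_cast; ring

theorem aeval_zshift_apply (Q : ℂ[X]) (g : ℤ → W) (l : ℤ) :
    aeval (zshift W) Q g l = Q.sum fun i a => a • g (l + i) := by
  rw [aeval_eq_sum_range, Polynomial.sum_over_range _ (by simp)]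
  simp [LinearMap.sum_apply, zshift_pow_apply]

theorem aeval_zshift_map (T : W →ₗ[ℂ] W') (Q : ℂ[X]) (g : ℤ → W) :
    aeval (zshift W') Q (fun l => T (g l)) = fun l => T (aeval (zshift W) Q g l) := by
  ext l
  simp [aeval_zshift_apply, Polynomial.sum]

theorem aeval_zshift_translate (Q : ℂ[X]) (g : ℤ → W) (k : ℤ) :
    aeval (zshift W) Q (fun l => g (l + k)) = fun l => aeval (zshift W) Q g (l + k) := by
  ext l
  simp only [aeval_zshift_apply, add_right_comm]

theorem aeval_zshift_of_dvd {Q R : ℂ[X]} (h : Q ∣ R) {g : ℤ → W}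
    (hg : aeval (zshift W) Q g = 0) : aeval (zshift W) R g = 0 := by
  obtain ⟨P, rfl⟩ := h
  rw [mul_comm, map_mul, Module.End.mul_apply, hg, map_zero]

theorem zshift_mul_zindex : zshift W * zindex W = zindex W * zshift W + zshift W := by
  ext g l
  change ((l + 1 : ℤ) : ℂ) • g (l + 1) = (l : ℂ) • g (l + 1) + g (l + 1)
  push_cast; rw [add_smul, one_smul]

/-- The commutator with the index operator acts on polynomials in the shift `S` as the derivation `S
d/dS`. -/
theorem aeval_zshift_mul_zindex (Q : ℂ[X]) : aeval (zshift W) Q * zindex W =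
    zindex W * aeval (zshift W) Q + zshift W * aeval (zshift W) (derivative Q) := by
  induction Q using Polynomial.induction_on with
  | C a =>
    simp only [aeval_C, derivative_C, map_zero, mul_zero, add_zero]
    exact Algebra.commutes a (zindex W)
  | add p q hp hq => simp only [map_add, add_mul, hp, hq, mul_add]; abel
  | monomial n a ih =>
    have e : C a * X ^ (n + 1) = X * (C a * X ^ n) := by ring
    rw [e, derivative_mul, map_mul, mul_assoc, ih, derivative_X, one_mul, map_add, map_mul,
      map_mul _ X (derivative _), aeval_X, mul_add, ← mul_assoc, zshift_mul_zindex]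
    noncomm_ring

/-- Recurrences survive multiplication by the index: the commutator leaves only a term `S Q'(S) g`,
which a second factor `Q` kills. -/
theorem aeval_zshift_sq_zindex {Q : ℂ[X]} {g : ℤ → W} (hg : aeval (zshift W) Q g = 0) :
    aeval (zshift W) (Q ^ 2) (zindex W g) = 0 := by
  have h1 : aeval (zshift W) Q (zindex W g) =
      zshift W (aeval (zshift W) (derivative Q) g) := by
    have := congrArg (fun T => T g) (aeval_zshift_mul_zindex (W := W) Q)
    simpa [hg] using this
  have h2 : aeval (zshift W) (Q * (X * derivative Q)) g = 0 :=
    aeval_zshift_of_dvd (dvd_mul_right _ _) hg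
  rw [sq, map_mul, Module.End.mul_apply, h1]
  simpa using h2

/-- `ℂ[X]` is infinite dimensional, so evaluating at index 0 has a kernel. This is one relation at
one place, not yet a recurrence. -/
theorem exists_relation_of_finite (W0 : Submodule ℂ W) [FiniteDimensional ℂ W0] (g : ℤ → W)
    (hg : ∀ l, g l ∈ W0) : ∃ Q : ℂ[X], Q ≠ 0 ∧ aeval (zshift W) Q g 0 = 0 := by
  let T : ℂ[X] →ₗ[ℂ] W :=
    (LinearMap.proj 0 ∘ₗ LinearMap.applyₗ g) ∘ₗ (aeval (zshift W)).toLinearMap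
  have hT : ∀ Q, T Q ∈ W0 := fun Q => by
    change aeval (zshift W) Q g 0 ∈ W0
    rw [aeval_zshift_apply]
    exact W0.sum_mem fun i _ => W0.smul_mem _ (hg _)
  by_contra! h
  have hinj : Function.Injective (T.codRestrict W0 hT) := by
    rw [← LinearMap.ker_eq_bot, LinearMap.ker_eq_bot']
    intro Q hQ
    by_contra h0
    exact h Q h0 (congrArg Subtype.val hQ)
  have := Module.Finite.of_injective _ hinj
  exact Polynomial.not_finite (R := ℂ) this

/-- The space of exponential-polynomial functions on `ℤ`. -/
def expPolySpace : Submodule ℂ (ℤ → ℂ) :=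
  Submodule.span ℂ {f | ∃ (p : ℂ[X]) (a : ℂ), a ≠ 0 ∧ f = fun k : ℤ => p.eval (k : ℂ) * a ^ k}

theorem mem_expPolySpace_iff_exists {f : ℤ → ℂ} : f ∈ expPolySpace ↔
    ∃ (r : ℕ) (p : Fin r → ℂ[X]) (a : Fin r → ℂ), (∀ i, a i ≠ 0) ∧
      ∀ k : ℤ, f k = ∑ i, (p i).eval (k : ℂ) * a i ^ k := by
  constructor
  · intro hf
    obtain ⟨r, c, g, rfl⟩ := Submodule.mem_span_set'.mp hf
    choose p a ha hg using fun i => (g i).2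
    refine ⟨r, fun i => C (c i) * p i, a, ha, fun k => ?_⟩
    simp [hg, mul_assoc]
  · rintro ⟨r, p, a, ha, hf⟩
    have : f = ∑ i, fun k : ℤ => (p i).eval (k : ℂ) * a i ^ k := by ext k; simp [hf]
    rw [this]
    exact Submodule.sum_mem _ fun i _ => Submodule.subset_span ⟨p i, a i, ha i, rfl⟩

theorem exists_annihilator_of_mem_expPolySpace {f : ℤ → ℂ} (hf : f ∈ expPolySpace) :
    ∃ Q : ℂ[X], Q ≠ 0 ∧ aeval (zshift ℂ) Q f = 0 := by
  have hadd : ∀ f g : ℤ → ℂ, (∃ Q : ℂ[X], Q ≠ 0 ∧ aeval (zshift ℂ) Q f = 0) →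
      (∃ Q : ℂ[X], Q ≠ 0 ∧ aeval (zshift ℂ) Q g = 0) →
      ∃ Q : ℂ[X], Q ≠ 0 ∧ aeval (zshift ℂ) Q (f + g) = 0 := by
    rintro f g ⟨Q, hQ, hf⟩ ⟨R, hR, hg⟩
    refine ⟨Q * R, mul_ne_zero hQ hR, ?_⟩
    rw [map_add, aeval_zshift_of_dvd (dvd_mul_right _ _) hf,
      aeval_zshift_of_dvd (dvd_mul_left _ _) hg, add_zero]
  have hsmul : ∀ (c : ℂ) (f : ℤ → ℂ), (∃ Q : ℂ[X], Q ≠ 0 ∧ aeval (zshift ℂ) Q f = 0) →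
      ∃ Q : ℂ[X], Q ≠ 0 ∧ aeval (zshift ℂ) Q (c • f) = 0 := by
    rintro c f ⟨Q, hQ, hf⟩
    exact ⟨Q, hQ, by rw [map_smul, hf, smul_zero]⟩
  induction hf using Submodule.span_induction with
  | zero => exact ⟨1, one_ne_zero, by simp⟩
  | add f g _ _ h1 h2 => exact hadd f g h1 h2
  | smul c f _ h => exact hsmul c f h
  | mem f hf =>
    obtain ⟨p, a, ha, rfl⟩ := hf
    have hmon : ∀ n : ℕ, ∃ Q : ℂ[X], Q ≠ 0 ∧
        aeval (zshift ℂ) Q (fun k : ℤ => (k : ℂ) ^ n * a ^ k) = 0 := by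
      intro n
      induction n with
      | zero =>
        refine ⟨X - C a, X_sub_C_ne_zero a, ?_⟩
        ext l
        rw [map_sub, aeval_X, aeval_C]
        change (((l + 1 : ℤ) : ℂ)) ^ 0 * a ^ (l + 1) - a * ((l : ℂ) ^ 0 * a ^ l) = 0
        rw [zpow_add_one₀ ha]; ring
      | succ n ih =>
        obtain ⟨Q, hQ, h⟩ := ih
        refine ⟨Q ^ 2, pow_ne_zero 2 hQ, ?_⟩
        rw [← aeval_zshift_sq_zindex h]
        congr 1; ext l
        change _ = (l : ℂ) * ((l : ℂ) ^ n * a ^ l)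
        ring
    induction p using Polynomial.induction_on' with
    | add p q hp hq =>
      have e : (fun k : ℤ => (p + q).eval (k : ℂ) * a ^ k) =
          (fun k : ℤ => p.eval (k : ℂ) * a ^ k) + fun k : ℤ => q.eval (k : ℂ) * a ^ k := by
        ext k; simp [add_mul]
      rw [e]; exact hadd _ _ hp hq
    | monomial n c =>
      have e : (fun k : ℤ => (monomial n c).eval (k : ℂ) * a ^ k) =
          c • fun k : ℤ => (k : ℂ) ^ n * a ^ k := by
        ext k; simp [mul_assoc]
      rw [e]; exact hsmul c _ (hmon n)

/-- Solves `(S - a) g = p(k) b ^ k` up to a power of `b`. The operator is triangular on monomials,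
preserving the degree when `b ≠ a` and lowering it by one when `b = a`. -/
theorem exists_polynomial_difference {a b : ℂ} (hb : b ≠ 0) (p : ℂ[X]) :
    ∃ q : ℂ[X], b • q.comp (X + 1) - a • q = p := by
  let T : ℂ[X] →ₗ[ℂ] ℂ[X] := b • (aeval (X + 1 : ℂ[X])).toLinearMap - a • LinearMap.id
  have hT : ∀ q, T q = b • q.comp (X + 1) - a • q := fun q => by
    simp [T, comp, aeval_def]
  suffices h : ∀ p, p ∈ LinearMap.range T by
    obtain ⟨q, hq⟩ := h p
    exact ⟨q, by rw [← hT, hq]⟩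
  have hlow : ∀ n m : ℕ, (∀ i < n, (X ^ i : ℂ[X]) ∈ LinearMap.range T) →
      ∑ i ∈ Finset.range n, (X ^ i : ℂ[X]) * 1 ^ (m - i) * (m.choose i : ℂ[X]) ∈
        LinearMap.range T := by
    intro n m h
    refine Submodule.sum_mem _ fun i hi => ?_
    have := Submodule.smul_mem _ (m.choose i : ℂ) (h i (Finset.mem_range.mp hi))
    convert this using 1
    rw [one_pow, mul_one, mul_comm, smul_eq_C_mul]; simp
  have hmon : ∀ n : ℕ, (X ^ n : ℂ[X]) ∈ LinearMap.range T := by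
    intro n
    induction n using Nat.strong_induction_on with
    | _ n ih =>
    by_cases hab : b = a
    -- In the resonant case the leading terms cancel, so `X ^ n` is reached from `X ^ (n + 1)` with
    -- coefficient `a (n + 1)`.
    · have h1 : T (X ^ (n + 1)) ∈ LinearMap.range T := ⟨_, rfl⟩
      have h2 := hlow n (n + 1) ih
      rw [hT, hab, ← smul_sub, pow_comp, X_comp, add_pow, Finset.sum_range_succ,
        Finset.sum_range_succ] at h1
      have ha : a ≠ 0 := hab ▸ hb
      have h3 := Submodule.sub_mem _ (Submodule.smul_mem _ a⁻¹ h1) h2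
      rw [inv_smul_smul₀ ha] at h3
      have hn : ((n : ℂ) + 1) ≠ 0 := by exact_mod_cast n.succ_ne_zero
      have h4 := Submodule.smul_mem _ ((n : ℂ) + 1)⁻¹ h3
      convert h4 using 1
      rw [eq_inv_smul_iff₀ hn, smul_eq_C_mul]
      simp
      ring
    · have h1 : T (X ^ n) ∈ LinearMap.range T := ⟨_, rfl⟩
      have h2 := Submodule.smul_mem _ b (hlow n n ih)
      rw [hT, pow_comp, X_comp, add_pow, Finset.sum_range_succ, smul_add] at h1
      have h3 := Submodule.sub_mem _ h1 h2
      have hn : b - a ≠ 0 := sub_ne_zero.mpr hab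
      have h4 := Submodule.smul_mem _ (b - a)⁻¹ h3
      convert h4 using 1
      rw [eq_inv_smul_iff₀ hn, sub_smul]
      simp only [tsub_self, pow_zero, Nat.choose_self, Nat.cast_one, mul_one]
      abel
  intro p
  induction p using Polynomial.induction_on' with
  | add p q hp hq => exact Submodule.add_mem _ hp hq
  | monomial n c =>
    rw [← C_mul_X_pow_eq_monomial, ← smul_eq_C_mul]
    exact Submodule.smul_mem _ _ (hmon n)

/-- For `a ≠ 0` a particular solution inside the space exists, and two solutions differ by a
multiple of `a ^ k`. For `a = 0` it suffices to shift back. -/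
theorem mem_expPolySpace_of_shift_sub {a : ℂ} {f : ℤ → ℂ}
    (h : zshift ℂ f - a • f ∈ expPolySpace) : f ∈ expPolySpace := by
  by_cases ha : a = 0
  · subst ha
    rw [zero_smul, sub_zero] at h
    have key : ∀ g ∈ expPolySpace, (fun k : ℤ => g (k - 1)) ∈ expPolySpace := by
      intro g hg
      rw [mem_expPolySpace_iff_exists] at hg ⊢
      obtain ⟨r, p, b, hb, hg⟩ := hg
      refine ⟨r, fun i => C (b i)⁻¹ * (p i).comp (X - 1), b, hb, fun k => ?_⟩
      rw [hg]
      refine Finset.sum_congr rfl fun i _ => ?_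
      rw [zpow_sub_one₀ (hb i)]
      simp
      ring
    have := key _ h
    convert this using 1
    ext k
    change f k = f (k - 1 + 1)
    rw [sub_add_cancel]
  · have key : ∀ g ∈ expPolySpace, ∃ g' ∈ expPolySpace, zshift ℂ g' - a • g' = g := by
      intro g hg
      induction hg using Submodule.span_induction with
      | zero => exact ⟨0, zero_mem _, by simp⟩
      | add g g' _ _ h1 h2 =>
        obtain ⟨u, hu, rfl⟩ := h1
        obtain ⟨v, hv, rfl⟩ := h2
        exact ⟨u + v, add_mem hu hv, by rw [map_add, smul_add]; abel⟩
      | smul c g _ h1 =>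
        obtain ⟨u, hu, rfl⟩ := h1
        exact ⟨c • u, Submodule.smul_mem _ c hu, by rw [map_smul, smul_sub, smul_comm]⟩
      | mem g hg =>
        obtain ⟨p, b, hb, rfl⟩ := hg
        obtain ⟨q, hq⟩ := exists_polynomial_difference (a := a) hb p
        refine ⟨_, Submodule.subset_span ⟨q, b, hb, rfl⟩, ?_⟩
        ext k
        change q.eval ((k + 1 : ℤ) : ℂ) * b ^ (k + 1) - a * (q.eval (k : ℂ) * b ^ k) = _
        rw [← hq, zpow_add_one₀ hb]
        simp
        ring
    obtain ⟨g, hg, e⟩ := key _ h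
    have e2 : ∀ k : ℤ, f (k + 1) - g (k + 1) = a * (f k - g k) := by
      intro k
      have := congrFun e k
      change g (k + 1) - a * g k = f (k + 1) - a * f k at this
      linear_combination -this
    have e3 : ∀ k : ℤ, f k - g k = (f 0 - g 0) * a ^ k := by
      intro k
      induction k using Int.induction_on with
      | zero => simp
      | succ i ih => rw [e2, ih, zpow_add_one₀ ha]; ring
      | pred i ih =>
        have := e2 (-i - 1)
        rw [sub_add_cancel, ih] at this
        rw [zpow_sub_one₀ ha]
        field_simp
        linear_combination -this
    have e4 : f = g + fun k : ℤ => (C (f 0 - g 0)).eval (k : ℂ) * a ^ k := by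
      ext k
      have := e3 k
      simp only [Pi.add_apply, eval_C]
      linear_combination this
    rw [e4]
    exact add_mem hg (Submodule.subset_span ⟨_, a, ha, rfl⟩)

/-- A two-sided sequence satisfying a linear recurrence is an exponential polynomial. -/
theorem mem_expPolySpace_of_annihilator {Q : ℂ[X]} (hQ : Q ≠ 0) {f : ℤ → ℂ}
    (hf : aeval (zshift ℂ) Q f = 0) : f ∈ expPolySpace := by
  induction hn : Q.natDegree generalizing Q f with
  | zero =>
    obtain ⟨c, rfl⟩ := natDegree_eq_zero.mp hn
    have hc : c ≠ 0 := by rintro rfl; simp at hQ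
    rw [aeval_C] at hf
    have : c • f = 0 := hf
    rw [(smul_eq_zero.mp this).resolve_left hc]
    exact zero_mem _
  | succ n ih =>
    obtain ⟨a, ha⟩ := IsAlgClosed.exists_root Q (by
      intro h; rw [natDegree_eq_of_degree_eq_some (n := 0) h] at hn; omega)
    obtain ⟨R, rfl⟩ := dvd_iff_isRoot.mpr ha
    have hR : R ≠ 0 := right_ne_zero_of_mul hQ
    -- With `Q = (X - a) R`, the sequence `(S - a) f` is killed by `R`, which has smaller degree.
    refine mem_expPolySpace_of_shift_sub (a := a) (ih hR (f := zshift ℂ f - a • f) ?_ ?_)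
    · rw [mul_comm, map_mul, Module.End.mul_apply, map_sub, aeval_X, aeval_C] at hf
      exact hf
    · rw [natDegree_mul (X_sub_C_ne_zero a) hR, natDegree_X_sub_C] at hn
      omega

end Recurrence

/-! ### From a recurrence for the weight to finite-dimensional components. -/

section FiniteDimensionality

open Polynomial

variable {V : Type*} [AddCommGroup V] [Module ℂ V] {ε κ : ℂ} {X : ℤ → ℤ → Module.End ℂ V}
  {𝓥 : ℤ → Submodule ℂ V}

/-- The shift is invertible on two-sided sequences, so factors `X` of an annihilator can be
stripped. -/
theorem exists_annihilator_coeff_zero_ne {Q : ℂ[X]} (hQ : Q ≠ 0) :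
    ∃ R : ℂ[X], R ≠ 0 ∧ R.coeff 0 ≠ 0 ∧
      ∀ g : ℤ → V, aeval (zshift V) Q g = 0 → aeval (zshift V) R g = 0 := by
  obtain ⟨R, hR, hd⟩ := exists_eq_pow_rootMultiplicity_mul_and_not_dvd Q hQ 0
  rw [C_0, sub_zero] at hR hd
  refine ⟨R, ?_, ?_, fun g hg => ?_⟩
  · rintro rfl; exact hd (dvd_zero _)
  · rwa [X_dvd_iff] at hd
  · rw [hR, map_mul, map_pow, aeval_X, Module.End.mul_apply] at hg
    ext l
    have := congrFun hg (l - rootMultiplicity 0 Q)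
    rwa [zshift_pow_apply, sub_add_cancel] at this

/-- A window of `Q.natDegree` consecutive terms slides right by dividing by the leading coefficient,
and left by dividing by the constant one. -/
theorem mem_of_recurrence {Q : ℂ[X]} (hQ : Q ≠ 0) (h0 : Q.coeff 0 ≠ 0) {g : ℤ → V}
    (hg : aeval (zshift V) Q g = 0) (Z : Submodule ℂ V)
    (hZ : ∀ i < Q.natDegree, g i ∈ Z) (l : ℤ) : g l ∈ Z := by
  have hrec : ∀ l : ℤ, ∑ i ∈ Finset.range (Q.natDegree + 1), Q.coeff i • g (l + i) = 0 := by
    intro l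
    have := congrFun hg l
    rwa [aeval_zshift_apply, Polynomial.sum_over_range _ (by simp)] at this
  have key : ∀ l : ℤ, ∀ i < Q.natDegree, g (l + i) ∈ Z := by
    intro l
    induction l using Int.induction_on with
    | zero => simpa using hZ
    | succ l ih =>
      intro i hi
      by_cases hi' : i + 1 < Q.natDegree
      · have := ih (i + 1) hi'
        rw [show (l : ℤ) + 1 + i = l + ((i + 1 : ℕ) : ℤ) by push_cast; ring]
        exact this
      · have e : i + 1 = Q.natDegree := by omega
        have h1 := hrec l
        rw [Finset.sum_range_succ] at h1
        have h2 := Z.smul_mem (Q.coeff Q.natDegree)⁻¹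
          (Z.sum_mem (t := Finset.range Q.natDegree) (f := fun i => Q.coeff i • g (l + i))
            fun i hi => Z.smul_mem _ (ih i (Finset.mem_range.mp hi)))
        rw [eq_neg_of_add_eq_zero_left h1, smul_neg, inv_smul_smul₀
          (show Q.coeff Q.natDegree ≠ 0 from leadingCoeff_ne_zero.mpr hQ), neg_mem_iff] at h2
        rw [show (l : ℤ) + 1 + i = l + (Q.natDegree : ℤ) by rw [← e]; push_cast; ring]
        exact h2
    | pred l ih =>
      intro i hi
      cases i with
      | succ i =>
        have := ih i (by omega)
        rw [show -(l : ℤ) - 1 + (i + 1 : ℕ) = -l + (i : ℤ) by push_cast; ring]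
        exact this
      | zero =>
        have h1 := hrec (-l - 1)
        rw [Finset.sum_range_succ'] at h1
        have h2 := Z.smul_mem (Q.coeff 0)⁻¹
          (Z.sum_mem (t := Finset.range Q.natDegree)
            (f := fun i => Q.coeff (i + 1) • g (-l - 1 + (i + 1 : ℕ)))
            fun i hi => Z.smul_mem _ (by
              rw [show -(l : ℤ) - 1 + (i + 1 : ℕ) = -l + (i : ℤ) by push_cast; ring]
              exact ih i (Finset.mem_range.mp hi)))
        rwa [eq_neg_of_add_eq_zero_left h1, smul_neg, inv_smul_smul₀ h0, neg_mem_iff] at h2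
  rcases Nat.eq_zero_or_pos Q.natDegree with h | h
  · have := hrec l
    rw [h, zero_add, Finset.sum_range_one] at this
    have := (smul_eq_zero.mp this).resolve_left h0
    rw [Nat.cast_zero, add_zero] at this
    rw [this]; exact Z.zero_mem
  · simpa using key l 0 h

/-- The action of `[D(b₁ + k b₂), D(-b₁ + (l - k) b₂)]`. -/
def levelOp (ε κ : ℂ) (X : ℤ → ℤ → Module.End ℂ V) (l : ℤ) : Module.End ℂ V :=
  (-(ε * l)) • X 0 l + (if l = 0 then κ else 0) • 1

theorem VirLikeRep.comm_one_neg_one (H : VirLikeRep ε κ X) (k m : ℤ) (w : V) :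
    X 1 k (X (-1) m w) = X (-1) m (X 1 k w) + levelOp ε κ X (m + k) w := by
  rw [H.comm, levelOp, add_comm m k]
  simp only [LinearMap.add_apply, LinearMap.smul_apply, Module.End.one_apply]
  rw [sub_eq_add_neg, add_assoc, ← neg_smul]
  simp only [Int.reduceNeg, add_neg_cancel, true_and, Int.cast_one, one_mul, Int.cast_neg,
    neg_mul, sub_neg_eq_add, Int.cast_add, add_comm (m : ℂ)]

/-- The error term carries `l` twice, once from the coefficient in `levelOp` and once from the
bracket. Being polynomial in `l`, it preserves recurrences. -/
theorem VirLikeRep.levelOp_neg_one (H : VirLikeRep ε κ X) (l r : ℤ) (u : V) :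
    levelOp ε κ X l (X (-1) r u) = X (-1) r (levelOp ε κ X l u) +
      (ε ^ 2) • (l : ℂ) • (l : ℂ) • X (-1) (l + r) u := by
  simp only [levelOp, LinearMap.add_apply, LinearMap.smul_apply, Module.End.one_apply, map_add,
    map_smul]
  rw [H.comm, if_neg (by omega)]
  simp only [zero_smul, add_zero, smul_sub, smul_smul, zero_add]
  have e : (-(ε * l)) * (ε * (((0 : ℤ) : ℂ) * r - ((-1 : ℤ) : ℂ) * l)) = -(ε ^ 2 * (l * l)) := by
    push_cast; ring
  rw [e]
  module

/-- Quasi-finiteness of an irreducible highest weight module whose weight satisfies a linear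
recurrence. -/
theorem VirLikeRep.finiteDimensional (H : VirLikeRep ε κ X) (hX : ShiftsDegrees X 𝓥) {d : ℤ}
    {v : V} (htop : ∀ j, d < j → 𝓥 j = ⊥) (hd : 𝓥 d ≤ Submodule.span ℂ {v})
    (hgen : ∀ n : ℕ, 𝓥 (d - (n + 1)) ≤
      ⨆ m : ℤ, (𝓥 (d - n)).map (X (-1) m))
    (hsing : ∀ j < d, ∀ u ∈ 𝓥 j, (∀ k, X 1 k u = 0) → u = 0)
    (hrec : ∃ Q : ℂ[X], Q ≠ 0 ∧ aeval (zshift V) Q (fun l => levelOp ε κ X l v) = 0) (n : ℤ) :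
    FiniteDimensional ℂ (𝓥 n) := by
  -- By `hsing` it is enough that every `X 1 k` kills the combination. Moving `X 1 k` inside gives a
  -- lowering sequence for `X 1 k w`, one degree higher and killed by `Q`, plus a translated
  -- `levelOp` sequence, killed by `R`.
  have hA : ∀ n : ℕ, (∃ Q : ℂ[X], Q ≠ 0 ∧ ∀ w ∈ 𝓥 (d - n + 1),
        aeval (zshift V) Q (fun m => X (-1) m w) = 0) →
      (∃ R : ℂ[X], R ≠ 0 ∧ ∀ w ∈ 𝓥 (d - n), aeval (zshift V) R (fun l => levelOp ε κ X l w) = 0) →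
      ∃ Q : ℂ[X], Q ≠ 0 ∧ ∀ w ∈ 𝓥 (d - n), aeval (zshift V) Q (fun m => X (-1) m w) = 0 := by
    rintro n ⟨Q, hQ, hQ'⟩ ⟨R, hR, hR'⟩
    refine ⟨Q * R, mul_ne_zero hQ hR, fun w hw => ?_⟩
    ext m
    refine hsing (d - n + -1) (by omega) _ ?_ fun k => ?_
    · rw [aeval_zshift_apply]
      exact Submodule.sum_mem _ fun i _ => Submodule.smul_mem _ _ (hX _ _ _ _ hw)
    · have e := congrFun (aeval_zshift_map (X 1 k) (Q * R) (fun m => X (-1) m w)) m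
      rw [← e]
      have e2 : (fun m => X 1 k (X (-1) m w)) = (fun m => X (-1) m (X 1 k w)) +
          fun m => levelOp ε κ X (m + k) w := by
        ext m; exact H.comm_one_neg_one k m w
      rw [e2, map_add, aeval_zshift_of_dvd (dvd_mul_right _ _) (hQ' _ (hX 1 k _ _ hw)), zero_add,
        aeval_zshift_translate _ (fun m => levelOp ε κ X m w),
        aeval_zshift_of_dvd (dvd_mul_left _ _) (hR' w hw)]
      rfl
  have hAB : ∀ n : ℕ, (∃ Q : ℂ[X], Q ≠ 0 ∧ ∀ w ∈ 𝓥 (d - n),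
        aeval (zshift V) Q (fun m => X (-1) m w) = 0) ∧
      ∃ R : ℂ[X], R ≠ 0 ∧ ∀ w ∈ 𝓥 (d - n),
        aeval (zshift V) R (fun l => levelOp ε κ X l w) = 0 := by
    intro n
    induction n with
    | zero =>
      have hB : ∃ R : ℂ[X], R ≠ 0 ∧ ∀ w ∈ 𝓥 (d - (0 : ℕ)),
          aeval (zshift V) R (fun l => levelOp ε κ X l w) = 0 := by
        obtain ⟨Q, hQ, h⟩ := hrec
        refine ⟨Q, hQ, fun w hw => ?_⟩
        rw [Nat.cast_zero, sub_zero] at hw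
        obtain ⟨c, rfl⟩ := Submodule.mem_span_singleton.mp (hd hw)
        have e : (fun l => levelOp ε κ X l (c • v)) = c • fun l => levelOp ε κ X l v := by
          ext l; simp
        rw [e, map_smul, h, smul_zero]
      -- The component above the top is zero, so the constant polynomial 1 annihilates there.
      refine ⟨hA 0 ⟨1, one_ne_zero, fun w hw => ?_⟩ hB, hB⟩
      rw [htop _ (by omega), Submodule.mem_bot] at hw
      subst hw
      ext; simp
    | succ n ih =>
      obtain ⟨⟨Q, hQ, hQ'⟩, R, hR, hR'⟩ := ih
      have hB : ∃ R : ℂ[X], R ≠ 0 ∧ ∀ w ∈ 𝓥 (d - (n + 1 : ℕ)),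
          aeval (zshift V) R (fun l => levelOp ε κ X l w) = 0 := by
        -- `R` kills the main term of `levelOp_neg_one`; each of the two multiplications by the
        -- index in its error term squares `Q`.
        refine ⟨R * (Q ^ 2) ^ 2, mul_ne_zero hR (pow_ne_zero _ (pow_ne_zero _ hQ)),
          fun w hw => ?_⟩
        suffices hle : ⨆ m : ℤ, (𝓥 (d - n)).map (X (-1) m) ≤
            LinearMap.ker (aeval (zshift V) (R * (Q ^ 2) ^ 2) ∘ₗ LinearMap.pi (levelOp ε κ X)) from
          hle (hgen n (by simpa using hw))
        refine iSup_le fun r => ?_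
        rintro _ ⟨u, hu, rfl⟩
        rw [LinearMap.mem_ker]
        change aeval (zshift V) (R * (Q ^ 2) ^ 2) (fun l => levelOp ε κ X l (X (-1) r u)) = 0
        have e : (fun l => levelOp ε κ X l (X (-1) r u)) =
            (fun l => X (-1) r (levelOp ε κ X l u)) +
              (ε ^ 2) • zindex V (zindex V fun l => X (-1) (l + r) u) := by
          ext l; exact H.levelOp_neg_one l r u
        have e1 : aeval (zshift V) R (fun l => X (-1) r (levelOp ε κ X l u)) = 0 := by
          rw [aeval_zshift_map (X (-1) r), hR' u hu]
          ext; simp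
        have e2 : aeval (zshift V) Q (fun l => X (-1) (l + r) u) = 0 := by
          rw [aeval_zshift_translate Q (fun l => X (-1) l u), hQ' u hu]
          rfl
        rw [e, map_add, map_smul, aeval_zshift_of_dvd (dvd_mul_right _ _) e1,
          aeval_zshift_of_dvd (dvd_mul_left _ _)
            (aeval_zshift_sq_zindex (aeval_zshift_sq_zindex e2)), smul_zero, add_zero]
      refine ⟨hA (n + 1) ⟨Q, hQ, fun w hw => hQ' w ?_⟩ hB, hB⟩
      convert hw using 2; push_cast; ring
  have hfin : ∀ n : ℕ, FiniteDimensional ℂ (𝓥 (d - n)) := by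
    intro n
    induction n with
    | zero =>
      rw [Nat.cast_zero, sub_zero]
      exact Submodule.finiteDimensional_of_le hd
    | succ n ih =>
      obtain ⟨⟨Q, hQ, hQ'⟩, -⟩ := hAB n
      obtain ⟨R, hR, hR0, hR'⟩ := exists_annihilator_coeff_zero_ne (V := V) hQ
      have hle : 𝓥 (d - (n + 1 : ℕ)) ≤
          ⨆ i : Fin R.natDegree, (𝓥 (d - n)).map (X (-1) i) := by
        rw [Nat.cast_succ]
        refine (hgen n).trans (iSup_le fun m => ?_)
        rintro _ ⟨w, hw, rfl⟩
        refine mem_of_recurrence hR hR0 (hR' _ (hQ' w hw)) _ (fun i hi => ?_) m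
        exact Submodule.mem_iSup_of_mem (⟨i, hi⟩ : Fin R.natDegree)
          (Submodule.mem_map_of_mem (f := X (-1) i) hw)
      exact Submodule.finiteDimensional_of_le hle
  rcases lt_or_ge d n with h | h
  · rw [htop n h]; infer_instance
  · have := hfin (d - n).toNat
    rwa [Int.toNat_of_nonneg (by omega), sub_sub_cancel] at this

end FiniteDimensionality

/-! ### Coordinates in the basis, homogeneous projections, generated submodules, and the centre. -/

namespace VirLike

variable (b : Module.Basis (Fin 2) ℤ (ℤ × ℤ))

theorem exists_coords (p : ℤ × ℤ) : ∃ i m : ℤ, p = i • b 0 + m • b 1 :=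
  ⟨b.repr p 0, b.repr p 1, by rw [← Fin.sum_univ_two (fun k => b.repr p k • b k), b.sum_repr]⟩

theorem coords_eq_zero_iff (i m : ℤ) : i • b 0 + m • b 1 = 0 ↔ i = 0 ∧ m = 0 := by
  constructor
  · intro h
    have := Fintype.linearIndependent_iff.mp b.linearIndependent ![i, m]
      (by simpa [Fin.sum_univ_two] using h)
    exact ⟨this 0, this 1⟩
  · rintro ⟨rfl, rfl⟩; simp

theorem gdet_coords (p q : ℤ × ℤ) (i m j n : ℤ) :
    gdet (i • p + m • q) (j • p + n • q) = (i * n - j * m) * gdet p q := by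
  simp [gdet]; ring

/-- The standard basis has determinant 1, and expressing it through `b` exhibits an integer inverse
of the determinant of `b`. -/
theorem gdet_basis_sq : gdet (b 0) (b 1) * gdet (b 0) (b 1) = 1 := by
  obtain ⟨i, m, h1⟩ := exists_coords b (1, 0)
  obtain ⟨j, n, h2⟩ := exists_coords b (0, 1)
  have : gdet (1, 0) (0, 1) = (i * n - j * m) * gdet (b 0) (b 1) := by
    rw [h1, h2, gdet_coords]
  have h3 : IsUnit (gdet (b 0) (b 1)) := IsUnit.of_mul_eq_one _ (by
    rw [mul_comm, ← this]; rfl)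
  rcases Int.isUnit_iff.mp h3 with h | h <;> rw [h] <;> rfl

theorem h_zsmul (i : ℤ) (p : ℤ × ℤ) : h (i • p) = (i : ℂ) • h p := by
  simp only [h, cen, ← map_smul]; simp

theorem exists_cen_eq (u v : ℂ) : ∃ x y : ℂ, cen u v = x • h (b 0) + y • h (b 1) := by
  have e : cen u v = u • h (1, 0) + v • h (0, 1) := by
    simp only [h, cen, ← map_smul, ← map_add]; simp
  obtain ⟨i, m, h1⟩ := exists_coords b (1, 0)
  obtain ⟨j, n, h2⟩ := exists_coords b (0, 1)
  refine ⟨u * i + v * j, u * m + v * n, ?_⟩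
  rw [e, h1, h2]
  simp only [h_add, h_zsmul]
  module

theorem D_mem_gr (i m : ℤ) : D (i • b 0 + m • b 1) ∈ gr b i :=
  Submodule.mem_sup_left (Submodule.subset_span ⟨m, rfl⟩)

theorem cen_mem_gr (u v : ℂ) : cen u v ∈ gr b 0 := by
  obtain ⟨x, y, h⟩ := exists_cen_eq b u v
  rw [h]
  exact add_mem (Submodule.smul_mem _ _ (h_mem_gr_zero b _))
    (Submodule.smul_mem _ _ (h_mem_gr_zero b _))

/-- A subspace containing the homogeneous generators of degree `i` contains `L_i`. -/
theorem gr_le {i : ℤ} {T : Submodule ℂ VirLike} (hD : ∀ m : ℤ, D (i • b 0 + m • b 1) ∈ T)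
    (hc : i = 0 → ∀ u v, cen u v ∈ T) : gr b i ≤ T := by
  refine sup_le (Submodule.span_le.mpr ?_) ?_
  · rintro _ ⟨m, rfl⟩; exact hD m
  · split_ifs with hi
    · refine Submodule.span_le.mpr ?_
      rintro _ (rfl | rfl) <;> exact hc hi _ _
    · exact bot_le

theorem lie_D_coords (i m j n : ℤ) :
    ⁅D (i • b 0 + m • b 1), D (j • b 0 + n • b 1)⁆ =
      (-((gdet (b 0) (b 1) : ℂ) * (i * n - j * m))) • D ((i + j) • b 0 + (m + n) • b 1) +
      if i + j = 0 ∧ m + n = 0 then (i : ℂ) • h (b 0) + (m : ℂ) • h (b 1) else 0 := by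
  have e : i • b 0 + m • b 1 + (j • b 0 + n • b 1) = (i + j) • b 0 + (m + n) • b 1 := by module
  rw [lie_D_D, e, gdet_coords]
  congr 1
  · congr 1; push_cast; ring
  · simp only [coords_eq_zero_iff, h_add, h_zsmul]

theorem lie_mem_gr {i j : ℤ} {x y : VirLike} (hx : x ∈ gr b i) (hy : y ∈ gr b j) :
    ⁅x, y⁆ ∈ gr b (i + j) := by
  have hc : ∀ (u v : ℂ) (z : VirLike), ⁅z, cen u v⁆ = 0 := fun u v z => by
    rw [← lie_skew, lie_cen, neg_zero]
  have hy' : ∀ m : ℤ, ⁅D (i • b 0 + m • b 1), y⁆ ∈ gr b (i + j) := by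
    intro m
    refine gr_le b (T := (gr b (i + j)).comap (LieAlgebra.ad ℂ VirLike (D (i • b 0 + m • b 1))))
      (fun n => ?_) (fun _ u v => ?_) hy
    · change ⁅D (i • b 0 + m • b 1), D (j • b 0 + n • b 1)⁆ ∈ gr b (i + j)
      rw [lie_D_coords]
      refine add_mem (Submodule.smul_mem _ _ (D_mem_gr b _ _)) ?_
      split_ifs with hij
      · rw [hij.1]
        exact add_mem (Submodule.smul_mem _ _ (h_mem_gr_zero b _))
          (Submodule.smul_mem _ _ (h_mem_gr_zero b _))
      · exact zero_mem _
    · change ⁅D (i • b 0 + m • b 1), cen u v⁆ ∈ gr b (i + j)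
      rw [hc]; exact zero_mem _
  let T : Submodule ℂ VirLike :=
    (gr b (i + j)).comap ((LieAlgebra.ad ℂ VirLike : VirLike →ₗ[ℂ] Module.End ℂ VirLike).flip y)
  refine gr_le b (T := T) hy' (fun _ u v => ?_) hx
  change ⁅cen u v, y⁆ ∈ gr b (i + j)
  rw [lie_cen]; exact zero_mem _

section Projection

variable {V : Type*} [AddCommGroup V] [Module ℂ V]

/-- The projection of a graded module to a homogeneous component. -/
noncomputable def zproj {𝓥 : ℤ → Submodule ℂ V} (hi : DirectSum.IsInternal 𝓥) (n : ℤ) :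
    V →ₗ[ℂ] V :=
  (𝓥 n).subtype ∘ₗ DirectSum.component ℂ ℤ (fun i => 𝓥 i) n ∘ₗ
    (LinearEquiv.ofBijective (DirectSum.coeLinearMap 𝓥) hi).symm.toLinearMap

variable {𝓥 : ℤ → Submodule ℂ V} (hi : DirectSum.IsInternal 𝓥)

theorem zproj_mem (n : ℤ) (v : V) : zproj hi n v ∈ 𝓥 n := Submodule.coe_mem _

theorem zproj_of_mem {n : ℤ} {v : V} (hv : v ∈ 𝓥 n) (m : ℤ) :
    zproj hi m v = if n = m then v else 0 := by
  have e : (LinearEquiv.ofBijective (DirectSum.coeLinearMap 𝓥) hi).symm v =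
      DirectSum.lof ℂ ℤ (fun i => 𝓥 i) n ⟨v, hv⟩ := by
    rw [LinearEquiv.symm_apply_eq]
    exact (DirectSum.coeLinearMap_lof 𝓥 n ⟨v, hv⟩).symm
  simp only [zproj, LinearMap.comp_apply, LinearEquiv.coe_coe, e]
  split_ifs with h
  · subst h
    rw [DirectSum.component.lof_self]; rfl
  · rw [DirectSum.component.of, dif_neg h]; rfl

theorem zproj_same {n : ℤ} {v : V} (hv : v ∈ 𝓥 n) : zproj hi n v = v := by
  rw [zproj_of_mem hi hv, if_pos rfl]

theorem eq_zero_of_zproj {v : V} (h : ∀ n, zproj hi n v = 0) : v = 0 := by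
  have : (LinearEquiv.ofBijective (DirectSum.coeLinearMap 𝓥) hi).symm v = 0 := by
    ext n
    exact h n
  exact (LinearEquiv.map_eq_zero_iff _).mp this

theorem induction_homogeneous (hi : DirectSum.IsInternal 𝓥) {T : Submodule ℂ V}
    (h : ∀ n, 𝓥 n ≤ T) (v : V) : v ∈ T := by
  have : (⨆ n, 𝓥 n) ≤ T := iSup_le h
  rw [hi.submodule_iSup_eq_top] at this
  exact this Submodule.mem_top

theorem exists_zproj_eq_zero_of_lt (v : V) : ∃ N : ℤ, ∀ n, N < |n| → zproj hi n v = 0 := by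
  refine induction_homogeneous hi (T :=
    { carrier := {v | ∃ N : ℤ, ∀ n, N < |n| → zproj hi n v = 0}
      zero_mem' := ⟨0, fun _ _ => map_zero _⟩
      add_mem' := ?_
      smul_mem' := ?_ }) ?_ v
  · rintro v w ⟨N, hN⟩ ⟨M, hM⟩
    exact ⟨max N M, fun n hn => by
      rw [map_add, hN n ((le_max_left _ _).trans_lt hn), hM n ((le_max_right _ _).trans_lt hn),
        add_zero]⟩
  · rintro c v ⟨N, hN⟩
    exact ⟨N, fun n hn => by rw [map_smul, hN n hn, smul_zero]⟩
  · intro n v hv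
    refine ⟨|n|, fun m hm => ?_⟩
    rw [zproj_of_mem hi hv, if_neg]
    rintro rfl; exact lt_irrefl _ hm

end Projection

section Modules

variable {V : Type*} [AddCommGroup V] [Module ℂ V] [LieRingModule VirLike V]
  [LieModule ℂ VirLike V]

/-- A subspace stable under the homogeneous components is a Lie submodule. -/
def lieSubOfGr (T : Submodule ℂ V) (hT : ∀ i, ∀ x ∈ gr b i, ∀ w ∈ T, ⁅x, w⁆ ∈ T) :
    LieSubmodule ℂ VirLike V where
  toSubmodule := T
  lie_mem := by
    intro x w hw
    change ⁅x, w⁆ ∈ T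
    induction x using induct with
    | hadd x y hx hy => rw [add_lie]; exact add_mem hx hy
    | hsmul t x hx => rw [smul_lie]; exact T.smul_mem t hx
    | hD p =>
      obtain ⟨i, m, rfl⟩ := exists_coords b p
      exact hT i _ (D_mem_gr b i m) w hw
    | hc u v => exact hT 0 _ (cen_mem_gr b u v) w hw

variable {b} in
/-- A submodule generated by homogeneous elements is graded. -/
theorem isGradedSub_lieSpan {𝓥 : ℤ → Submodule ℂ V}
    (hlie : ∀ (i j : ℤ), ∀ x ∈ gr b i, ∀ v ∈ 𝓥 j, ⁅x, v⁆ ∈ 𝓥 (i + j)) {S : Set V}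
    (hS : ∀ w ∈ S, ∃ n, w ∈ 𝓥 n) : IsGradedSub 𝓥 (LieSubmodule.lieSpan ℂ VirLike S) := by
  let N := LieSubmodule.lieSpan ℂ VirLike S
  have hT : ∀ i, ∀ x ∈ gr b i, ∀ w ∈ ⨆ n : ℤ, N.toSubmodule ⊓ 𝓥 n,
      ⁅x, w⁆ ∈ ⨆ n : ℤ, N.toSubmodule ⊓ 𝓥 n := by
    intro i x hx w hw
    refine (iSup_le (fun n w hw => ?_) : _ ≤ (⨆ n : ℤ, N.toSubmodule ⊓ 𝓥 n).comap
      (LieModule.toEnd ℂ VirLike V x)) hw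
    exact Submodule.mem_iSup_of_mem (i + n) ⟨N.lie_mem hw.1, hlie i n x hx w hw.2⟩
  have : N ≤ lieSubOfGr b _ hT := by
    refine LieSubmodule.lieSpan_le.mpr ?_
    intro w hw
    obtain ⟨n, hn⟩ := hS w hw
    exact Submodule.mem_iSup_of_mem n ⟨LieSubmodule.subset_lieSpan hw, hn⟩
  exact this

theorem lieSpan_eq_top_of_homogeneous {𝓥 : ℤ → Submodule ℂ V} (hg : IsZGraded b 𝓥)
    (hirr : IsGradedIrreducible 𝓥) {n : ℤ} {v : V} (hv : v ∈ 𝓥 n) (h0 : v ≠ 0) :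
    LieSubmodule.lieSpan ℂ VirLike {v} = ⊤ := by
  refine (hirr.2 _ (isGradedSub_lieSpan hg.lie_mem (S := {v}) ?_)).resolve_left ?_
  · rintro _ rfl; exact ⟨n, hv⟩
  · rw [LieSubmodule.lieSpan_eq_bot_iff]
    simpa using h0

/-- The operators by which `D(s i b₁ + m b₂)` acts. -/
noncomputable def opX (V : Type*) [AddCommGroup V] [Module ℂ V] [LieRingModule VirLike V]
    [LieModule ℂ VirLike V] (s : ℤˣ) (i m : ℤ) : Module.End ℂ V :=
  LieModule.toEnd ℂ VirLike V (D (((s : ℤ) * i) • b 0 + m • b 1))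

theorem opX_apply (s : ℤˣ) (i m : ℤ) (v : V) :
    opX b V s i m v = ⁅D (((s : ℤ) * i) • b 0 + m • b 1), v⁆ := rfl

theorem unit_sq (s : ℤˣ) : (s : ℤ) * s = 1 := by
  rw [← Units.val_mul, Int.units_mul_self, Units.val_one]

theorem virLikeRep_opX (s : ℤˣ) {κ : ℂ} (hκ : ∀ v : V, ⁅h (b 0), v⁆ = κ • v)
    (h1 : ∀ v : V, ⁅h (b 1), v⁆ = 0) :
    VirLikeRep ((s : ℤ) * (gdet (b 0) (b 1) : ℂ)) ((s : ℤ) * κ) (opX b V s) where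
  comm i m j n v := by
    have hs : ((s : ℤ) * i + (s : ℤ) * j = 0 ↔ i + j = 0) := by
      rw [← mul_add, mul_eq_zero]; simp
    rw [opX_apply, opX_apply, leibniz_lie, lie_D_coords, add_lie, smul_lie, ← mul_add, add_comm,
      ← add_assoc]
    congr 1
    · rw [opX_apply, opX_apply, opX_apply, sub_eq_add_neg ⁅D (((s : ℤ) * j) • b 0 + n • b 1), _⁆,
        ← neg_smul]
      congr 2
      push_cast; ring
    · simp only [mul_add, hs]
      split_ifs with hij
      · rw [add_lie, smul_lie, smul_lie, hκ, h1, smul_zero, add_zero, smul_smul]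
        congr 1; push_cast; ring
      · simp

theorem shiftsDegrees_opX {𝓥 : ℤ → Submodule ℂ V} (hg : IsZGraded b 𝓥) (s : ℤˣ) :
    ShiftsDegrees (opX b V s) fun n => 𝓥 (s * n) := by
  intro i m n v hv
  have := hg.lie_mem _ _ _ (D_mem_gr b ((s : ℤ) * i) m) v hv
  rwa [← mul_add, add_comm] at this

/-- A subspace stable under all `opX`, on a module where the centre acts by scalars, is a Lie
submodule. -/
def lieSubOfOpX (s : ℤˣ) {κ : ℂ} (hκ : ∀ v : V, ⁅h (b 0), v⁆ = κ • v)
    (h1 : ∀ v : V, ⁅h (b 1), v⁆ = 0) (T : Submodule ℂ V)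
    (hT : ∀ i m, ∀ w ∈ T, opX b V s i m w ∈ T) : LieSubmodule ℂ VirLike V where
  toSubmodule := T
  lie_mem := by
    intro x w hw
    change ⁅x, w⁆ ∈ T
    induction x using induct with
    | hadd x y hx hy => rw [add_lie]; exact add_mem hx hy
    | hsmul t x hx => rw [smul_lie]; exact T.smul_mem t hx
    | hD p =>
      obtain ⟨i, m, rfl⟩ := exists_coords b p
      have := hT (s * i) m w hw
      rwa [opX_apply, ← mul_assoc, unit_sq, one_mul] at this
    | hc u v =>
      obtain ⟨x, y, e⟩ := exists_cen_eq b u v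
      rw [e, add_lie, smul_lie, smul_lie, hκ, h1, smul_zero, add_zero]
      exact T.smul_mem _ (T.smul_mem _ hw)

theorem zproj_lie {𝓥 : ℤ → Submodule ℂ V} (hg : IsZGraded b 𝓥) {i : ℤ} {x : VirLike}
    (hx : x ∈ gr b i) (n : ℤ) (v : V) :
    zproj hg.isInternal (i + n) ⁅x, v⁆ = ⁅x, zproj hg.isInternal n v⁆ := by
  refine induction_homogeneous hg.isInternal (T := LinearMap.eqLocus
    (zproj hg.isInternal (i + n) ∘ₗ LieModule.toEnd ℂ VirLike V x)
    (LieModule.toEnd ℂ VirLike V x ∘ₗ zproj hg.isInternal n)) (fun m w hw => ?_) v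
  change zproj hg.isInternal (i + n) ⁅x, w⁆ = ⁅x, zproj hg.isInternal n w⁆
  rw [zproj_of_mem _ (hg.lie_mem i m x hx w hw), zproj_of_mem _ hw]
  by_cases h : m = n
  · subst h; simp
  · simp [h]

end Modules

/-- The centre of the Virasoro-like algebra is spanned by `c₁`, `c₂`. -/
theorem exists_cen_of_mem_center {z : VirLike} (hz : z ∈ LieAlgebra.center ℂ VirLike) :
    ∃ u v : ℂ, z = cen u v := by
  obtain ⟨f, u, v⟩ := z
  refine ⟨u, v, ?_⟩
  suffices hf : f = 0 by subst hf; rfl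
  by_contra hf
  obtain ⟨m, hm⟩ := Finsupp.ne_iff.mp hf
  -- The quarter turn of `m = (p, q)` has determinant `p² + q²` with it. The coordinate of `⁅D n,
  -- z⁆` at `m + n` is then `f m` times this determinant, so `z` is not central.
  obtain ⟨n, hn1, hn2⟩ : ∃ n : ℤ × ℤ, gdet m.1 n ≠ 0 ∧ m.1 + n ≠ 0 := by
    obtain ⟨⟨p, q⟩, hpq⟩ := m
    have hpq' : gdet (p, q) (-q, p) ≠ 0 := by
      simp only [gdet]
      intro h0
      apply hpq
      have : p * p + q * q = 0 := by linarith
      have hp : p = 0 := by nlinarith [mul_self_nonneg p, mul_self_nonneg q]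
      have hq : q = 0 := by nlinarith [mul_self_nonneg p, mul_self_nonneg q]
      rw [hp, hq]; rfl
    refine ⟨(-q, p), hpq', fun h0 => hpq' ?_⟩
    rw [← neg_eq_of_add_eq_zero_right h0]
    simp [gdet]; ring
  have hb : br (D n) (f, u, v) = 0 := hz (D n)
  have hn0 : n ≠ 0 := by rintro rfl; simp [gdet] at hn1
  have h2 := congrArg (fun w => coordD w ⟨m.1 + n, hn2⟩) hb
  have e1 : br (D n) (f, u, v) = f.sum fun p c => c • brD n p.1 := by
    change (Finsupp.linearCombination ℂ fun m : {m : ℤ × ℤ // m ≠ 0} =>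
      Finsupp.linearCombination ℂ fun n : {m : ℤ × ℤ // m ≠ 0} => brD m.1 n.1) (coordD (D n)) f = _
    rw [coordD_D ⟨n, hn0⟩, Finsupp.linearCombination_single, one_smul,
      Finsupp.linearCombination_apply]
  have e2 : ∀ p : {m : ℤ × ℤ // m ≠ 0}, coordD (brD n p.1) ⟨m.1 + n, hn2⟩ =
      if p = m then (gdet m.1 n : ℂ) else 0 := by
    intro p
    have e3 : coordD (if n + p.1 = 0 then h n else 0) = 0 := by
      split_ifs
      · exact coordD_cen _ _
      · simp
    rw [brD, map_add, e3, add_zero, map_smul, Finsupp.smul_apply]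
    by_cases hp : p = m
    · subst hp
      rw [if_pos rfl, add_comm n, coordD_D ⟨p.1 + n, hn2⟩, Finsupp.single_eq_same, smul_eq_mul,
        mul_one, ← Int.cast_neg]
      congr 1; simp [gdet]; ring
    · rw [if_neg hp]
      by_cases hq : n + p.1 = 0
      · rw [hq, D_zero]; simp
      · rw [coordD_D ⟨n + p.1, hq⟩, Finsupp.single_eq_of_ne, smul_zero]
        intro e
        apply hp
        have := congrArg Subtype.val e
        simp only at this
        exact Subtype.ext (by rw [add_comm m.1 n] at this; simpa using this.symm)
  simp only [e1, Finsupp.sum, map_sum, map_smul, Finsupp.coe_finsetSum, Finset.sum_apply,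
    Finsupp.smul_apply, e2, map_zero, Finsupp.coe_zero, Pi.zero_apply] at h2
  simp only [smul_eq_mul, mul_ite, mul_zero] at h2
  rw [Finset.sum_ite_eq' f.support m, if_pos (Finsupp.mem_support_iff.mpr hm)] at h2
  exact mul_ne_zero hm (by exact_mod_cast hn1) h2

end VirLike

/-! ### Straightening of words and the induced module. -/

namespace VirLike

variable (b : Module.Basis (Fin 2) ℤ (ℤ × ℤ)) (s : ℤˣ)

section Words

variable {V : Type*} [AddCommGroup V] [LieRingModule VirLike V]

/-- The iterated action of a list of elements, remembering their degrees. -/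
def wordAct (l : List (ℤ × VirLike)) (v : V) : V := l.foldr (fun p v => ⁅p.2, v⁆) v

theorem wordAct_cons (p : ℤ × VirLike) (l : List (ℤ × VirLike)) (v : V) :
    wordAct (p :: l) v = ⁅p.2, wordAct l v⁆ := rfl

variable [Module ℂ V]

theorem wordAct_mem {𝓥 : ℤ → Submodule ℂ V}
    (hlie : ∀ (i j : ℤ), ∀ x ∈ gr b i, ∀ v ∈ 𝓥 j, ⁅x, v⁆ ∈ 𝓥 (i + j))
    {l : List (ℤ × VirLike)} (hl : ∀ p ∈ l, p.2 ∈ gr b p.1) {d : ℤ} {v : V} (hv : v ∈ 𝓥 d) :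
    wordAct l v ∈ 𝓥 ((l.map Prod.fst).sum + d) := by
  induction l with
  | nil => simpa [wordAct]
  | cons p l ih =>
    rw [wordAct_cons, List.map_cons, List.sum_cons, add_assoc]
    exact hlie _ _ _ (hl p List.mem_cons_self) _ (ih fun q hq => hl q (List.mem_cons_of_mem _ hq))

/-- The span of the words of total degree `n` in strictly lowering elements (with respect to the
sign `s`), applied to vectors of `S`. -/
def lowerWords (S : Submodule ℂ V) (n : ℤ) : Submodule ℂ V :=
  Submodule.span ℂ {w | ∃ (l : List (ℤ × VirLike)) (v : V), v ∈ S ∧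
    (∀ p ∈ l, p.2 ∈ gr b p.1 ∧ (s : ℤ) * p.1 < 0) ∧ (l.map Prod.fst).sum = n ∧ w = wordAct l v}

variable {b s} {S : Submodule ℂ V}

theorem lowerWords_le_of_lie_mem {n : ℤ} {T : ℤ → Submodule ℂ V} (h0 : S ≤ T 0)
    (hT : ∀ i n, (s : ℤ) * i < 0 → ∀ x ∈ gr b i, ∀ w ∈ T n, ⁅x, w⁆ ∈ T (i + n)) :
    lowerWords b s S n ≤ T n := by
  refine Submodule.span_le.mpr ?_
  rintro _ ⟨l, v, hv, hl, rfl, rfl⟩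
  induction l with
  | nil => exact h0 hv
  | cons p l ih =>
    rw [wordAct_cons, List.map_cons, List.sum_cons]
    have hp := hl p List.mem_cons_self
    exact hT _ _ hp.2 _ hp.1 _ (ih fun q hq => hl q (List.mem_cons_of_mem _ hq))

theorem le_lowerWords_zero : S ≤ lowerWords b s S 0 := fun v hv =>
  Submodule.subset_span ⟨[], v, hv, by simp, rfl, rfl⟩

theorem lower_lie_mem_lowerWords [LieModule ℂ VirLike V] {i n : ℤ} (hi : (s : ℤ) * i < 0) {x : VirLike} (hx : x ∈ gr b i)
    {w : V} (hw : w ∈ lowerWords b s S n) : ⁅x, w⁆ ∈ lowerWords b s S (i + n) := by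
  refine (Submodule.span_le.mpr ?_ : lowerWords b s S n ≤
    (lowerWords b s S (i + n)).comap (LieModule.toEnd ℂ VirLike V x)) hw
  rintro _ ⟨l, v, hv, hl, rfl, rfl⟩
  refine Submodule.subset_span ⟨(i, x) :: l, v, hv, ?_, by simp, rfl⟩
  intro p hp
  rcases List.mem_cons.mp hp with rfl | hp
  · exact ⟨hx, hi⟩
  · exact hl p hp

theorem lower_sum_nonpos (l : List (ℤ × VirLike))
    (hl : ∀ p ∈ l, p.2 ∈ gr b p.1 ∧ (s : ℤ) * p.1 < 0) : (s : ℤ) * (l.map Prod.fst).sum ≤ 0 := by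
  induction l with
  | nil => simp
  | cons q l ih =>
    rw [List.map_cons, List.sum_cons, mul_add]
    have := (hl q List.mem_cons_self).2
    have := ih fun q hq => hl q (List.mem_cons_of_mem _ hq)
    omega

theorem lowerWords_pos {n : ℤ} (hn : 0 < (s : ℤ) * n) : lowerWords b s S n = ⊥ := by
  rw [eq_bot_iff]
  refine Submodule.span_le.mpr ?_
  rintro _ ⟨l, v, hv, hl, rfl, rfl⟩
  exact absurd (lower_sum_nonpos l hl) (by omega)

theorem lowerWords_zero_le : lowerWords b s S 0 ≤ S := by
  refine Submodule.span_le.mpr ?_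
  rintro _ ⟨l, v, hv, hl, hsum, rfl⟩
  cases l with
  | nil => exact hv
  | cons p l =>
    exfalso
    have h1 := lower_sum_nonpos l fun q hq => hl q (List.mem_cons_of_mem _ hq)
    have h2 := (hl p List.mem_cons_self).2
    rw [List.map_cons, List.sum_cons] at hsum
    have := congrArg (fun t => (s : ℤ) * t) hsum
    simp only [mul_add, mul_zero] at this
    omega

/-- Straightening: the span of the lowering words is stable under the whole algebra. -/
theorem lie_mem_lowerWords [LieModule ℂ VirLike V]
    (hpos : ∀ i, 0 < (s : ℤ) * i → ∀ x ∈ gr b i, ∀ v ∈ S, ⁅x, v⁆ = 0)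
    (hzero : ∀ x ∈ gr b 0, ∀ v ∈ S, ⁅x, v⁆ ∈ S) {i n : ℤ} {x : VirLike} (hx : x ∈ gr b i)
    {w : V} (hw : w ∈ lowerWords b s S n) : ⁅x, w⁆ ∈ lowerWords b s S (i + n) := by
  refine (Submodule.span_le.mpr ?_ : lowerWords b s S n ≤
    (lowerWords b s S (i + n)).comap (LieModule.toEnd ℂ VirLike V x)) hw
  clear hw
  rintro _ ⟨l, v, hv, hl, rfl, rfl⟩
  change ⁅x, wordAct l v⁆ ∈ lowerWords b s S (i + (l.map Prod.fst).sum)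
  induction l generalizing i x with
  | nil =>
    rw [List.map_nil, List.sum_nil, add_zero]
    change ⁅x, v⁆ ∈ lowerWords b s S i
    rcases lt_trichotomy ((s : ℤ) * i) 0 with h | h | h
    · simpa using lower_lie_mem_lowerWords h hx (le_lowerWords_zero (b := b) (s := s) hv)
    · have hi : i = 0 := by simpa using h
      subst hi
      exact le_lowerWords_zero (hzero x hx v hv)
    · rw [hpos i h x hx v hv]; exact zero_mem _
  | cons p l ih =>
    have hl' : ∀ q ∈ l, q.2 ∈ gr b q.1 ∧ (s : ℤ) * q.1 < 0 :=
      fun q hq => hl q (List.mem_cons_of_mem _ hq)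
    have hp := hl p List.mem_cons_self
    rw [wordAct_cons, leibniz_lie, List.map_cons, List.sum_cons]
    refine add_mem ?_ ?_
    · rw [← add_assoc]
      exact ih (lie_mem_gr b hx hp.1) hl'
    · rw [add_left_comm]
      exact lower_lie_mem_lowerWords hp.2 hp.1 (ih hx hl')

end Words

section Verma

variable (ψ : gr b 0 →ₗ[ℂ] ℂ)

theorem v0_raise {j : ℤ} (hj : 0 < (s : ℤ) * j) {x : VirLike} (hx : x ∈ gr b j) :
    ⁅x, v0 b s ψ⁆ = 0 := by
  change Submodule.Quotient.mk (p := vermaIdeal b s ψ)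
    (UniversalEnvelopingAlgebra.ι ℂ x * 1) = 0
  rw [mul_one, Submodule.Quotient.mk_eq_zero]
  exact Ideal.subset_span (Or.inl ⟨j, hj, x, hx, rfl⟩)

theorem v0_weight (x : gr b 0) : ⁅(x : VirLike), v0 b s ψ⁆ = ψ x • v0 b s ψ := by
  have : Submodule.Quotient.mk (p := vermaIdeal b s ψ)
      (UniversalEnvelopingAlgebra.ι ℂ (x : VirLike) -
        algebraMap ℂ (UniversalEnvelopingAlgebra ℂ VirLike) (ψ x)) = 0 := by
    rw [Submodule.Quotient.mk_eq_zero]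
    exact Ideal.subset_span (Or.inr ⟨x, rfl⟩)
  rw [Submodule.Quotient.mk_sub, sub_eq_zero] at this
  change Submodule.Quotient.mk (p := vermaIdeal b s ψ)
    (UniversalEnvelopingAlgebra.ι ℂ (x : VirLike) * 1) = _
  rw [mul_one, this, Algebra.algebraMap_eq_smul_one]
  rfl

/-- `U(L)` is a quotient of the tensor algebra, so it is generated by `L` and scalars. -/
theorem uea_smul_mem {M : Type*} [AddCommGroup M] [Module ℂ M]
    [Module (UniversalEnvelopingAlgebra ℂ VirLike) M]
    [IsScalarTower ℂ (UniversalEnvelopingAlgebra ℂ VirLike) M] (T : Submodule ℂ M)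
    (hT : ∀ x : VirLike, ∀ w ∈ T, UniversalEnvelopingAlgebra.ι ℂ x • w ∈ T)
    (u : UniversalEnvelopingAlgebra ℂ VirLike) {w : M} (hw : w ∈ T) : u • w ∈ T := by
  obtain ⟨t, rfl⟩ : ∃ t, UniversalEnvelopingAlgebra.mkAlgHom ℂ VirLike t = u :=
    RingCon.mkₐ_surjective _ u
  induction t using TensorAlgebra.induction generalizing w with
  | algebraMap r =>
    rw [AlgHom.commutes, algebraMap_smul]
    exact T.smul_mem r hw
  | ι x => exact hT x w hw
  | mul a c ha hc => rw [map_mul, mul_smul]; exact ha (hc hw)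
  | add a c ha hc => rw [map_add, add_smul]; exact add_mem (ha hw) (hc hw)

theorem verma_eq_top_of_v0_mem {N : LieSubmodule ℂ VirLike (Verma b s ψ)} (h : v0 b s ψ ∈ N) :
    N = ⊤ := by
  rw [eq_top_iff]
  rintro w -
  obtain ⟨u, rfl⟩ := Submodule.Quotient.mk_surjective (vermaIdeal b s ψ) w
  have := uea_smul_mem (M := Verma b s ψ) N.toSubmodule (fun x w hw => N.lie_mem hw) u h
  have e : u • v0 b s ψ = Submodule.Quotient.mk (p := vermaIdeal b s ψ) u := by
    change Submodule.Quotient.mk (p := vermaIdeal b s ψ) (u * 1) = _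
    rw [mul_one]
  rw [e] at this
  exact this

theorem wordAct_mem_vermaGr {l : List (ℤ × VirLike)} (hl : ∀ p ∈ l, p.2 ∈ gr b p.1) :
    wordAct l (v0 b s ψ) ∈ vermaGr b s ψ (l.map Prod.fst).sum :=
  Submodule.subset_span ⟨l, hl, rfl, rfl⟩

theorem v0_mem_vermaGr : v0 b s ψ ∈ vermaGr b s ψ 0 :=
  wordAct_mem_vermaGr b s ψ (l := []) (by simp)

theorem lie_mem_vermaGr (i n : ℤ) (x : VirLike) (hx : x ∈ gr b i) (w : Verma b s ψ)
    (hw : w ∈ vermaGr b s ψ n) : ⁅x, w⁆ ∈ vermaGr b s ψ (i + n) := by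
  refine (Submodule.span_le.mpr ?_ : vermaGr b s ψ n ≤
    (vermaGr b s ψ (i + n)).comap (LieModule.toEnd ℂ VirLike _ x)) hw
  rintro _ ⟨l, hl, rfl, rfl⟩
  refine Submodule.subset_span ⟨(i, x) :: l, ?_, by simp, rfl⟩
  intro p hp
  rcases List.mem_cons.mp hp with rfl | hp
  · exact hx
  · exact hl p hp

/-- This is the spanning half of Poincaré–Birkhoff–Witt, the only half needed: it bounds the
components in degree 0 and above. Independence of the components of the induced module is never
used, since components are always compared after mapping to a graded `V`. -/
theorem vermaGr_le_lowerWords (n : ℤ) :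
    vermaGr b s ψ n ≤ lowerWords b s (Submodule.span ℂ {v0 b s ψ}) n := by
  refine Submodule.span_le.mpr ?_
  rintro _ ⟨l, hl, rfl, rfl⟩
  have := wordAct_mem b (𝓥 := fun n => lowerWords b s (Submodule.span ℂ {v0 b s ψ}) n)
    (fun i j x hx v hv => lie_mem_lowerWords ?_ ?_ hx hv) hl
    (le_lowerWords_zero (Submodule.mem_span_singleton_self _))
  · rwa [add_zero] at this
  · intro i hi x hx v hv
    obtain ⟨c, rfl⟩ := Submodule.mem_span_singleton.mp hv
    rw [lie_smul, v0_raise b s ψ hi hx, smul_zero]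
  · intro x hx v hv
    obtain ⟨c, rfl⟩ := Submodule.mem_span_singleton.mp hv
    rw [lie_smul, v0_weight b s ψ ⟨x, hx⟩]
    exact Submodule.smul_mem _ _ (Submodule.smul_mem _ _ (Submodule.mem_span_singleton_self _))

theorem vermaGr_pos {n : ℤ} (hn : 0 < (s : ℤ) * n) : vermaGr b s ψ n = ⊥ := by
  rw [eq_bot_iff, ← lowerWords_pos (b := b) (S := Submodule.span ℂ {v0 b s ψ}) hn]
  exact vermaGr_le_lowerWords b s ψ n

theorem vermaGr_zero_le : vermaGr b s ψ 0 ≤ Submodule.span ℂ {v0 b s ψ} :=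
  (vermaGr_le_lowerWords b s ψ 0).trans lowerWords_zero_le

theorem iSup_vermaGr : ⨆ n, vermaGr b s ψ n = ⊤ := by
  have hT : ∀ i, ∀ x ∈ gr b i, ∀ w ∈ ⨆ n, vermaGr b s ψ n, ⁅x, w⁆ ∈ ⨆ n, vermaGr b s ψ n := by
    intro i x hx w hw
    refine (iSup_le (fun n w hw => ?_) : _ ≤ (⨆ n, vermaGr b s ψ n).comap
      (LieModule.toEnd ℂ VirLike _ x)) hw
    exact Submodule.mem_iSup_of_mem (i + n) (lie_mem_vermaGr b s ψ i n x hx w hw)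
  have := verma_eq_top_of_v0_mem b s ψ (N := lieSubOfGr b _ hT)
    (Submodule.mem_iSup_of_mem 0 (v0_mem_vermaGr b s ψ))
  exact congrArg LieSubmodule.toSubmodule this

theorem isGradedSub_vermaRad : IsGradedSub (vermaGr b s ψ) (vermaRad b s ψ) := by
  have hT : ∀ i, ∀ x ∈ gr b i,
      ∀ w ∈ ⨆ n : ℤ, (vermaRad b s ψ).toSubmodule ⊓ vermaGr b s ψ n,
      ⁅x, w⁆ ∈ ⨆ n : ℤ, (vermaRad b s ψ).toSubmodule ⊓ vermaGr b s ψ n := by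
    intro i x hx w hw
    refine (iSup_le (fun n w hw => ?_) : _ ≤
      (⨆ n : ℤ, (vermaRad b s ψ).toSubmodule ⊓ vermaGr b s ψ n).comap
      (LieModule.toEnd ℂ VirLike _ x)) hw
    exact Submodule.mem_iSup_of_mem (i + n)
      ⟨(vermaRad b s ψ).lie_mem hw.1, lie_mem_vermaGr b s ψ i n x hx w hw.2⟩
  have : vermaRad b s ψ ≤ lieSubOfGr b _ hT := by
    refine sSup_le fun N hN => ?_
    intro w hw
    refine (iSup_mono fun n => inf_le_inf_right _ ?_ :
      (⨆ n : ℤ, N.toSubmodule ⊓ vermaGr b s ψ n) ≤ _) (hN.2 hw)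
    exact LieSubmodule.toSubmodule_le_toSubmodule _ _ |>.mpr (le_sSup hN)
  exact this

/-! ### Homogeneous maps out of the induced module and their kernels. -/

section Lift

variable {V : Type*} [AddCommGroup V] [Module ℂ V] [LieRingModule VirLike V]

/-- `v` is annihilated by `L_±` and is a weight vector for `L_0`. -/
structure IsWeightSingular (v : V) : Prop where
  raise : ∀ i, 0 < (s : ℤ) * i → ∀ x ∈ gr b i, ⁅x, v⁆ = 0
  weight : ∀ x : gr b 0, ⁅(x : VirLike), v⁆ = ψ x • v

variable {b s ψ}

/-- The universal property of the induced module. -/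
theorem exists_vermaLift [LieModule ℂ VirLike V] {v : V} (hv : IsWeightSingular b s ψ v) :
    ∃ φ : Verma b s ψ →ₗ⁅ℂ, VirLike⁆ V, φ (v0 b s ψ) = v := by
  let U := UniversalEnvelopingAlgebra ℂ VirLike
  let ρ : U →ₐ[ℂ] Module.End ℂ V :=
    UniversalEnvelopingAlgebra.lift ℂ (LieModule.toEnd ℂ VirLike V)
  have hρ : ∀ (x : VirLike) (w : V), ρ (UniversalEnvelopingAlgebra.ι ℂ x) w = ⁅x, w⁆ := by
    intro x w
    rw [UniversalEnvelopingAlgebra.lift_ι_apply]; rfl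
  let _ : Module U V := Module.compHom V ρ.toRingHom
  have hsmul : ∀ (u : U) (w : V), u • w = ρ u w := fun _ _ => rfl
  let f : U →ₗ[U] V := LinearMap.toSpanSingleton U V v
  have hf : vermaIdeal b s ψ ≤ LinearMap.ker f := by
    refine Submodule.span_le.mpr ?_
    rintro _ (⟨j, hj, x, hx, rfl⟩ | ⟨x, rfl⟩)
    · change ρ (UniversalEnvelopingAlgebra.ι ℂ x) v = 0
      rw [hρ, hv.raise j hj x hx]
    · change ρ (UniversalEnvelopingAlgebra.ι ℂ (x : VirLike) - algebraMap ℂ U (ψ x)) v = 0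
      rw [map_sub, LinearMap.sub_apply, hρ, hv.weight, AlgHom.commutes]
      exact sub_self _
  let F : Verma b s ψ →ₗ[U] V := (vermaIdeal b s ψ).liftQ f hf
  refine ⟨{ toFun := F, map_add' := map_add F, map_smul' := ?_, map_lie' := ?_ }, ?_⟩
  · intro c w
    have e : c • w = (algebraMap ℂ U c) • w := (algebraMap_smul U c w).symm
    rw [e, map_smul, hsmul, AlgHom.commutes]; rfl
  · intro x w
    change F (UniversalEnvelopingAlgebra.ι ℂ x • w) = ⁅x, F w⁆
    rw [map_smul, hsmul, hρ]
  · change ρ 1 v = v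
    rw [map_one]; rfl

theorem map_wordAct {W : Type*} [AddCommGroup W] [Module ℂ W] [LieRingModule VirLike W]
    (φ : W →ₗ⁅ℂ, VirLike⁆ V) (l : List (ℤ × VirLike)) (w : W) :
    φ (wordAct l w) = wordAct l (φ w) := by
  induction l with
  | nil => rfl
  | cons p l ih => rw [wordAct_cons, wordAct_cons, LieModuleHom.map_lie, ih]

theorem map_vermaGr {𝓥 : ℤ → Submodule ℂ V} (hg : IsZGraded b 𝓥)
    (φ : Verma b s ψ →ₗ⁅ℂ, VirLike⁆ V) {d : ℤ} (hd : φ (v0 b s ψ) ∈ 𝓥 d) {n : ℤ}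
    {w : Verma b s ψ} (hw : w ∈ vermaGr b s ψ n) : φ w ∈ 𝓥 (n + d) := by
  refine (Submodule.span_le.mpr ?_ : vermaGr b s ψ n ≤
    (𝓥 (n + d)).comap (φ : Verma b s ψ →ₗ[ℂ] V)) hw
  rintro _ ⟨l, hl, rfl, rfl⟩
  change φ (wordAct l _) ∈ 𝓥 ((l.map Prod.fst).sum + d)
  rw [map_wordAct]
  exact wordAct_mem b hg.lie_mem hl hd

/-- Every vector of the image of a homogeneous map has homogeneous components in the image. -/
theorem exists_components {𝓥 : ℤ → Submodule ℂ V} (hg : IsZGraded b 𝓥)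
    (φ : Verma b s ψ →ₗ⁅ℂ, VirLike⁆ V) {d : ℤ} (hd : φ (v0 b s ψ) ∈ 𝓥 d)
    {N : Submodule ℂ (Verma b s ψ)} {w : Verma b s ψ} (hw : w ∈ ⨆ n : ℤ, N ⊓ vermaGr b s ψ n) :
    ∃ f : ℤ →₀ Verma b s ψ, (∀ n, f n ∈ N ⊓ vermaGr b s ψ n) ∧ (f.sum fun _ x => x) = w ∧
      ∀ n, zproj hg.isInternal (n + d) (φ w) = φ (f n) := by
  obtain ⟨f, hf, rfl⟩ := (Submodule.mem_iSup_iff_exists_finsupp _ _).mp hw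
  refine ⟨f, hf, rfl, fun n => ?_⟩
  simp only [Finsupp.sum, map_sum]
  rw [Finset.sum_eq_single n]
  · exact zproj_same _ (map_vermaGr hg φ hd (hf n).2)
  · intro m _ hmn
    rw [zproj_of_mem _ (map_vermaGr hg φ hd (hf m).2), if_neg (by omega)]
  · intro hn
    rw [Finsupp.notMem_support_iff.mp hn, map_zero, map_zero]

theorem mem_iSup_top_inf (w : Verma b s ψ) :
    w ∈ ⨆ n : ℤ, (⊤ : Submodule ℂ (Verma b s ψ)) ⊓ vermaGr b s ψ n := by
  simp only [top_inf_eq, iSup_vermaGr]; exact Submodule.mem_top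

/-- The kernel of a homogeneous map is graded, and it is proper because it misses `v0`. -/
theorem ker_le_vermaRad {𝓥 : ℤ → Submodule ℂ V} (hg : IsZGraded b 𝓥)
    (φ : Verma b s ψ →ₗ⁅ℂ, VirLike⁆ V) {d : ℤ} (hd : φ (v0 b s ψ) ∈ 𝓥 d)
    (h0 : φ (v0 b s ψ) ≠ 0) : φ.ker ≤ vermaRad b s ψ := by
  refine le_sSup ⟨fun h => h0 ?_, fun w hw => ?_⟩
  · exact LieModuleHom.mem_ker.mp (h ▸ LieSubmodule.mem_top _)
  · obtain ⟨f, hf, hfw, hφ⟩ := exists_components hg φ hd (mem_iSup_top_inf w)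
    rw [← hfw]
    refine Submodule.sum_mem _ fun n _ => Submodule.mem_iSup_of_mem n ⟨?_, (hf n).2⟩
    change f n ∈ φ.ker
    rw [LieModuleHom.mem_ker, ← hφ]
    have : φ w = 0 := LieModuleHom.mem_ker.mp hw
    rw [this, map_zero]

/-- The image of a proper graded `N` is a graded submodule of `V`. Were it all of `V`, the degree-0
component of a preimage of `φ v0` would be a nonzero multiple of `v0` in `N`, making `N` everything.
-/
theorem vermaRad_le_ker {𝓥 : ℤ → Submodule ℂ V} (hg : IsZGraded b 𝓥)
    (hirr : IsGradedIrreducible 𝓥) (φ : Verma b s ψ →ₗ⁅ℂ, VirLike⁆ V) {d : ℤ}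
    (hd : φ (v0 b s ψ) ∈ 𝓥 d) (h0 : φ (v0 b s ψ) ≠ 0) : vermaRad b s ψ ≤ φ.ker := by
  refine sSup_le fun N hN => ?_
  have hgr : IsGradedSub 𝓥 (N.map φ) := by
    rintro _ ⟨w, hw, rfl⟩
    obtain ⟨f, hf, hfw, -⟩ := exists_components hg φ hd (hN.2 hw)
    rw [← hfw]
    simp only [Finsupp.sum, LieModuleHom.coe_toLinearMap, map_sum]
    refine Submodule.sum_mem _ fun n _ => Submodule.mem_iSup_of_mem (n + d) ⟨?_, ?_⟩
    · exact ⟨f n, (hf n).1, rfl⟩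
    · exact map_vermaGr hg φ hd (hf n).2
  rcases hirr.2 _ hgr with h | h
  · intro w hw
    rw [LieModuleHom.mem_ker]
    have : φ w ∈ N.map φ := ⟨w, hw, rfl⟩
    rw [h] at this
    exact (LieSubmodule.mem_bot _).mp this
  · exfalso
    obtain ⟨w, hw, hwv⟩ : φ (v0 b s ψ) ∈ N.map φ := h ▸ LieSubmodule.mem_top _
    obtain ⟨f, hf, -, hφ⟩ := exists_components hg φ hd (hN.2 hw)
    have e := hφ 0
    have hwv' : φ w = φ (v0 b s ψ) := hwv
    rw [hwv', zero_add, zproj_same _ hd] at e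
    obtain ⟨c, hc⟩ := Submodule.mem_span_singleton.mp (vermaGr_zero_le b s ψ (hf 0).2)
    have hc0 : c ≠ 0 := by
      rintro rfl
      rw [← hc, zero_smul, map_zero] at e
      exact h0 e
    refine hN.1 (verma_eq_top_of_v0_mem b s ψ ?_)
    have := N.smul_mem c⁻¹ ((hf 0).1 : f 0 ∈ N)
    rwa [← hc, inv_smul_smul₀ hc0] at this

/-- The first isomorphism theorem for maps with kernel `vermaRad`. -/
theorem nonempty_equiv_irrWt (φ : Verma b s ψ →ₗ⁅ℂ, VirLike⁆ V) (hφ : Function.Surjective φ)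
    (hker : φ.ker = vermaRad b s ψ) : Nonempty (V ≃ₗ⁅ℂ, VirLike⁆ IrrWt b s ψ) := by
  have hle : (vermaRad b s ψ).toSubmodule ≤ LinearMap.ker (φ : Verma b s ψ →ₗ[ℂ] V) := by
    intro w hw
    have : w ∈ φ.ker := hker ▸ hw
    exact this
  let F : IrrWt b s ψ →ₗ[ℂ] V := (vermaRad b s ψ).toSubmodule.liftQ _ hle
  have hF : ∀ w, F (LieSubmodule.Quotient.mk' _ w) = φ w := fun w => rfl
  let G : IrrWt b s ψ →ₗ⁅ℂ, VirLike⁆ V :=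
    { F with
      map_lie' := by
        intro x w
        obtain ⟨w, rfl⟩ := LieSubmodule.Quotient.surjective_mk' _ w
        change F ⁅x, LieSubmodule.Quotient.mk' _ w⁆ = ⁅x, F (LieSubmodule.Quotient.mk' _ w)⁆
        rw [← LieModuleHom.map_lie, hF, hF, LieModuleHom.map_lie] }
  have hbij : Function.Bijective F := by
    constructor
    · rw [injective_iff_map_eq_zero]
      intro w hw
      obtain ⟨w, rfl⟩ := LieSubmodule.Quotient.surjective_mk' _ w
      rw [hF] at hw
      rw [LieSubmodule.Quotient.mk_eq_zero, ← hker, LieModuleHom.mem_ker, hw]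
    · intro v
      obtain ⟨w, rfl⟩ := hφ v
      exact ⟨LieSubmodule.Quotient.mk' _ w, hF w⟩
  let E := LinearEquiv.ofBijective F hbij
  exact ⟨LieModuleEquiv.symm { G with
    invFun := E.symm
    left_inv := E.symm_apply_apply
    right_inv := E.apply_symm_apply }⟩

end Lift

end Verma

end VirLike

/-! ### From ungraded isomorphisms to homogeneous copies; raising to the extremal vector. -/

namespace VirLike

variable {b : Module.Basis (Fin 2) ℤ (ℤ × ℤ)} {s : ℤˣ} {ψ : gr b 0 →ₗ[ℂ] ℂ}
  {V : Type*} [AddCommGroup V] [Module ℂ V] [LieRingModule VirLike V]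
  {𝓥 : ℤ → Submodule ℂ V}

theorem isWeightSingular_map_v0 (φ : Verma b s ψ →ₗ⁅ℂ, VirLike⁆ V) :
    IsWeightSingular b s ψ (φ (v0 b s ψ)) where
  raise i hi x hx := by rw [← LieModuleHom.map_lie, v0_raise b s ψ hi hx, map_zero]
  weight x := by rw [← LieModuleHom.map_lie, v0_weight, map_smul]

theorem zproj_map_pos {n : ℤ} (hn : 0 < (s : ℤ) * n) (hg : IsZGraded b 𝓥)
    (φ : Verma b s ψ →ₗ⁅ℂ, VirLike⁆ V) {d : ℤ} (hd : φ (v0 b s ψ) ∈ 𝓥 d) (y : Verma b s ψ) :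
    zproj hg.isInternal (n + d) (φ y) = 0 := by
  obtain ⟨f, hf, -, hφ⟩ := exists_components hg φ hd (mem_iSup_top_inf y)
  have := (hf n).2
  rw [vermaGr_pos b s ψ hn] at this
  rw [hφ, (Submodule.mem_bot ℂ).mp this, map_zero]

theorem zproj_map_zero (hg : IsZGraded b 𝓥)
    (φ : Verma b s ψ →ₗ⁅ℂ, VirLike⁆ V) {d : ℤ} (hd : φ (v0 b s ψ) ∈ 𝓥 d) (y : Verma b s ψ) :
    ∃ c : ℂ, zproj hg.isInternal d (φ y) = c • φ (v0 b s ψ) := by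
  obtain ⟨f, hf, -, hφ⟩ := exists_components hg φ hd (mem_iSup_top_inf y)
  obtain ⟨c, hc⟩ := Submodule.mem_span_singleton.mp (vermaGr_zero_le b s ψ (hf 0).2)
  refine ⟨c, ?_⟩
  have := hφ 0
  rw [zero_add] at this
  rw [this, ← hc, map_smul]

variable [LieModule ℂ VirLike V]

/-- The conditions are imposed by homogeneous elements, which commute with projections up to a shift
of degree. -/
theorem IsWeightSingular.zproj (hg : IsZGraded b 𝓥) {v : V} (hv : IsWeightSingular b s ψ v)
    (n : ℤ) : IsWeightSingular b s ψ (zproj hg.isInternal n v) where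
  raise i hi x hx := by rw [← zproj_lie b hg hx, hv.raise i hi x hx, map_zero]
  weight x := by
    have := zproj_lie b hg x.2 n v
    rw [zero_add] at this
    rw [← this, hv.weight, map_smul]

theorem zproj_wordAct (hg : IsZGraded b 𝓥) {l : List (ℤ × VirLike)}
    (hl : ∀ p ∈ l, p.2 ∈ gr b p.1) (n : ℤ) (v : V) :
    zproj hg.isInternal ((l.map Prod.fst).sum + n) (wordAct l v) =
      wordAct l (zproj hg.isInternal n v) := by
  induction l with
  | nil => simp [wordAct]
  | cons p l ih =>
    rw [wordAct_cons, wordAct_cons, List.map_cons, List.sum_cons, add_assoc,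
      zproj_lie b hg (hl p List.mem_cons_self),
      ih fun q hq => hl q (List.mem_cons_of_mem _ hq)]

/-- A graded module isomorphic to an irreducible weight quotient, possibly in a non-homogeneous
way, contains a homogeneous copy of it. -/
theorem exists_homogeneous_lift [Nontrivial V] (hg : IsZGraded b 𝓥)
    (e : V ≃ₗ⁅ℂ, VirLike⁆ IrrWt b s ψ) :
    ∃ (d : ℤ) (φ : Verma b s ψ →ₗ⁅ℂ, VirLike⁆ V), φ (v0 b s ψ) ∈ 𝓥 d ∧ φ (v0 b s ψ) ≠ 0 ∧
      φ.ker = vermaRad b s ψ := by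
  let Φ : Verma b s ψ →ₗ⁅ℂ, VirLike⁆ V :=
    (e.symm : IrrWt b s ψ →ₗ⁅ℂ, VirLike⁆ V).comp (LieSubmodule.Quotient.mk' (vermaRad b s ψ))
  have hΦ : ∀ w, Φ w = 0 ↔ w ∈ vermaRad b s ψ := by
    intro w
    rw [← LieSubmodule.Quotient.mk_eq_zero (N := vermaRad b s ψ)]
    exact LinearEquiv.map_eq_zero_iff e.symm.toLinearEquiv
  have hne : Φ (v0 b s ψ) ≠ 0 := by
    intro h
    have h1 := verma_eq_top_of_v0_mem b s ψ ((hΦ _).mp h)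
    obtain ⟨v, hv⟩ := exists_ne (0 : V)
    obtain ⟨w, hw⟩ := LieSubmodule.Quotient.surjective_mk' (vermaRad b s ψ) (e v)
    have : (LieSubmodule.Quotient.mk' (vermaRad b s ψ)) w = 0 := by
      rw [LieSubmodule.Quotient.mk_eq_zero, h1]; exact LieSubmodule.mem_top _
    rw [this] at hw
    exact hv ((LinearEquiv.map_eq_zero_iff e.toLinearEquiv).mp hw.symm)
  obtain ⟨d, hd⟩ : ∃ d, zproj hg.isInternal d (Φ (v0 b s ψ)) ≠ 0 := by
    by_contra! h
    exact hne (eq_zero_of_zproj hg.isInternal h)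
  obtain ⟨φ, hφ⟩ := exists_vermaLift ((isWeightSingular_map_v0 Φ).zproj hg d)
  have hφd : φ (v0 b s ψ) ∈ 𝓥 d := hφ ▸ zproj_mem _ _ _
  have hφ0 : φ (v0 b s ψ) ≠ 0 := hφ ▸ hd
  -- On degree `n`, the new map is a component of the old one, so it kills the graded pieces of
  -- `vermaRad`.
  have hcomp : ∀ n, ∀ w ∈ vermaGr b s ψ n, φ w = zproj hg.isInternal (n + d) (Φ w) := by
    intro n w hw
    refine (Submodule.span_le.mpr ?_ : vermaGr b s ψ n ≤ LinearMap.eqLocus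
      (φ : Verma b s ψ →ₗ[ℂ] V)
      (zproj hg.isInternal (n + d) ∘ₗ (Φ : Verma b s ψ →ₗ[ℂ] V))) hw
    rintro _ ⟨l, hl, rfl, rfl⟩
    change φ (wordAct l _) = zproj hg.isInternal _ (Φ (wordAct l _))
    rw [map_wordAct, map_wordAct, zproj_wordAct hg hl, hφ]
  refine ⟨d, φ, hφd, hφ0, le_antisymm (ker_le_vermaRad hg φ hφd hφ0) ?_⟩
  intro w hw
  refine (iSup_le fun n w hw => ?_ : (⨆ n : ℤ, (vermaRad b s ψ).toSubmodule ⊓ vermaGr b s ψ n) ≤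
    LinearMap.ker (φ : Verma b s ψ →ₗ[ℂ] V)) (isGradedSub_vermaRad b s ψ hw)
  change φ w = 0
  rw [hcomp n w hw.2, (hΦ w).mpr hw.1, map_zero]

section HomogeneousLift

variable (hg : IsZGraded b 𝓥) (φ : Verma b s ψ →ₗ⁅ℂ, VirLike⁆ V) {d : ℤ}
  (hd : φ (v0 b s ψ) ∈ 𝓥 d) (h0 : φ (v0 b s ψ) ≠ 0) (hker : φ.ker = vermaRad b s ψ)

include hg hd h0 hker

/-- A singular vector strictly below the top generates nothing above its own degree, so `y`
generates a proper graded submodule, which lies in `vermaRad`, the kernel of `φ`. -/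
theorem eq_zero_of_singular {k : ℤ} (hk : (s : ℤ) * k < 0) {y : Verma b s ψ}
    (hy : y ∈ vermaGr b s ψ k)
    (hsing : ∀ i, 0 < (s : ℤ) * i → ∀ x ∈ gr b i, ⁅x, φ y⁆ = 0) : φ y = 0 := by
  -- All singular vectors of this degree are taken at once: this space is stable under `L_0`, as
  -- straightening requires, whereas `φ y` need not be a weight vector.
  let S : Submodule ℂ V :=
    { carrier := {w | w ∈ 𝓥 (k + d) ∧ ∀ i, 0 < (s : ℤ) * i → ∀ x ∈ gr b i, ⁅x, w⁆ = 0}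
      zero_mem' := ⟨zero_mem _, fun i _ x _ => lie_zero x⟩
      add_mem' := fun {v w} hv hw => ⟨add_mem hv.1 hw.1, fun i hi x hx => by
        rw [lie_add, hv.2 i hi x hx, hw.2 i hi x hx, add_zero]⟩
      smul_mem' := fun c w hw => ⟨Submodule.smul_mem _ c hw.1, fun i hi x hx => by
        rw [lie_smul, hw.2 i hi x hx, smul_zero]⟩ }
  have hT : ∀ i, ∀ x ∈ gr b i, ∀ w ∈ ⨆ n, lowerWords b s S n, ⁅x, w⁆ ∈ ⨆ n, lowerWords b s S n := by
    intro i x hx w hw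
    refine (iSup_le (fun n w hw => ?_) : _ ≤ (⨆ n, lowerWords b s S n).comap
      (LieModule.toEnd ℂ VirLike _ x)) hw
    have hS : ∀ x ∈ gr b 0, ∀ v ∈ S, ⁅x, v⁆ ∈ S := by
      rintro x hx v ⟨hv, hv'⟩
      refine ⟨?_, fun i hi z hz => ?_⟩
      · have := hg.lie_mem 0 _ x hx v hv
        rwa [zero_add] at this
      · have hzx := lie_mem_gr b hz hx
        rw [leibniz_lie, hv' i hi z hz, lie_zero, add_zero]
        exact hv' (i + 0) (by rwa [add_zero]) _ hzx
    exact Submodule.mem_iSup_of_mem (i + n)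
      (lie_mem_lowerWords (S := S) (fun i hi x hx v hv => hv.2 i hi x hx) hS hx hw)
  let N := LieSubmodule.lieSpan ℂ VirLike {y}
  have hN : IsGradedSub (vermaGr b s ψ) N := isGradedSub_lieSpan (lie_mem_vermaGr b s ψ)
    (by rintro _ rfl; exact ⟨k, hy⟩)
  have hyN : y ∈ N := LieSubmodule.subset_lieSpan rfl
  by_cases htop : N = ⊤
  · exfalso
    have hle : N ≤ (lieSubOfGr b _ hT).comap φ := by
      refine LieSubmodule.lieSpan_le.mpr (Set.singleton_subset_iff.mpr ?_)
      have hkd : φ y ∈ 𝓥 (k + d) := map_vermaGr hg φ hd hy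
      exact Submodule.mem_iSup_of_mem 0 (le_lowerWords_zero ⟨hkd, hsing⟩)
    have hv : φ (v0 b s ψ) ∈ ⨆ n, lowerWords b s S n :=
      hle (htop ▸ LieSubmodule.mem_top _)
    have hz : (⨆ n, lowerWords b s S n) ≤ LinearMap.ker (zproj hg.isInternal d) := by
      refine iSup_le fun n => ?_
      by_cases hn : 0 < (s : ℤ) * n
      · rw [lowerWords_pos hn]; exact bot_le
      · intro w hw
        have hw' : w ∈ 𝓥 (n + (k + d)) := by
          refine lowerWords_le_of_lie_mem (T := fun n => 𝓥 (n + (k + d))) ?_ ?_ hw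
          · intro v hv
            rw [zero_add]; exact hv.1
          · intro i n _ x hx w hw
            rw [add_assoc]; exact hg.lie_mem _ _ x hx w hw
        rw [LinearMap.mem_ker, zproj_of_mem _ hw', if_neg]
        intro h
        have : n = -k := by omega
        rw [this, mul_neg] at hn
        omega
    have := hz hv
    rw [LinearMap.mem_ker, zproj_same _ hd] at this
    exact h0 this
  · have : N ≤ vermaRad b s ψ := le_sSup ⟨htop, hN⟩
    have := this hyN
    rwa [← hker, LieModuleHom.mem_ker] at this

/-- Every nonzero vector of the image generates the highest weight vector. -/
theorem v0_mem_of_lowest_component (N : LieSubmodule ℂ VirLike V) (hN : ∀ w ∈ N, ∃ y, φ y = w)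
    (k : ℕ) :
    ∀ w ∈ N, zproj hg.isInternal (-((s : ℤ) * k) + d) w ≠ 0 →
      (∀ m : ℕ, k < m → zproj hg.isInternal (-((s : ℤ) * m) + d) w = 0) → φ (v0 b s ψ) ∈ N := by
  induction k using Nat.strong_induction_on with
  | _ k ih =>
  intro w hw hne hlow
  obtain ⟨y, rfl⟩ := hN w hw
  have hss := unit_sq s
  rcases Nat.eq_zero_or_pos k with rfl | hk
  · obtain ⟨c, hc⟩ := zproj_map_zero hg φ hd y
    rw [Nat.cast_zero, mul_zero, neg_zero, zero_add] at hne
    have hc0 : c ≠ 0 := by rintro rfl; exact hne (by rw [hc, zero_smul])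
    have : φ y = c • φ (v0 b s ψ) := by
      rw [← sub_eq_zero, ← hc]
      refine eq_zero_of_zproj hg.isInternal fun n => ?_
      rw [map_sub, zproj_of_mem _ (zproj_mem hg.isInternal d (φ y))]
      obtain ⟨n, rfl⟩ : ∃ n', n = n' + d := ⟨n - d, by ring⟩
      rcases lt_trichotomy ((s : ℤ) * n) 0 with h | h | h
      · have e : n = -((s : ℤ) * ((-((s : ℤ) * n)).toNat : ℤ)) := by
          rw [Int.toNat_of_nonneg (by omega), mul_neg, ← mul_assoc, hss]; ring
        rw [if_neg (by rintro h'; have : n = 0 := by omega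
                       subst this; simp at h), sub_zero, e]
        exact hlow _ (by omega)
      · have hn : n = 0 := by simpa using h
        subst hn
        simp
      · rw [zproj_map_pos h hg φ hd, if_neg, sub_zero]
        rintro h'
        have : n = 0 := by omega
        subst this; simp at h
    have h2 := N.smul_mem c⁻¹ hw
    rwa [this, inv_smul_smul₀ hc0] at h2
  · obtain ⟨f, hf, -, hφ⟩ := exists_components hg φ hd (mem_iSup_top_inf y)
    have hneg : (s : ℤ) * (-((s : ℤ) * k)) < 0 := by
      rw [mul_neg, ← mul_assoc, hss]; omega
    -- The deepest component is nonzero below the top, hence not singular. Some raising `x` acts on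
    -- it nontrivially, and `⁅x, w⁆` then has smaller depth.
    obtain ⟨i, hi, x, hx, hne2⟩ : ∃ i, 0 < (s : ℤ) * i ∧ ∃ x ∈ gr b i,
        ⁅x, φ (f (-((s : ℤ) * k)))⁆ ≠ 0 := by
      by_contra! h
      rw [hφ] at hne
      exact hne (eq_zero_of_singular hg φ hd h0 hker hneg (hf _).2 h)
    rw [← hφ, ← zproj_lie b hg hx, ← LieModuleHom.map_lie] at hne2
    have hik : (s : ℤ) * i ≤ k := by
      by_contra! hlt
      refine hne2 ?_
      rw [← add_assoc]
      refine zproj_map_pos ?_ hg φ hd _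
      rw [mul_add, mul_neg, ← mul_assoc, hss]; omega
    obtain ⟨j, hj⟩ : ∃ j : ℕ, (s : ℤ) * i = j := ⟨((s : ℤ) * i).toNat, by omega⟩
    have hi' : i = s * j := by rw [← hj, ← mul_assoc, hss, one_mul]
    refine ih (k - j) (by omega) _ (N.lie_mem (x := x) hw) ?_ fun m hm => ?_
    · rw [LieModuleHom.map_lie] at hne2
      convert hne2 using 2
      rw [← add_assoc, hi', Nat.cast_sub (by omega)]; congr 1; ring
    · have := zproj_lie b hg hx (-((s : ℤ) * (m + j : ℕ)) + d) (φ y)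
      rw [hlow (m + j) (by omega), lie_zero] at this
      rw [← this, hi']
      congr 2
      push_cast; ring

/-- The image of `N` contains a nonzero vector, hence `φ v0`. So `v0` is congruent to an element of
`N` modulo the kernel, which lies in `N`. Surjectivity of `φ` is not needed. -/
theorem eq_top_of_vermaRad_lt {N : LieSubmodule ℂ VirLike (Verma b s ψ)}
    (hle : vermaRad b s ψ ≤ N) {y : Verma b s ψ} (hy : y ∈ N) (hy' : y ∉ vermaRad b s ψ) :
    N = ⊤ := by
  have hss := unit_sq s
  have hφy : φ y ≠ 0 := by
    rw [← hker] at hy'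
    exact fun h => hy' (LieModuleHom.mem_ker.mpr h)
  obtain ⟨B, hB⟩ := exists_zproj_eq_zero_of_lt hg.isInternal (φ y)
  obtain ⟨n, hn⟩ : ∃ n, zproj hg.isInternal (n + d) (φ y) ≠ 0 := by
    by_contra! h
    refine hφy (eq_zero_of_zproj hg.isInternal fun n => ?_)
    have := h (n - d)
    rwa [sub_add_cancel] at this
  have hbd : ∀ m : ℤ, zproj hg.isInternal (-((s : ℤ) * m) + d) (φ y) ≠ 0 → m ≤ |B| + |d| := by
    intro m hm
    by_contra! hlt
    refine hm (hB _ ?_)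
    have h1 := le_abs_self B
    have h2 := abs_sub_abs_le_abs_sub d ((s : ℤ) * m)
    have h3 : |(s : ℤ) * m| = |m| := by
      rcases Int.units_eq_one_or s with rfl | rfl <;> simp
    have h4 : |(s : ℤ) * m| - |d| ≤ |-((s : ℤ) * m) + d| := by
      have := abs_sub_abs_le_abs_sub ((s : ℤ) * m) d
      rwa [abs_sub_comm ((s : ℤ) * m), sub_eq_neg_add d] at this
    have h5 := le_abs_self m
    omega
  obtain ⟨m, hm, hmax⟩ := Int.exists_greatest_of_bdd
    (P := fun m => zproj hg.isInternal (-((s : ℤ) * m) + d) (φ y) ≠ 0) ⟨_, hbd⟩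
    ⟨-((s : ℤ) * n), by rwa [mul_neg, ← mul_assoc, hss, one_mul, neg_neg]⟩
  have hm0 : 0 ≤ m := by
    by_contra! hlt
    refine hm (zproj_map_pos ?_ hg φ hd y)
    rw [mul_neg, ← mul_assoc, hss]; omega
  lift m to ℕ using hm0
  have hmem := v0_mem_of_lowest_component hg φ hd h0 hker (N.map φ)
    (fun w ⟨u, _, hu⟩ => ⟨u, hu⟩) m (φ y) ⟨y, hy, rfl⟩ hm fun k hk => by
      by_contra h
      have := hmax k h
      omega
  obtain ⟨u, hu, huv⟩ := hmem
  refine verma_eq_top_of_v0_mem b s ψ ?_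
  have hd' : v0 b s ψ - u ∈ vermaRad b s ψ := by
    rw [← hker, LieModuleHom.mem_ker, map_sub, sub_eq_zero]
    exact huv.symm
  have := add_mem (hle hd') (show u ∈ N from hu)
  rwa [sub_add_cancel] at this

end HomogeneousLift

end VirLike

/-- Shows inductively that the operators of degree `t` generate all those of degree `t j`, `j ≥ 1`.
-/
theorem VirLikeRep.exists_commutator {V : Type*} [AddCommGroup V] [Module ℂ V] {ε κ : ℂ}
    {X : ℤ → ℤ → Module.End ℂ V} (H : VirLikeRep ε κ X) (hε : ε ≠ 0) (t : ℤˣ) {j : ℤ}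
    (hj : 1 ≤ j) (r : ℤ) : ∃ (a c : ℤ) (x : ℂ), ∀ w, X (t * (j + 1)) r w =
      x • (X t a (X (t * j) c w) - X (t * j) c (X t a w)) := by
  -- Up to the factor `t` this is the determinant of `(t, a)` and `(t j, r - a)`, the structure
  -- constant of the bracket.
  obtain ⟨a, ha⟩ : ∃ a : ℤ, r - a - j * a ≠ 0 := by
    by_cases hr : r = 0
    · exact ⟨1, by omega⟩
    · exact ⟨0, by simpa using hr⟩
  have ht : ((t : ℤ) : ℂ) ≠ 0 := by exact_mod_cast t.ne_zero
  have ha' : ((r - a - j * a : ℤ) : ℂ) ≠ 0 := by exact_mod_cast ha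
  refine ⟨a, r - a, (-(ε * (t * (r - a - j * a : ℤ))))⁻¹, fun w => ?_⟩
  have hne : ¬ ((t : ℤ) + t * j = 0 ∧ a + (r - a) = 0) := by
    rintro ⟨h, -⟩
    have : (t : ℤ) * (1 + j) = 0 := by linear_combination h
    rcases mul_eq_zero.mp this with h | h
    · exact t.ne_zero h
    · omega
  rw [H.comm, if_neg hne, zero_smul, add_zero, sub_sub_cancel_left, ← neg_smul,
    show (t : ℤ) + t * j = t * (j + 1) by ring, add_sub_cancel, eq_inv_smul_iff₀]
  · congr 2; push_cast; ring
  · exact neg_ne_zero.mpr (mul_ne_zero hε (mul_ne_zero ht ha'))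

/-! ### Irreducibility and quasi-finiteness of the irreducible weight quotients. -/

namespace VirLike

open Polynomial

variable {b : Module.Basis (Fin 2) ℤ (ℤ × ℤ)} {s : ℤˣ} {ψ : gr b 0 →ₗ[ℂ] ℂ}
  {V : Type*} [AddCommGroup V] [Module ℂ V] [LieRingModule VirLike V] [LieModule ℂ VirLike V]
  {𝓥 : ℤ → Submodule ℂ V}

/-- Any graded module isomorphic to an irreducible weight quotient is irreducible. -/
theorem isIrreducible_of_equiv [Nontrivial V] (hg : IsZGraded b 𝓥)
    (e : V ≃ₗ⁅ℂ, VirLike⁆ IrrWt b s ψ) : LieModule.IsIrreducible ℂ VirLike V := by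
  obtain ⟨d, φ, hd, h0, hker⟩ := exists_homogeneous_lift hg e
  refine { exists_pair_ne := ⟨⊥, ⊤, bot_ne_top⟩, eq_bot_or_eq_top := fun N => ?_ }
  rw [or_iff_not_imp_left]
  intro hN
  let Φ : Verma b s ψ →ₗ⁅ℂ, VirLike⁆ V :=
    (e.symm : IrrWt b s ψ →ₗ⁅ℂ, VirLike⁆ V).comp (LieSubmodule.Quotient.mk' (vermaRad b s ψ))
  have hΦs : ∀ v, ∃ y, Φ y = v := fun v => by
    obtain ⟨y, hy⟩ := LieSubmodule.Quotient.surjective_mk' (vermaRad b s ψ) (e v)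
    refine ⟨y, ?_⟩
    change e.symm (LieSubmodule.Quotient.mk' (vermaRad b s ψ) y) = v
    rw [hy]; exact e.symm_apply_apply v
  have hΦ : ∀ w ∈ vermaRad b s ψ, Φ w = 0 := fun w hw => by
    change e.symm (LieSubmodule.Quotient.mk' (vermaRad b s ψ) w) = 0
    have : LieSubmodule.Quotient.mk' (vermaRad b s ψ) w = 0 :=
      (Submodule.Quotient.mk_eq_zero _).mpr hw
    rw [this]
    exact map_zero e.symm.toLinearEquiv
  obtain ⟨w, hw, hw0⟩ := Submodule.exists_mem_ne_zero_of_ne_bot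
    (p := N.toSubmodule) (by simpa using hN)
  obtain ⟨y, rfl⟩ := hΦs w
  -- The homogeneous `φ` supplies maximality of `vermaRad` among all submodules; the surjection `Φ`
  -- carries it to `V`.
  have htop := eq_top_of_vermaRad_lt hg φ hd h0 hker (N := N.comap Φ)
    (fun u hu => by
      rw [LieSubmodule.mem_comap, hΦ u hu]; exact zero_mem N) hw (fun h => hw0 (hΦ y h))
  rw [eq_top_iff]
  rintro v -
  obtain ⟨u, rfl⟩ := hΦs v
  have : u ∈ N.comap Φ := htop ▸ LieSubmodule.mem_top _
  exact this

/-- The eigenspaces of a central element `h(p)`. -/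
noncomputable def centralEigen (V : Type*) [AddCommGroup V] [Module ℂ V] [LieRingModule VirLike V]
    [LieModule ℂ VirLike V] (p : ℤ × ℤ) (c : ℂ) : LieSubmodule ℂ VirLike V where
  toSubmodule := Module.End.eigenspace (LieModule.toEnd ℂ VirLike V (h p)) c
  lie_mem := by
    intro x w hw
    have hw' : ⁅h p, w⁆ = c • w := Module.End.mem_eigenspace_iff.mp hw
    refine Module.End.mem_eigenspace_iff.mpr ?_
    change ⁅h p, ⁅x, w⁆⁆ = c • ⁅x, w⁆
    have e : ⁅h p, x⁆ = 0 := lie_cen _ _ x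
    rw [leibniz_lie, e, zero_lie, zero_add, hw', lie_smul]

/-- The eigenspaces of a central element are submodules, and this one contains a generator. -/
theorem central_scalar {v : V} (hv : LieSubmodule.lieSpan ℂ VirLike {v} = ⊤) {p : ℤ × ℤ} {c : ℂ}
    (hc : ⁅h p, v⁆ = c • v) (w : V) : ⁅h p, w⁆ = c • w := by
  have h1 : LieSubmodule.lieSpan ℂ VirLike {v} ≤ centralEigen V p c :=
    LieSubmodule.lieSpan_le.mpr
      (Set.singleton_subset_iff.mpr (Module.End.mem_eigenspace_iff.mpr hc))
  rw [hv] at h1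
  exact Module.End.mem_eigenspace_iff.mp (h1 (LieSubmodule.mem_top w))

theorem gr_lie_mem {i : ℤ} (hi : i ≠ 0) {w : V} {T : Submodule ℂ V}
    (hT : ∀ m : ℤ, ⁅D (i • b 0 + m • b 1), w⁆ ∈ T) {x : VirLike} (hx : x ∈ gr b i) :
    ⁅x, w⁆ ∈ T :=
  gr_le b (T := T.comap ((LieModule.toEnd ℂ VirLike V : VirLike →ₗ[ℂ] Module.End ℂ V).flip w))
    hT (fun h => absurd h hi) hx

theorem opX_unit_mul (i m : ℤ) (w : V) :
    opX b V s (s * i) m w = ⁅D (i • b 0 + m • b 1), w⁆ := by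
  rw [opX_apply, ← mul_assoc, unit_sq, one_mul]

theorem gdet_ne_zero (s : ℤˣ) : ((s : ℤ) * (gdet (b 0) (b 1) : ℂ)) ≠ 0 := by
  refine mul_ne_zero (by exact_mod_cast s.ne_zero) ?_
  intro h
  have h2 : gdet (b 0) (b 1) = 0 := by exact_mod_cast h
  have := gdet_basis_sq b
  rw [h2] at this; simp at this

theorem gdet_sq_complex : ((gdet (b 0) (b 1) : ℂ)) * gdet (b 0) (b 1) = 1 := by
  exact_mod_cast gdet_basis_sq b

/-- The action of `levelOp` on a weight singular vector. -/
theorem levelOp_singular {κ : ℂ} {v : V} (hv : IsWeightSingular b s ψ v)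
    (f : ℤ → ℂ)
    (hf : ∀ k : ℤ, k ≠ 0 → f k = k * ψ ⟨D (k • b 1), D_mem_gr_zero b k⟩)
    (hf0 : κ = -(gdet (b 0) (b 1) : ℂ) * f 0) (l : ℤ) :
    levelOp ((s : ℤ) * (gdet (b 0) (b 1) : ℂ)) ((s : ℤ) * κ) (opX b V s) l v =
      (-((s : ℤ) * (gdet (b 0) (b 1) : ℂ)) * f l) • v := by
  rw [levelOp, LinearMap.add_apply, LinearMap.smul_apply, LinearMap.smul_apply,
    Module.End.one_apply, opX_apply, mul_zero, zero_smul, zero_add]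
  have hw := hv.weight ⟨D (l • b 1), D_mem_gr_zero b l⟩
  simp only at hw
  rw [hw, smul_smul, ← add_smul]
  congr 1
  by_cases hl : l = 0
  · subst hl
    rw [if_pos rfl, hf0]; push_cast; ring
  · rw [if_neg hl, hf l hl]; ring

theorem isQuasiFinite_of_equiv [Nontrivial V] (hg : IsZGraded b 𝓥)
    (e : V ≃ₗ⁅ℂ, VirLike⁆ IrrWt b s ψ) (hψ : IsExpPoly b ψ) : IsQuasiFinite 𝓥 := by
  have hirr := isIrreducible_of_equiv hg e
  obtain ⟨d, φ, hd, h0, hker⟩ := exists_homogeneous_lift hg e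
  set v := φ (v0 b s ψ) with hv
  have hsing : IsWeightSingular b s ψ v := isWeightSingular_map_v0 φ
  have hspan : LieSubmodule.lieSpan ℂ VirLike {v} = ⊤ :=
    (hirr.eq_bot_or_eq_top _).resolve_left
      (by rw [LieSubmodule.lieSpan_eq_bot_iff]; simpa using h0)
  have hsurj : ∀ w, ∃ y, φ y = w := by
    have h1 : LieSubmodule.lieSpan ℂ VirLike {v} ≤ (⊤ : LieSubmodule ℂ VirLike _).map φ :=
      LieSubmodule.lieSpan_le.mpr
        (Set.singleton_subset_iff.mpr ⟨v0 b s ψ, LieSubmodule.mem_top _, rfl⟩)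
    rw [hspan] at h1
    intro w
    obtain ⟨y, -, hy⟩ := h1 (LieSubmodule.mem_top w)
    exact ⟨y, hy⟩
  obtain ⟨-, hψ1, r, p, α, hα, hψD, hψ0⟩ := hψ
  set κ := ψ ⟨h (b 0), h_mem_gr_zero b (b 0)⟩ with hκdef
  have hκ : ∀ w : V, ⁅h (b 0), w⁆ = κ • w := central_scalar hspan (hsing.weight ⟨h (b 0), _⟩)
  have hκ1 : ∀ w : V, ⁅h (b 1), w⁆ = 0 := fun w => by
    have := central_scalar hspan (hsing.weight ⟨h (b 1), h_mem_gr_zero b (b 1)⟩) w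
    rwa [hψ1, zero_smul] at this
  have H := virLikeRep_opX b s hκ hκ1
  have hss := unit_sq s
  have hX := shiftsDegrees_opX b hg s
  have hε := gdet_ne_zero (b := b) s
  have htop : ∀ j, (s : ℤ) * d < j → 𝓥 (s * j) = ⊥ := by
    intro j hj
    rw [eq_bot_iff]
    intro w hw
    obtain ⟨y, rfl⟩ := hsurj w
    have hpos : 0 < (s : ℤ) * (s * j - d) := by rw [mul_sub, ← mul_assoc, hss]; omega
    have := zproj_map_pos hpos hg φ hd y
    rw [sub_add_cancel, zproj_same _ hw] at this
    exact this
  have hbase : 𝓥 d ≤ Submodule.span ℂ {v} := by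
    intro w hw
    obtain ⟨y, rfl⟩ := hsurj w
    obtain ⟨c, hc⟩ := zproj_map_zero hg φ hd y
    rw [zproj_same _ hw] at hc
    exact Submodule.mem_span_singleton.mpr ⟨c, hc.symm⟩
  have hmain : ∀ n, FiniteDimensional ℂ (𝓥 (s * n)) := by
    refine H.finiteDimensional (d := s * d) (v := v) hX htop ?_ ?_ ?_ ?_
    · rwa [← mul_assoc, hss, one_mul]
    -- Beyond the line of `v`, `T` collects what the degree `-1` operators produce. The sum of all
    -- `T n` contains `v` and is stable under lowering, hence is everything; projecting to one
    -- degree isolates a single `T (n + 1)`.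
    · let T : ℕ → Submodule ℂ V := fun n => Nat.casesOn n (Submodule.span ℂ {v})
        fun n => ⨆ m : ℤ, (𝓥 (s * (s * d - n))).map (opX b V s (-1) m)
      have hTle : ∀ n : ℕ, T n ≤ 𝓥 (s * (s * d - n)) := by
        intro n
        cases n with
        | zero =>
          rw [Nat.cast_zero, sub_zero, ← mul_assoc, hss, one_mul]
          exact Submodule.span_le.mpr (Set.singleton_subset_iff.mpr hd)
        | succ n =>
          refine iSup_le fun m => ?_
          rintro _ ⟨w, hw, rfl⟩
          have := hX (-1) m _ w hw
          convert this using 3; push_cast; ring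
      have hstep : ∀ m : ℤ, ∀ w ∈ ⨆ n, T n, opX b V s (-1) m w ∈ ⨆ n, T n := by
        intro m w hw
        refine (iSup_le (fun n w hw => ?_) : _ ≤ (⨆ n, T n).comap (opX b V s (-1) m)) hw
        refine Submodule.mem_iSup_of_mem (n + 1) ?_
        exact Submodule.mem_iSup_of_mem m (Submodule.mem_map_of_mem (hTle n hw))
      have hlower : ∀ j : ℕ, ∀ m : ℤ, ∀ w ∈ ⨆ n, T n, opX b V s (-(j + 1)) m w ∈ ⨆ n, T n := by
        intro j
        induction j with
        | zero => simpa using hstep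
        | succ j ih =>
          intro m w hw
          obtain ⟨a, c, x, hx⟩ := H.exists_commutator hε (-1) (j := j + 1) (by omega) m
          have e1 : (-((j + 1 : ℕ) + 1 : ℤ)) = ((-1 : ℤˣ) : ℤ) * ((j : ℤ) + 1 + 1) := by
            push_cast; ring
          have e2 : ((-1 : ℤˣ) : ℤ) * ((j : ℤ) + 1) = -(j + 1) := by push_cast; ring
          rw [e1, hx, e2]
          exact Submodule.smul_mem _ _ (sub_mem (hstep a _ (ih c w hw)) (ih c _ (hstep a w hw)))
      have hall : ∀ w, w ∈ ⨆ n, T n := by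
        have hle : ∀ n, vermaGr b s ψ n ≤ (⨆ n, T n).comap (φ : Verma b s ψ →ₗ[ℂ] V) := by
          intro n
          refine (vermaGr_le_lowerWords b s ψ n).trans (lowerWords_le_of_lie_mem
            (T := fun _ => (⨆ n, T n).comap (φ : Verma b s ψ →ₗ[ℂ] V)) ?_ ?_)
          · refine Submodule.span_le.mpr (Set.singleton_subset_iff.mpr ?_)
            exact Submodule.mem_iSup_of_mem 0 (Submodule.mem_span_singleton_self v)
          · intro i _ hi x hx w hw
            change φ ⁅x, w⁆ ∈ ⨆ n, T n
            rw [LieModuleHom.map_lie]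
            refine gr_lie_mem (by rintro rfl; simp at hi) (fun m => ?_) hx
            rw [← opX_unit_mul (s := s)]
            have := hlower ((-((s : ℤ) * i)).toNat - 1) m (φ w) hw
            convert this using 3
            omega
        intro w
        obtain ⟨y, rfl⟩ := hsurj w
        have : y ∈ ⨆ n, vermaGr b s ψ n := by rw [iSup_vermaGr]; exact Submodule.mem_top
        exact iSup_le hle this
      intro n w hw
      have hle : ⨆ n, T n ≤ (T (n + 1)).comap
          (zproj hg.isInternal (s * (s * d - (n + 1)))) := by
        refine iSup_le fun k u hu => ?_
        rw [Submodule.mem_comap, zproj_of_mem _ (hTle k hu)]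
        split_ifs with hk
        · have hk' : k = n + 1 := by
            have := mul_left_cancel₀ s.ne_zero hk
            omega
          rwa [← hk']
        · exact zero_mem _
      have := hle (hall w)
      rwa [Submodule.mem_comap, zproj_same _ hw] at this
    · intro j hj u hu hkill
      -- Degree 1 operators generate all raising ones, so `u` is singular.
      have hraise : ∀ i : ℕ, ∀ m : ℤ, opX b V s (i + 1) m u = 0 := by
        intro i
        induction i with
        | zero => simpa using hkill
        | succ i ih =>
          intro m
          obtain ⟨a, c, x, hx⟩ := H.exists_commutator hε 1 (j := i + 1) (by omega) m
          have e1 : (((i + 1 : ℕ) : ℤ) + 1) = ((1 : ℤˣ) : ℤ) * ((i : ℤ) + 1 + 1) := by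
            push_cast; ring
          have e2 : ((1 : ℤˣ) : ℤ) * ((i : ℤ) + 1) = i + 1 := by push_cast; ring
          rw [e1, hx, e2, ih, Units.val_one, hkill, map_zero, map_zero, sub_zero, smul_zero]
      obtain ⟨y, rfl⟩ := hsurj u
      obtain ⟨f, hf, -, hφ⟩ := exists_components hg φ hd (mem_iSup_top_inf y)
      have e1 := hφ (s * j - d)
      rw [sub_add_cancel, zproj_same _ hu] at e1
      rw [e1]
      refine eq_zero_of_singular hg φ hd h0 hker (k := s * j - d) ?_ (hf _).2 ?_
      · rw [mul_sub, ← mul_assoc, hss]; omega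
      · intro i hi x hx
        rw [← e1]
        refine (Submodule.mem_bot ℂ).mp (gr_lie_mem (by rintro rfl; simp at hi) (fun m => ?_) hx)
        rw [← opX_unit_mul (s := s), Submodule.mem_bot]
        have := hraise (((s : ℤ) * i).toNat - 1) m
        convert this using 3
        omega
    · have hmem : (fun l : ℤ => ∑ i, (p i).eval (l : ℂ) * α i ^ l) ∈ expPolySpace :=
        mem_expPolySpace_iff_exists.mpr ⟨r, p, α, hα, fun _ => rfl⟩
      obtain ⟨Q, hQ, hQ0⟩ := exists_annihilator_of_mem_expPolySpace hmem
      refine ⟨Q, hQ, ?_⟩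
      have e1 : (fun l => levelOp ((s : ℤ) * (gdet (b 0) (b 1) : ℂ)) ((s : ℤ) * κ)
          (opX b V s) l v) = fun l : ℤ =>
            (LinearMap.toSpanSingleton ℂ V ((-((s : ℤ) * (gdet (b 0) (b 1) : ℂ))) • v))
            (∑ i, (p i).eval (l : ℂ) * α i ^ l) := by
        ext l
        rw [levelOp_singular hsing
          (fun l : ℤ => ∑ i, (p i).eval (l : ℂ) * α i ^ l) ?_ ?_]
        · rw [LinearMap.toSpanSingleton_apply, smul_smul, mul_comm]
        · intro k hk
          have hk' : (k : ℂ) ≠ 0 := by exact_mod_cast hk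
          rw [hψD k hk, mul_div_cancel₀ _ hk']
        · rw [hψ0]; simp [coeff_zero_eq_eval_zero]
      rw [e1, aeval_zshift_map, hQ0]
      ext; simp
  intro n
  have := hmain (s * n)
  rwa [← mul_assoc, hss, one_mul] at this

end VirLike

/-- Commuting operators have a joint eigenvector in a common invariant finite-dimensional space. -/
theorem exists_joint_eigenvector {V ι : Type*} [AddCommGroup V] [Module ℂ V]
    (W : Submodule ℂ V) [FiniteDimensional ℂ W] (hW : W ≠ ⊥) (Y : ι → Module.End ℂ V)
    (hY : ∀ i, ∀ w ∈ W, Y i w ∈ W) (hcomm : ∀ i j w, Y i (Y j w) = Y j (Y i w)) :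
    ∃ u ∈ W, u ≠ 0 ∧ ∀ i, ∃ c : ℂ, Y i u = c • u := by
  induction hn : Module.finrank ℂ W using Nat.strong_induction_on generalizing W with
  | _ n ih =>
  by_cases hsc : ∀ i, ∃ c : ℂ, ∀ w ∈ W, Y i w = c • w
  · obtain ⟨u, hu, h0⟩ := Submodule.exists_mem_ne_zero_of_ne_bot hW
    exact ⟨u, hu, h0, fun i => (hsc i).imp fun c hc => hc u hu⟩
  · push Not at hsc
    obtain ⟨i, hi⟩ := hsc
    obtain ⟨c, u, hu, h0, hc⟩ := exists_eigen_of_mapsTo W hW (Y i) (hY i)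
    obtain ⟨w, hw, hwc⟩ := hi c
    have hlt : W ⊓ Module.End.eigenspace (Y i) c < W :=
      lt_of_le_of_ne inf_le_left fun h =>
        hwc (Module.End.mem_eigenspace_iff.mp (h.symm ▸ hw : w ∈ W ⊓ _).2)
    have : FiniteDimensional ℂ ↥(W ⊓ Module.End.eigenspace (Y i) c) :=
      Submodule.finiteDimensional_of_le inf_le_left
    obtain ⟨u', hu', h0', h⟩ := ih _ (hn ▸ Submodule.finrank_lt_finrank_of_lt hlt)
      (W ⊓ Module.End.eigenspace (Y i) c)
      (fun h => h0 ((Submodule.mem_bot ℂ).mp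
        (h ▸ (⟨hu, Module.End.mem_eigenspace_iff.mpr hc⟩ : u ∈ W ⊓ _))))
      (fun j x hx => ⟨hY j x hx.1, Module.End.mem_eigenspace_iff.mpr (by
        rw [hcomm, Module.End.mem_eigenspace_iff.mp hx.2, map_smul])⟩) rfl
    exact ⟨u', hu'.1, h0', h⟩

/-! ### Quasi-finite irreducible modules: level, extremal vector and its weight. -/

namespace VirLike

open Polynomial

variable {b : Module.Basis (Fin 2) ℤ (ℤ × ℤ)} {s : ℤˣ} {ψ : gr b 0 →ₗ[ℂ] ℂ}
  {V : Type*} [AddCommGroup V] [Module ℂ V] [LieRingModule VirLike V]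
  {𝓥 : ℤ → Submodule ℂ V}

theorem InOZ.exists_ne_bot (hV : InOZ b 𝓥) : ∃ n, 𝓥 n ≠ ⊥ := by
  by_contra! hbot
  have := hV.2.1.1
  obtain ⟨v, hv⟩ := exists_ne (0 : V)
  exact hv ((Submodule.mem_bot ℂ).mp
    (induction_homogeneous hV.1.isInternal (fun n => (hbot n).le) v))

variable [LieModule ℂ VirLike V]

/-- Central elements `h(p)` act by scalars. -/
theorem InOZ.exists_scalar (hV : InOZ b 𝓥) (p : ℤ × ℤ) :
    ∃ c : ℂ, ∀ w : V, ⁅h p, w⁆ = c • w := by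
  obtain ⟨n, hn⟩ := hV.exists_ne_bot
  have := hV.2.2 n
  obtain ⟨c, u, hu, h0, hc⟩ := exists_eigen_of_mapsTo (𝓥 n) hn
    (LieModule.toEnd ℂ VirLike V (h p)) (fun w hw => by
      have := hV.1.lie_mem 0 n _ (h_mem_gr_zero b p) w hw
      rwa [zero_add] at this)
  exact ⟨c, central_scalar (lieSpan_eq_top_of_homogeneous b hV.1 hV.2.1 hu h0) hc⟩

/-- `D(b₂)` and `D(-b₂)` preserve each component and their commutator is the scalar by which `h (b
1)` acts; its trace on a nonzero finite-dimensional component is zero. -/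
theorem InOZ.h_one_lie (hV : InOZ b 𝓥) (w : V) : ⁅h (b 1), w⁆ = 0 := by
  obtain ⟨c, hc⟩ := hV.exists_scalar (b 1)
  obtain ⟨n, hn⟩ := hV.exists_ne_bot
  have := hV.2.2 n
  have hmem : ∀ k : ℤ, ∀ w ∈ 𝓥 n, LieModule.toEnd ℂ VirLike V (D (k • b 1)) w ∈ 𝓥 n :=
    fun k w hw => by
      have := hV.1.lie_mem 0 n _ (D_mem_gr_zero b k) w hw
      rwa [zero_add] at this
  let A := (LieModule.toEnd ℂ VirLike V (D ((1 : ℤ) • b 1))).restrict (hmem 1)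
  let B := (LieModule.toEnd ℂ VirLike V (D ((-1 : ℤ) • b 1))).restrict (hmem (-1))
  have hAB : A * B - B * A = c • 1 := by
    ext ⟨w, hw⟩
    change ⁅D ((1 : ℤ) • b 1), ⁅D ((-1 : ℤ) • b 1), w⁆⁆ -
      ⁅D ((-1 : ℤ) • b 1), ⁅D ((1 : ℤ) • b 1), w⁆⁆ = c • w
    rw [← lie_lie, lie_D_D, if_pos (by simp)]
    have : gdet ((1 : ℤ) • b 1) ((-1 : ℤ) • b 1) = 0 := by simp [gdet]; ring
    rw [this, one_smul, Int.cast_zero, neg_zero, zero_smul, zero_add, hc]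
  have htr := congrArg (LinearMap.trace ℂ (𝓥 n)) hAB
  rw [map_sub, LinearMap.trace_mul_comm, sub_self, map_smul, LinearMap.trace_one, smul_eq_mul]
    at htr
  have : Module.finrank ℂ (𝓥 n) ≠ 0 := fun h => hn (Submodule.finrank_eq_zero.mp h)
  have hc0 : c = 0 := (mul_eq_zero.mp htr.symm).resolve_right (by exact_mod_cast this)
  rw [hc, hc0, zero_smul]

theorem InOZ.exists_level (hV : InOZ b 𝓥)
    (hc : ∃ z ∈ LieAlgebra.center ℂ VirLike, ∃ c : ℂ, c ≠ 0 ∧ ∀ v : V, ⁅z, v⁆ = c • v) :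
    ∃ κ : ℂ, κ ≠ 0 ∧ ∀ w : V, ⁅h (b 0), w⁆ = κ • w := by
  obtain ⟨κ, hκ⟩ := hV.exists_scalar (b 0)
  refine ⟨κ, ?_, hκ⟩
  rintro rfl
  obtain ⟨z, hz, c, hc, hzc⟩ := hc
  obtain ⟨u, v, rfl⟩ := exists_cen_of_mem_center hz
  obtain ⟨x, y, e⟩ := exists_cen_eq b u v
  have := hV.2.1.1
  obtain ⟨w, hw⟩ := exists_ne (0 : V)
  have h1 := hzc w
  rw [e, add_lie, smul_lie, smul_lie, hκ, hV.h_one_lie, zero_smul, smul_zero, smul_zero, add_zero,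
    eq_comm, smul_eq_zero] at h1
  exact h1.elim hc hw

/-- In one of the two directions the degrees of the module are bounded. -/
theorem InOZ.exists_extreme_degree (hV : InOZ b 𝓥) {κ : ℂ} (hκ0 : κ ≠ 0)
    (hκ : ∀ w : V, ⁅h (b 0), w⁆ = κ • w) :
    ∃ (s : ℤˣ) (d : ℤ), (s = 1 ∨ s = -1) ∧ 𝓥 (s * d) ≠ ⊥ ∧ ∀ j, d < j → 𝓥 (s * j) = ⊥ := by
  have H := virLikeRep_opX b 1 hκ hV.h_one_lie
  have hX := shiftsDegrees_opX b hV.1 1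
  have hs : ∀ (s : ℤˣ) (n : ℤ), (s : ℤ) * (s * n) = n := fun s n => by
    rw [← mul_assoc, unit_sq, one_mul]
  have hmax : ∀ s : ℤˣ, (∃ N, ∀ n, N < n → 𝓥 (s * n) = ⊥) →
      ∃ d : ℤ, 𝓥 (s * d) ≠ ⊥ ∧ ∀ j, d < j → 𝓥 (s * j) = ⊥ := by
    rintro s ⟨N, hN⟩
    obtain ⟨n, hn⟩ := hV.exists_ne_bot
    obtain ⟨d, hd, hmax⟩ := Int.exists_greatest_of_bdd (P := fun j => 𝓥 (s * j) ≠ ⊥)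
      ⟨N, fun j hj => not_lt.mp fun h => hj (hN j h)⟩ ⟨s * n, by rwa [hs]⟩
    exact ⟨d, hd, fun j hj => by_contra fun h => absurd (hmax j h) (not_le.mpr hj)⟩
  rcases H.bounded (gdet_ne_zero 1) (mul_ne_zero (by simp) hκ0) hX (fun n => hV.2.2 _) (by
    intro n v hv h0 T hvT hT
    have h1 : LieSubmodule.lieSpan ℂ VirLike {v} ≤ lieSubOfOpX b 1 hκ hV.h_one_lie T hT :=
      LieSubmodule.lieSpan_le.mpr (Set.singleton_subset_iff.mpr hvT)
    rw [lieSpan_eq_top_of_homogeneous b hV.1 hV.2.1 hv h0] at h1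
    exact eq_top_iff.mpr fun w _ => h1 (LieSubmodule.mem_top w)) with ⟨N, hN⟩ | ⟨N, hN⟩
  · obtain ⟨d, hd⟩ := hmax 1 ⟨N, hN⟩
    exact ⟨1, d, Or.inl rfl, hd⟩
  · obtain ⟨d, hd⟩ := hmax (-1) ⟨-N, fun n hn => by
      have := hN (-n) (by omega)
      simpa using this⟩
    exact ⟨-1, d, Or.inr rfl, hd⟩

theorem InOZ.exists_weight_singular (hV : InOZ b 𝓥) {κ : ℂ}
    (hκ : ∀ w : V, ⁅h (b 0), w⁆ = κ • w) {d : ℤ} (hd : 𝓥 (s * d) ≠ ⊥)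
    (htop : ∀ j, d < j → 𝓥 (s * j) = ⊥) :
    ∃ ψ : gr b 0 →ₗ[ℂ] ℂ, ∃ v ∈ 𝓥 (s * d), v ≠ 0 ∧ IsWeightSingular b s ψ v := by
  have := hV.2.2 (s * d)
  obtain ⟨v, hv, h0, hev⟩ := exists_joint_eigenvector (𝓥 (s * d)) hd
    (fun m : ℤ => LieModule.toEnd ℂ VirLike V (D (m • b 1)))
    (fun m w hw => by
      have := hV.1.lie_mem 0 _ _ (D_mem_gr_zero b m) w hw
      rwa [zero_add] at this)
    -- The elements `D(m b₂)` commute on `V`, since their brackets are multiples of `h (b 1)`.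
    (fun m n w => by
      change ⁅D (m • b 1), ⁅D (n • b 1), w⁆⁆ = ⁅D (n • b 1), ⁅D (m • b 1), w⁆⁆
      have hdet : gdet (m • b 1) (n • b 1) = 0 := by simp [gdet]; ring
      rw [leibniz_lie, lie_D_D, hdet, Int.cast_zero, neg_zero, zero_smul, zero_add, add_eq_right]
      split_ifs
      · rw [h_zsmul, smul_lie, hV.h_one_lie, smul_zero]
      · rw [zero_lie])
  -- A functional with `g v = 1` reads off eigenvalues linearly, which makes `ψ` a linear function.
  obtain ⟨g, hg⟩ := Module.Projective.exists_dual_eq_one ℂ h0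
  let A : VirLike →ₗ[ℂ] V := (LieModule.toEnd ℂ VirLike V : VirLike →ₗ[ℂ] Module.End ℂ V).flip v
  refine ⟨g ∘ₗ A ∘ₗ (gr b 0).subtype, v, hv, h0, ?_, ?_⟩
  · intro i hi x hx
    have h1 := hV.1.lie_mem i _ x hx v hv
    have e : i + (s : ℤ) * d = s * (s * i + d) := by
      rw [mul_add, ← mul_assoc, unit_sq, one_mul]
    rw [e, htop _ (by omega)] at h1
    exact (Submodule.mem_bot ℂ).mp h1
  · rintro ⟨x, hx⟩
    change ⁅x, v⁆ = g ⁅x, v⁆ • v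
    have hle : gr b 0 ≤ (Submodule.span ℂ {v}).comap A := by
      refine gr_le b (fun m => ?_) (fun _ u w => ?_)
      · obtain ⟨c, hc⟩ := hev m
        rw [zero_smul, zero_add]
        exact Submodule.mem_span_singleton.mpr ⟨c, hc.symm⟩
      · obtain ⟨x, y, e⟩ := exists_cen_eq b u w
        refine Submodule.mem_span_singleton.mpr ⟨x * κ, ?_⟩
        change _ = ⁅cen u w, v⁆
        rw [e, add_lie, smul_lie, smul_lie, hκ, hV.h_one_lie, smul_zero, add_zero, smul_smul]
    obtain ⟨c, hc⟩ := Submodule.mem_span_singleton.mp (hle hx)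
    have hc' : ⁅x, v⁆ = c • v := hc.symm
    rw [hc', map_smul, hg, smul_eq_mul, mul_one]

theorem InOZ.nonempty_equiv (hV : InOZ b 𝓥) {d : ℤ} {v : V} (hv : v ∈ 𝓥 d) (h0 : v ≠ 0)
    (hs : IsWeightSingular b s ψ v) : Nonempty (V ≃ₗ⁅ℂ, VirLike⁆ IrrWt b s ψ) := by
  obtain ⟨φ, rfl⟩ := exists_vermaLift hs
  refine nonempty_equiv_irrWt φ (fun w => ?_)
    (le_antisymm (ker_le_vermaRad hV.1 φ hv h0) (vermaRad_le_ker hV.1 hV.2.1 φ hv h0))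
  have h1 : LieSubmodule.lieSpan ℂ VirLike {φ (v0 b s ψ)} ≤
      (⊤ : LieSubmodule ℂ VirLike _).map φ :=
    LieSubmodule.lieSpan_le.mpr
      (Set.singleton_subset_iff.mpr ⟨v0 b s ψ, LieSubmodule.mem_top _, rfl⟩)
  rw [lieSpan_eq_top_of_homogeneous b hV.1 hV.2.1 hv h0] at h1
  obtain ⟨y, -, hy⟩ := h1 (LieSubmodule.mem_top w)
  exact ⟨y, hy⟩

/-- The weight of an extremal vector of a quasi-finite module is exp-polynomial. -/
theorem InOZ.isExpPoly (hV : InOZ b 𝓥) {κ : ℂ} (hκ0 : κ ≠ 0)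
    (hκ : ∀ w : V, ⁅h (b 0), w⁆ = κ • w) {d : ℤ} {v : V} (hv : v ∈ 𝓥 (s * d)) (h0 : v ≠ 0)
    (hs : IsWeightSingular b s ψ v) : IsExpPoly b ψ := by
  have H := virLikeRep_opX b s hκ hV.h_one_lie
  have hX := shiftsDegrees_opX b hV.1 s
  have hψ0 : ψ ⟨h (b 0), h_mem_gr_zero b (b 0)⟩ = κ := by
    have := hs.weight ⟨h (b 0), h_mem_gr_zero b (b 0)⟩
    rw [hκ] at this
    exact (smul_left_injective ℂ h0 this).symm
  have hψ1 : ψ ⟨h (b 1), h_mem_gr_zero b (b 1)⟩ = 0 := by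
    have := hs.weight ⟨h (b 1), h_mem_gr_zero b (b 1)⟩
    rw [hV.h_one_lie] at this
    exact (smul_eq_zero.mp this.symm).resolve_right h0
  refine ⟨fun h => hκ0 (by rw [← hψ0, h, LinearMap.zero_apply]), hψ1, ?_⟩
  -- The value at 0 is chosen so that, the determinant squaring to 1, the central term at `l = 0`
  -- fits the same formula in `levelOp_singular` as all other `l`.
  let f : ℤ → ℂ := fun k => if k = 0 then -(gdet (b 0) (b 1) : ℂ) * κ else
    k * ψ ⟨D (k • b 1), D_mem_gr_zero b k⟩
  have hf : ∀ k : ℤ, k ≠ 0 → f k = k * ψ ⟨D (k • b 1), D_mem_gr_zero b k⟩ := fun k hk => if_neg hk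
  have hf0 : κ = -(gdet (b 0) (b 1) : ℂ) * f 0 := by
    rw [show f 0 = -(gdet (b 0) (b 1) : ℂ) * κ from if_pos rfl]
    linear_combination (-κ) * gdet_sq_complex (b := b)
  have hlev := levelOp_singular hs (κ := κ) f hf hf0
  have hraise : ∀ k, opX b V s 1 k v = 0 := fun k => by
    rw [opX_apply]
    refine hs.raise ((s : ℤ) * 1) ?_ _ (D_mem_gr b _ _)
    rw [mul_one, unit_sq]; exact one_pos
  have := hV.2.2 (s * (d + -1))
  obtain ⟨Q, hQ, hQ0⟩ := exists_relation_of_finite (𝓥 (s * (d + -1)))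
    (fun m => opX b V s (-1) m v) (fun m => hX (-1) m d v hv)
  have hQf : aeval (zshift ℂ) Q f = 0 := by
    -- The relation holds only at index 0. Applying `X 1 k`, which kills `v`, translates it by `k`,
    -- so letting `k` vary gives the full recurrence for `f`.
    ext k
    have e1 := aeval_zshift_map (opX b V s 1 k) Q (fun m => opX b V s (-1) m v)
    have e2 : (fun m => opX b V s 1 k (opX b V s (-1) m v)) = fun m => LinearMap.toSpanSingleton ℂ V
        ((-((s : ℤ) * (gdet (b 0) (b 1) : ℂ))) • v) (f (m + k)) := by
      ext m
      rw [H.comm_one_neg_one, hraise, map_zero, zero_add, hlev, LinearMap.toSpanSingleton_apply,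
        smul_smul, mul_comm]
    rw [e2, aeval_zshift_map, aeval_zshift_translate] at e1
    have e3 := congrFun e1 0
    simp only [hQ0, map_zero, zero_add, LinearMap.toSpanSingleton_apply, smul_eq_zero, neg_eq_zero,
      gdet_ne_zero, h0, or_false] at e3
    exact e3
  obtain ⟨r, p, α, hα, hp⟩ := mem_expPolySpace_iff_exists.mp (mem_expPolySpace_of_annihilator hQ hQf)
  refine ⟨r, p, α, hα, fun k hk => ?_, ?_⟩
  · have hk' : (k : ℂ) ≠ 0 := by exact_mod_cast hk
    rw [← hp, hf k hk, mul_div_cancel_left₀ _ hk']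
  · rw [hψ0, hf0, hp 0]
    simp [coeff_zero_eq_eval_zero]

theorem InOZ.exists_isExpPoly_equiv (hV : InOZ b 𝓥)
    (hc : ∃ z ∈ LieAlgebra.center ℂ VirLike, ∃ c : ℂ, c ≠ 0 ∧ ∀ v : V, ⁅z, v⁆ = c • v) :
    ∃ (s : ℤˣ) (ψ : gr b 0 →ₗ[ℂ] ℂ), (s = 1 ∨ s = -1) ∧ IsExpPoly b ψ ∧
      Nonempty (V ≃ₗ⁅ℂ, VirLike⁆ IrrWt b s ψ) := by
  obtain ⟨κ, hκ0, hκ⟩ := hV.exists_level hc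
  obtain ⟨s, d, hs, hd, htop⟩ := hV.exists_extreme_degree hκ0 hκ
  obtain ⟨ψ, v, hv, h0, hsing⟩ := hV.exists_weight_singular hκ hd htop
  exact ⟨s, ψ, hs, hV.isExpPoly hκ0 hκ hv h0 hsing, hV.nonempty_equiv hv h0 hsing⟩

theorem inOZ_of_equiv [Nontrivial V] (hg : IsZGraded b 𝓥)
    (e : V ≃ₗ⁅ℂ, VirLike⁆ IrrWt b s ψ) (hψ : IsExpPoly b ψ) : InOZ b 𝓥 :=
  ⟨hg, ⟨inferInstance, fun N _ => (isIrreducible_of_equiv hg e).eq_bot_or_eq_top N⟩,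
    isQuasiFinite_of_equiv hg e hψ⟩

end VirLike

theorem corollary3p9 (b : Module.Basis (Fin 2) ℤ (ℤ × ℤ))
    {V : Type*} [AddCommGroup V] [Module ℂ V] [LieRingModule VirLike V] [LieModule ℂ VirLike V]
    [Nontrivial V] (𝓥 : ℤ → Submodule ℂ V) (h𝓥 : VirLike.IsZGraded b 𝓥)
    (hc : ∃ z ∈ LieAlgebra.center ℂ VirLike, ∃ c : ℂ, c ≠ 0 ∧ ∀ v : V, ⁅z, v⁆ = c • v) :
    (VirLike.InOZ b 𝓥 ↔
      ∃ ψ : VirLike.gr b 0 →ₗ[ℂ] ℂ, VirLike.IsExpPoly b ψ ∧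
        (Nonempty (V ≃ₗ⁅ℂ, VirLike⁆ VirLike.VhatPlus b ψ) ∨
          Nonempty (V ≃ₗ⁅ℂ, VirLike⁆ VirLike.VhatMinus b ψ))) ∧
    (VirLike.InOZ b 𝓥 → LieModule.IsIrreducible ℂ VirLike V) := by
  refine ⟨⟨fun hV => ?_, ?_⟩, fun hV => ?_⟩
  · obtain ⟨s, ψ, rfl | rfl, hψ, he⟩ := hV.exists_isExpPoly_equiv hc
    exacts [⟨ψ, hψ, Or.inl he⟩, ⟨ψ, hψ, Or.inr he⟩]
  · rintro ⟨ψ, hψ, ⟨⟨e⟩⟩ | ⟨⟨e⟩⟩⟩ <;> exact VirLike.inOZ_of_equiv h𝓥 e hψ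
  · obtain ⟨s, ψ, -, -, ⟨e⟩⟩ := hV.exists_isExpPoly_equiv hc
    exact VirLike.isIrreducible_of_equiv h𝓥 e
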